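/- Let $E_9$ be the digraph with vertices $a,b,c,d$ and arcs $ab, ba, ac, ca, bd, dc$. Digraphs are finite and have no loops and no parallel arcs. A dipath is a directed path with pairwise distinct vertices (possibly a single vertex). A subdivision of a digraph $F$ is a digraph obtained from $F$ by replacing each arc $xy$ of $F$ by a dipath from $x$ to $y$, where these dipaths have no internal vertices in common and their internal vertices are new; the vertex corresponding to $x$ is called its $x$-vertex. Then there is an algorithm (for a random access machine with words of $O(\log(n+m))$ bits) which, given a digraph $D$ with $n\ge 1$ vertices and $m$ arcs as the list of its arcs, decides in time $O(n^7(n+m))$ whether $D$ contains a subdivision of $E_9$ as a subdigraph. Moreover, the problem reduces to the detection of shunts. For sets $S,T$ of vertices of a digraph $H$, an $(S,T)$-shunt in $H$ consists of three dipaths $P,Q,R$ of $H$ such that $R$ has length at least $2$, its initial vertex lies on $P$, its terminal vertex lies on $Q$, the paths $P$, $Q$ and the path formed by the internal vertices of $R$ are pairwise disjoint, the initial vertices of $P$ and $Q$ form the set $S$, and their terminal vertices form the set $T$. For every digraph $D$ and every vertex $v$ of $D$, there is a subdivision of $E_9$ in $D$ whose $a$-vertex is $v$ if and only if there are two distinct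 outneighbours $s_1,s_2$ of $v$ and two distinct inneighbours $t_1,t_2$ of $v$ (where $\{s_1,s_2\}$ and $\{t_1,t_2\}$ may intersect) such that $D-v$ contains an $(\{s_1,s_2\},\{t_1,t_2\})$-shunt. -/

import Mathlib

/-! ### Dipaths and subdivisions -/

/-- `p` is the vertex sequence of a directed path of `D` from `u` to `v`: its vertices are distinct
and consecutive ones are joined by an arc. Its length is `p.length - 1`, which may be zero. -/
def IsDipath {V : Type*} (D : Digraph V) (u v : V) (p : List V) : Prop :=
  p.IsChain D.Adj ∧ p.Nodup ∧ p.head? = some u ∧ p.getLast? = some v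

/-- The internal vertices of a path: all but the first one and the last one. -/
def internalVertices {V : Type*} (p : List V) : List V := p.tail.dropLast

/-- A subdivision of the loopless digraph `F` that is a subdigraph of `D`: every vertex `a` of `F`
is placed on its own vertex of `D` (the `a`-vertex of the subdivision), and every arc `ab` of `F` is
replaced by a dipath of `D` from the `a`-vertex to the `b`-vertex. The internal vertices of these
dipaths are new, and distinct arcs have dipaths without common internal vertices. -/
structure Subdivision {W V : Type*} (F : Digraph W) (D : Digraph V) where
  /-- The vertex of `D` that corresponds to a vertex of `F`. -/
  vertex : W → V
  /-- The dipath that replaces the arc `ab`; irrelevant when `ab` is not an arc. -/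
  path : W → W → List V
  vertex_injective : Function.Injective vertex
  isDipath : ∀ a b, F.Adj a b → IsDipath D (vertex a) (vertex b) (path a b)
  interior_new : ∀ a b, F.Adj a b → ∀ c, vertex c ∉ internalVertices (path a b)
  interior_disjoint : ∀ a b c d, F.Adj a b → F.Adj c d → (a, b) ≠ (c, d) →
    (internalVertices (path a b)).Disjoint (internalVertices (path c d))

/-- The digraph `E₉`, with `a = 0`, `b = 1`, `c = 2`, `d = 3`. Its arcs are `ab`, `ba`, `ac`, `ca`,
`bd` and `dc`. -/
def E9 : Digraph (Fin 4) where
  Adj x y := (x, y) ∈ [((0 : Fin 4), (1 : Fin 4)), (1, 0), (0, 2), (2, 0), (1, 3), (3, 2)]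

/-- `D` has an `(S, T)`-shunt: three dipaths `P`, `Q`, `R` such that `R` has length at least `2`,
starts on `P` and ends on `Q`; the paths `P`, `Q` and the interior of `R` are pairwise disjoint;
the initial vertices of `P` and `Q` form `S` and their terminal vertices form `T`. -/
def HasShunt {V : Type*} (D : Digraph V) (S T : Set V) : Prop :=
  ∃ (p p' q q' r r' : V) (P Q R : List V),
    IsDipath D p p' P ∧ IsDipath D q q' Q ∧ IsDipath D r r' R ∧
    3 ≤ R.length ∧ r ∈ P ∧ r' ∈ Q ∧
    P.Disjoint Q ∧ P.Disjoint (internalVertices R) ∧ Q.Disjoint (internalVertices R) ∧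
    ({p, q} : Set V) = S ∧ ({p', q'} : Set V) = T

/-- The digraph `D - v`. -/
def deleteVertex {V : Type*} (D : Digraph V) (v : V) : Digraph {x : V // x ≠ v} where
  Adj x y := D.Adj x y

/-! ### Random access machines -/

namespace RAM

/-- The memory of a machine: registers, and arrays of cells. A program names the registers and the
arrays that it uses, so each program has only finitely many of them. -/
structure State where
  /-- The content of a register. -/
  reg : ℕ → ℕ
  /-- The content of a cell, given by an array and an index. -/
  mem : ℕ → ℕ → ℕ

/-- Write a register. -/
def State.setReg (σ : State) (i x : ℕ) : State where
  reg := Function.update σ.reg i x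
  mem := σ.mem

/-- Write a cell. -/
def State.setMem (σ : State) (a j x : ℕ) : State where
  reg := σ.reg
  mem := Function.update σ.mem a (Function.update (σ.mem a) j x)

/-- Programs of a random access machine, in structured form. -/
inductive Program where
  /-- Do nothing. -/
  | skip
  /-- `reg i := c`. -/
  | const (i c : ℕ)
  /-- `reg i := reg j`. -/
  | copy (i j : ℕ)
  /-- `reg i := reg j + reg k`. -/
  | add (i j k : ℕ)
  /-- `reg i := reg j - reg k`, and `0` if this is negative. -/
  | sub (i j k : ℕ)
  /-- `reg i := mem a [reg j]`. -/
  | load (i a j : ℕ)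
  /-- `mem a [reg j] := reg i`. -/
  | store (a j i : ℕ)
  /-- First `p`, then `q`. -/
  | seq (p q : Program)
  /-- If `reg i ≠ 0` then `p`, else `q`. -/
  | cond (i : ℕ) (p q : Program)
  /-- While `reg i ≠ 0` do `p`. -/
  | loop (i : ℕ) (p : Program)

/-- `Exec w p σ t τ`: started in `σ`, the program `p` halts in `τ` after exactly `t` steps, on a
machine whose words are the natural numbers up to `w`. Every instruction and every test of a
register takes one step. An operation whose result exceeds `w` is not executed: the machine gets
stuck, and there is no halting run. -/
inductive Exec (w : ℕ) : Program → State → ℕ → State → Prop where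
  | skip (σ) : Exec w .skip σ 1 σ
  | const (σ i c) : c ≤ w → Exec w (.const i c) σ 1 (σ.setReg i c)
  | copy (σ i j) : Exec w (.copy i j) σ 1 (σ.setReg i (σ.reg j))
  | add (σ i j k) : σ.reg j + σ.reg k ≤ w →
      Exec w (.add i j k) σ 1 (σ.setReg i (σ.reg j + σ.reg k))
  | sub (σ i j k) : Exec w (.sub i j k) σ 1 (σ.setReg i (σ.reg j - σ.reg k))
  | load (σ i a j) : Exec w (.load i a j) σ 1 (σ.setReg i (σ.mem a (σ.reg j)))
  | store (σ a j i) : Exec w (.store a j i) σ 1 (σ.setMem a (σ.reg j) (σ.reg i))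
  | seq {p q σ τ ρ s t} : Exec w p σ s τ → Exec w q τ t ρ → Exec w (.seq p q) σ (s + t) ρ
  | cond_true {i p q σ t τ} : σ.reg i ≠ 0 → Exec w p σ t τ → Exec w (.cond i p q) σ (1 + t) τ
  | cond_false {i p q σ t τ} : σ.reg i = 0 → Exec w q σ t τ → Exec w (.cond i p q) σ (1 + t) τ
  | loop_true {i p σ s τ t ρ} : σ.reg i ≠ 0 → Exec w p σ s τ → Exec w (.loop i p) τ t ρ →
      Exec w (.loop i p) σ (1 + s + t) ρ
  | loop_false {i p σ} : σ.reg i = 0 → Exec w (.loop i p) σ 1 σ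

/-- The initial state for a digraph on the vertices `0, …, n - 1` with the given list of arcs:
register `0` holds the number of vertices, register `1` the number of arcs, and cell `j` of
array `0` (of array `1`) the tail (the head) of the `j`-th arc. All the rest is zero. -/
def input (n : ℕ) (arcs : List (Fin n × Fin n)) : State where
  reg i := if i = 0 then n else if i = 1 then arcs.length else 0
  mem a j :=
    if a = 0 then (arcs.map fun e => (e.1 : ℕ)).getD j 0
    else if a = 1 then (arcs.map fun e => (e.2 : ℕ)).getD j 0
    else 0

/-- The property `Q` of finite simple digraphs (no loops, no parallel arcs) can be decided in time
`O(f n m)`, where `n` and `m` are the numbers of vertices and of arcs: one program, on words of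
`O(log (n + m))` bits, halts for every digraph and every list of its arcs with the answer `1`
(yes) or `0` (no) in register `0`, after at most `C * f n m` steps if there is a vertex. -/
def SolvableInTime (Q : (n : ℕ) → Digraph (Fin n) → Prop) (f : ℕ → ℕ → ℕ) : Prop :=
  ∃ (p : Program) (k C : ℕ), ∀ (n : ℕ) (D : Digraph (Fin n)) (arcs : List (Fin n × Fin n)),
    (∀ v, ¬ D.Adj v v) → arcs.Nodup → (∀ u v, (u, v) ∈ arcs ↔ D.Adj u v) →
    ∃ (t : ℕ) (τ : State),
      Exec ((n + arcs.length + 2) ^ k) p (input n arcs) t τ ∧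
      (Q n D → τ.reg 0 = 1) ∧ (¬ Q n D → τ.reg 0 = 0) ∧
      (0 < n → t ≤ C * f n arcs.length)

end RAM

/-! ### Walks inside a set of vertices -/

/-! In a subdivision of `E9` with a-vertex `v`, the paths for ba and ab meet only in the b-vertex
and `v`; without `v` they form a dipath P through the b-vertex. Likewise those for ac and ca form a
dipath Q through the c-vertex, and those for bd and dc form a path R of length at least 2 from P to
Q. This is a shunt of D − v, and the reading can be reversed (`exists_subdivision_iff_hasShunt`).
Throughout, paths are replaced by walks inside disjoint sets of vertices (`SetShunt`), which are
easier to recombine.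

To decide whether there is a shunt from S to T, both with two elements, one looks at the pairs of
vertices that separate S from T (`Cut`). If no single vertex separates, Menger's theorem
(`twoDisjoint_of_forall_conn`) gives two disjoint paths P, Q from S to T, and every separating pair
has one vertex on each. Call a vertex critical if it is in a separating pair (`OnCut`). Partners are
critical vertices that share the other vertex of a pair, so they lie on the same path for every
choice of P and Q. Links are arcs between useful vertices that are not both critical, read in either
direction. The criterion `setShunt_iff` says that a shunt exists exactly when some two critical
vertices are joined by a chain of links but by no chain of partners.

Given a shunt, the last critical vertex on the way to R and the first one after R are such vertices
(`SetShunt.criterion`). Conversely, let there be no shunt. Then a walk from P to Q outside of both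
can only be a single arc (`no_ear`), and the ends of an arc between P and Q are critical
(`onCut_of_cross`). So links never change sides, and critical vertices joined by links are on the
same path for every choice of P and Q. Such vertices are joined by partners (`transGen_partner`):
where the chain of partners breaks off, there are arcs in both directions between P and Q along
which the two paths can exchange their final parts, and this would put the two vertices on different
paths.

The core is `mem_of_not_conn`, which yields `onCut_of_cross`: a vertex that the first path cannot
avoid is on every other pair of paths. A second pair that changes sides must do so along two
crossing arcs; their tails separate S from T, and induction applies beyond them.

For the running time, reachability after the deletion of any three vertices is tabulated by n³ runs
of Warshall's algorithm. Then, for each of the n⁵ choices of v, S and T, the links, the partners and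
their transitive closures take O(n³) steps. The total O(n⁸) is within O(n⁷(n + m)). The algorithm is
written in a small language of loops over tables, whose nesting depth is the exponent in the time
bound of its compiled code. -/

/-- There is a walk from `u` to `v` all of whose vertices lie in `X`. -/
def Conn {V : Type*} (E : V → V → Prop) (X : Set V) (u v : V) : Prop :=
  u ∈ X ∧ Relation.ReflTransGen (fun a b => E a b ∧ b ∈ X) u v

namespace Conn

variable {V : Type*} {E : V → V → Prop} {X Y : Set V} {u v w : V}

theorem refl (h : u ∈ X) : Conn E X u u := ⟨h, .refl⟩

theorem left_mem (h : Conn E X u v) : u ∈ X := h.1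

theorem right_mem (h : Conn E X u v) : v ∈ X := by
  rcases h.2.cases_tail with rfl | ⟨_, _, h'⟩
  · exact h.1
  · exact h'.2

theorem trans (h : Conn E X u v) (h' : Conn E X v w) : Conn E X u w := ⟨h.1, h.2.trans h'.2⟩

theorem mono (h : Conn E X u v) (hXY : X ⊆ Y) : Conn E Y u v :=
  ⟨hXY h.1, Relation.ReflTransGen.mono (fun _ _ h => ⟨h.1, hXY h.2⟩) _ _ h.2⟩

theorem snoc (h : Conn E X u v) (e : E v w) (hw : w ∈ X) : Conn E X u w :=
  ⟨h.1, h.2.tail ⟨e, hw⟩⟩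

theorem cons (h : Conn E X v w) (hu : u ∈ X) (e : E u v) : Conn E X u w :=
  ⟨hu, .head ⟨e, h.1⟩ h.2⟩

@[elab_as_elim]
theorem tail_induction {motive : ∀ v, Conn E X u v → Prop} (h : Conn E X u v)
    (base : ∀ hu, motive u hu)
    (step : ∀ a b (ha : Conn E X u a) (e : E a b) (hb : b ∈ X), motive a ha →
      motive b (ha.snoc e hb)) : motive v h := by
  obtain ⟨hu, h⟩ := h
  induction h with
  | refl => exact base _
  | tail h e ih => exact step _ _ ⟨hu, h⟩ e.1 e.2 ih

@[elab_as_elim]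
theorem head_induction {motive : ∀ u, Conn E X u v → Prop} (h : Conn E X u v)
    (base : ∀ hv, motive v hv)
    (step : ∀ a b (ha : a ∈ X) (e : E a b) (hb : Conn E X b v), motive b hb →
      motive a (hb.cons ha e)) : motive u h := by
  obtain ⟨hu, h⟩ := h
  revert hu
  induction h using Relation.ReflTransGen.head_induction_on with
  | refl => exact fun _ => base _
  | head e h ih => exact fun hu => step _ _ hu e.1 ⟨e.2, h⟩ (ih e.2)

/-- Either the walk avoids `Y`, or it has a first vertex in `Y`. -/
theorem first_hit (Y : Set V) (h : Conn E X u v) :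
    Conn E (X \ Y) u v ∨ ∃ y ∈ Y, y ∈ X ∧ Conn E X y v ∧
      (u = y ∨ ∃ p, Conn E (X \ Y) u p ∧ E p y) := by
  induction h using head_induction with
  | base h =>
    by_cases hy : v ∈ Y
    · exact .inr ⟨v, hy, h.1, h, .inl rfl⟩
    · exact .inl (refl ⟨h.1, hy⟩)
  | step a b ha e hb ih =>
    by_cases hy : a ∈ Y
    · exact .inr ⟨a, hy, ha, hb.cons ha e, .inl rfl⟩
    · rcases ih with ih | ⟨y, hy', hyX, hyv, rfl | ⟨p, hp, ep⟩⟩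
      · exact .inl (ih.cons ⟨ha, hy⟩ e)
      · exact .inr ⟨b, hy', hyX, hyv, .inr ⟨a, refl ⟨ha, hy⟩, e⟩⟩
      · exact .inr ⟨y, hy', hyX, hyv, .inr ⟨p, hp.cons ⟨ha, hy⟩ e, ep⟩⟩

/-- Either the walk avoids `Y`, or it has a last vertex in `Y`. -/
theorem last_hit (Y : Set V) (h : Conn E X u v) :
    Conn E (X \ Y) u v ∨ ∃ y ∈ Y, y ∈ X ∧ Conn E X u y ∧
      (y = v ∨ ∃ p, E y p ∧ Conn E (X \ Y) p v) := by
  induction h using tail_induction with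
  | base h =>
    by_cases hy : u ∈ Y
    · exact .inr ⟨u, hy, h.1, refl h.1, .inl rfl⟩
    · exact .inl (refl ⟨h.1, hy⟩)
  | step a b ha e hb ih =>
    by_cases hy : b ∈ Y
    · exact .inr ⟨b, hy, hb, snoc ha e hb, .inl rfl⟩
    · rcases ih with ih | ⟨y, hy', hyX, hyv, rfl | ⟨p, ep, hp⟩⟩
      · exact .inl (snoc ih e ⟨hb, hy⟩)
      · exact .inr ⟨y, hy', hyX, hyv, .inr ⟨b, e, refl ⟨hb, hy⟩⟩⟩
      · exact .inr ⟨y, hy', hyX, hyv, .inr ⟨p, ep, snoc hp e ⟨hb, hy⟩⟩⟩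

theorem first_hit_of_mem (h : Conn E X u v) (hv : v ∈ Y) : ∃ y ∈ Y, y ∈ X ∧ Conn E X y v ∧
      (u = y ∨ ∃ p, Conn E (X \ Y) u p ∧ E p y) :=
  (h.first_hit Y).resolve_left fun h' => h'.right_mem.2 hv

theorem last_hit_of_mem (h : Conn E X u v) (hu : u ∈ Y) : ∃ y ∈ Y, y ∈ X ∧ Conn E X u y ∧
      (y = v ∨ ∃ p, E y p ∧ Conn E (X \ Y) p v) :=
  (h.last_hit Y).resolve_left fun h' => h'.left_mem.2 hu

/-- A walk between distinct vertices may be taken to leave its start at once and for ever. -/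
theorem exists_out (h : Conn E X u v) (huv : u ≠ v) :
    ∃ p, E u p ∧ Conn E (X \ {u}) p v := by
  obtain ⟨y, rfl, -, -, rfl | h⟩ := h.last_hit_of_mem (Y := {u}) rfl
  · exact absurd rfl huv
  · exact h

theorem exists_in (h : Conn E X u v) (huv : u ≠ v) :
    ∃ p, Conn E (X \ {v}) u p ∧ E p v := by
  obtain ⟨y, rfl, -, -, rfl | h⟩ := h.first_hit_of_mem (Y := {v}) rfl
  · exact absurd rfl huv
  · exact h

theorem reachable (h : Conn E X u v) : Conn E {x | Conn E X u x} u v := by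
  induction h using tail_induction with
  | base h => exact refl h
  | step a b ha e hb ih => exact ih.snoc e (ha.snoc e hb)

/-- Vertices are deleted by dropping the arcs whose head lies outside `Y`, without changing the
vertex type. In the smaller digraph only the first vertex of a walk can be outside `Y`, whence the
extra hypothesis in `of_restrict`. -/
theorem restrict (h : Conn E X u v) (hXY : X ⊆ Y) : Conn (fun a b => E a b ∧ b ∈ Y) X u v :=
  ⟨h.1, Relation.ReflTransGen.mono (fun _ _ h => ⟨⟨h.1, hXY h.2⟩, h.2⟩) _ _ h.2⟩

theorem of_restrict (h : Conn (fun a b => E a b ∧ b ∈ Y) X u v) (hu : u ∈ Y) :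
    Conn E (X ∩ Y) u v :=
  ⟨⟨h.1, hu⟩, Relation.ReflTransGen.mono (fun _ _ h => ⟨h.1.1, h.2, h.1.2⟩) _ _ h.2⟩

theorem exists_isDipath {D : Digraph V} (h : Conn D.Adj X u v) :
    ∃ l : List V, IsDipath D u v l ∧ ∀ x ∈ l, x ∈ X := by
  induction h using head_induction with
  | base h => exact ⟨[v], by simp [IsDipath], by simpa using h.1⟩
  | step a b ha e hb ih =>
    obtain ⟨l, ⟨hc, hn, hh, hl⟩, hX⟩ := ih
    by_cases hal : a ∈ l
    · obtain ⟨l₁, l₂, rfl⟩ := List.append_of_mem hal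
      refine ⟨a :: l₂, ⟨?_, ?_, rfl, ?_⟩, ?_⟩
      · exact (List.isChain_append.1 hc).2.1
      · exact (List.nodup_append.1 hn).2.1
      · rw [← hl, List.getLast?_append]; simp [List.getLast?_cons]
      · intro x hx; exact hX x (List.mem_append_right _ hx)
    · refine ⟨a :: l, ⟨?_, List.nodup_cons.2 ⟨hal, hn⟩, rfl, ?_⟩, ?_⟩
      · rw [List.isChain_cons]
        refine ⟨fun y hy => ?_, hc⟩
        rw [hh] at hy; cases hy; exact e
      · cases l with
        | nil => simp at hh
        | cons c l => rw [List.getLast?_cons_cons]; exact hl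
      · intro x hx
        rcases List.mem_cons.1 hx with rfl | hx
        · exact ha
        · exact hX x hx

end Conn

theorem List.IsChain.conn {V : Type*} {E : V → V → Prop} {l : List V} (h : l.IsChain E)
    (i j : ℕ) (hij : i ≤ j) (hj : j < l.length) :
    Conn E {z | ∃ k, ∃ hk : k < l.length, l[k] = z ∧ i ≤ k ∧ k ≤ j} l[i] l[j] := by
  induction j, hij using Nat.le_induction with
  | base => exact .refl ⟨i, hj, rfl, le_rfl, le_rfl⟩
  | succ j hij ih =>
    refine ((ih (by omega)).mono ?_).snoc (List.isChain_iff_getElem.1 h j hj) ⟨_, hj, rfl, by omega, le_rfl⟩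
    rintro z ⟨k, hk, rfl, h1, h2⟩
    exact ⟨k, hk, rfl, h1, by omega⟩

/-! ### Ordered paths -/

/-- A path from `s` to `t`, given as a set of vertices that is ordered by a rank function. -/
structure OPath {V : Type*} (E : V → V → Prop) (s t : V) where
  /-- The vertices of the path. -/
  verts : Set V
  /-- The order of the vertices. -/
  rk : V → ℕ
  inj : ∀ x ∈ verts, ∀ y ∈ verts, rk x = rk y → x = y
  left_mem : s ∈ verts
  right_mem : t ∈ verts
  left_le : ∀ x ∈ verts, rk s ≤ rk x
  le_right : ∀ x ∈ verts, rk x ≤ rk t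
  seg : ∀ x ∈ verts, ∀ y ∈ verts, rk x ≤ rk y →
    Conn E {z | z ∈ verts ∧ rk x ≤ rk z ∧ rk z ≤ rk y} x y

theorem IsDipath.exists_opath {V : Type*} {D : Digraph V} {u v : V} {l : List V}
    (h : IsDipath D u v l) : ∃ P : OPath D.Adj u v, P.verts = {x | x ∈ l} := by
  classical
  obtain ⟨hc, hn, hh, hl⟩ := h
  have hne : l ≠ [] := by rintro rfl; simp at hh
  have hpos : 0 < l.length := List.length_pos_iff.2 hne
  have hu : l[0] = u := by
    rw [List.head?_eq_getElem?, List.getElem?_eq_getElem hpos] at hh; exact Option.some.inj hh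
  have hv : l[l.length - 1] = v := by
    rw [List.getLast?_eq_getElem?, List.getElem?_eq_getElem (by omega)] at hl
    exact Option.some.inj hl
  have hid : ∀ k (hk : k < l.length), l.idxOf l[k] = k := fun k hk => hn.idxOf_getElem k hk
  have hum : u ∈ l := hu ▸ List.getElem_mem _
  have hvm : v ∈ l := hv ▸ List.getElem_mem _
  refine ⟨⟨{x | x ∈ l}, l.idxOf, ?_, hum, hvm, ?_, ?_, ?_⟩, rfl⟩
  · intro x hx y hy hxy
    exact (List.idxOf_inj hx).1 hxy
  · intro x hx
    rw [← hu, hid]; omega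
  · intro x hx
    rw [← hv, hid]
    have := List.idxOf_lt_length_of_mem hx
    omega
  · intro x hx y hy hxy
    have h1 := List.idxOf_lt_length_of_mem hx
    have h2 := List.idxOf_lt_length_of_mem hy
    have := hc.conn _ _ hxy h2
    rw [List.getElem_idxOf, List.getElem_idxOf] at this
    refine this.mono ?_
    rintro z ⟨k, hk, rfl, h3, h4⟩
    exact ⟨List.getElem_mem _, by rw [hid]; exact h3, by rw [hid]; exact h4⟩

theorem Conn.exists_opath {V : Type*} {E : V → V → Prop} {X : Set V} {u v : V}
    (h : Conn E X u v) : ∃ P : OPath E u v, P.verts ⊆ X := by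
  obtain ⟨l, hl, hX⟩ := Conn.exists_isDipath (D := ⟨E⟩) h
  obtain ⟨P, hP⟩ := hl.exists_opath
  exact ⟨P, by rw [hP]; exact hX⟩

namespace OPath

variable {V : Type*} {E : V → V → Prop} {s t : V} (P : OPath E s t)

theorem conn_to {x : V} (hx : x ∈ P.verts) : Conn E {z | z ∈ P.verts ∧ P.rk z ≤ P.rk x} s x :=
  (P.seg s P.left_mem x hx (P.left_le x hx)).mono fun _ h => ⟨h.1, h.2.2⟩

theorem conn_from {x : V} (hx : x ∈ P.verts) : Conn E {z | z ∈ P.verts ∧ P.rk x ≤ P.rk z} x t :=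
  (P.seg x hx t P.right_mem (P.le_right x hx)).mono fun _ h => ⟨h.1, h.2.1⟩

theorem conn : Conn E P.verts s t := (P.conn_to P.right_mem).mono fun _ h => h.1

theorem rk_lt {x y : V} (hx : x ∈ P.verts) (hy : y ∈ P.verts) (h : P.rk x ≤ P.rk y)
    (hxy : x ≠ y) : P.rk x < P.rk y :=
  lt_of_le_of_ne h fun e => hxy (P.inj x hx y hy e)

theorem exists_pred {x : V} (hx : x ∈ P.verts) (hs : s ≠ x) :
    ∃ p, E p x ∧ Conn E {z | z ∈ P.verts ∧ P.rk z < P.rk x} s p := by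
  obtain ⟨p, hp, e⟩ := (P.conn_to hx).exists_in hs
  exact ⟨p, e, hp.mono fun z hz => ⟨hz.1.1, P.rk_lt hz.1.1 hx hz.1.2 hz.2⟩⟩

theorem exists_succ {x : V} (hx : x ∈ P.verts) (hs : x ≠ t) :
    ∃ p, E x p ∧ Conn E {z | z ∈ P.verts ∧ P.rk x < P.rk z} p t := by
  obtain ⟨p, e, hp⟩ := (P.conn_from hx).exists_out hs
  exact ⟨p, e, hp.mono fun z hz => ⟨hz.1.1, P.rk_lt hx hz.1.1 hz.1.2 (Ne.symm hz.2)⟩⟩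

theorem exists_between {a z d : V} (ha : a ∈ P.verts) (hz : z ∈ P.verts) (hd : d ∈ P.verts)
    (haz : P.rk a < P.rk z) (hzd : P.rk z < P.rk d) :
    ∃ x y, E a x ∧ Conn E {z | z ∈ P.verts ∧ P.rk a < P.rk z ∧ P.rk z < P.rk d} x y ∧ E y d := by
  obtain ⟨x, ex, hx⟩ := (P.seg a ha z hz haz.le).exists_out (by rintro rfl; omega)
  obtain ⟨y, hy, ey⟩ := (P.seg z hz d hd hzd.le).exists_in (by rintro rfl; omega)
  refine ⟨x, y, ex, (hx.mono ?_).trans (hy.mono ?_), ey⟩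
  · intro w hw
    exact ⟨hw.1.1, P.rk_lt ha hw.1.1 hw.1.2.1 (Ne.symm hw.2), by have := hw.1.2.2; omega⟩
  · intro w hw
    exact ⟨hw.1.1, by have := hw.1.2.1; omega, P.rk_lt hw.1.1 hd hw.1.2.2 hw.2⟩

/-- The final part of a path. -/
def suffix {d : V} (hd : d ∈ P.verts) : OPath E d t where
  verts := {z | z ∈ P.verts ∧ P.rk d ≤ P.rk z}
  rk := P.rk
  inj x hx y hy := P.inj x hx.1 y hy.1
  left_mem := ⟨hd, le_rfl⟩
  right_mem := ⟨P.right_mem, P.le_right d hd⟩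
  left_le _ hx := hx.2
  le_right x hx := P.le_right x hx.1
  seg x hx y hy h := (P.seg x hx.1 y hy.1 h).mono
    fun _ hz => ⟨⟨hz.1, hx.2.trans hz.2.1⟩, hz.2⟩

/-- A path within `X`, as a path of the digraph without the arcs that do not end in `X`. -/
def restrict {X : Set V} (h : P.verts ⊆ X) : OPath (fun a b => E a b ∧ b ∈ X) s t where
  verts := P.verts
  rk := P.rk
  inj := P.inj
  left_mem := P.left_mem
  right_mem := P.right_mem
  left_le := P.left_le
  le_right := P.le_right
  seg x hx y hy h' := (P.seg x hx y hy h').restrict fun _ hz => h hz.1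

end OPath

/-! ### Two disjoint paths -/

section Menger

variable {V : Type*} {E : V → V → Prop} {S T : Set V}

/-- There are two disjoint walks from `S` to `T`. -/
def TwoDisjoint (E : V → V → Prop) (S T : Set V) : Prop :=
  ∃ A B : Set V, Disjoint A B ∧ (∃ s ∈ S, ∃ t ∈ T, Conn E A s t) ∧
    ∃ s ∈ S, ∃ t ∈ T, Conn E B s t

/-- Every vertex of `A` can be reached from `S` inside `A`. -/
def Rooted (E : V → V → Prop) (S A : Set V) : Prop := ∀ z ∈ A, ∃ s ∈ S, Conn E A s z

/-- Two sets that carry walks from `S` to `p`, disjoint from each other and from the path `P`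
from `p` on. -/
structure TwoWalksTo {s₀ t₀ : V} (S : Set V) (P : OPath E s₀ t₀) (p : V) (A B : Set V) :
    Prop where
  disj : Disjoint A B
  left_lt : ∀ z ∈ A, z ∈ P.verts → P.rk z < P.rk p
  right_lt : ∀ z ∈ B, z ∈ P.verts → P.rk z < P.rk p
  left_rooted : Rooted E S A
  right_rooted : Rooted E S B
  left_conn : ∃ s ∈ S, Conn E (insert p A) s p
  right_conn : ∃ s ∈ S, Conn E (insert p B) s p

theorem TwoWalksTo.symm {s₀ t₀ p : V} {P : OPath E s₀ t₀} {A B : Set V}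
    (h : TwoWalksTo S P p A B) : TwoWalksTo S P p B A :=
  ⟨h.disj.symm, h.right_lt, h.left_lt, h.right_rooted, h.left_rooted, h.right_conn, h.left_conn⟩

/-- A walk that leaves `A` yields two disjoint walks, or two walks to a later vertex. -/
theorem TwoWalksTo.extend {s₀ t₀ p : V} {P : OPath E s₀ t₀} {A B : Set V}
    (h : TwoWalksTo S P p A B) (hp : p ∈ P.verts) (ht₀ : t₀ ∈ T) {w t : V} (ht : t ∈ T)
    (hw : ∀ X, A ⊆ X → w ∈ X → ∃ s ∈ S, Conn E X s w)
    (hwt : Conn E ({p}ᶜ \ (A ∪ B)) w t) :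
    TwoDisjoint E S T ∨ ∃ q ∈ P.verts, P.rk p < P.rk q ∧ ∃ A' B', TwoWalksTo S P q A' B' := by
  -- The walk from `w` is followed only up to its first vertex on `P` after `p`. What it reaches
  -- until then, `G`, is added to `A`.
  set F := ({p}ᶜ \ (A ∪ B)) \ {z | z ∈ P.verts ∧ P.rk p < P.rk z} with hF
  set G := {x | Conn E F w x} with hG
  have hGF : ∀ x ∈ G, x ∈ F := fun x hx => Conn.right_mem hx
  have hFP : ∀ x ∈ F, x ∈ P.verts → P.rk x < P.rk p := by
    rintro x ⟨⟨hx1, -⟩, hx2⟩ hxP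
    exact P.rk_lt hxP hp (not_lt.1 fun h => hx2 ⟨hxP, h⟩) hx1
  have root : ∀ x, Conn E F w x → ∃ s ∈ S, Conn E (A ∪ G) s x := by
    intro x hx
    obtain ⟨s, hs, hsw⟩ := hw (A ∪ G) Set.subset_union_left (.inr (.refl hx.1))
    exact ⟨s, hs, hsw.trans (hx.reachable.mono Set.subset_union_right)⟩
  have hpB : p ∉ B := fun hb => lt_irrefl _ (h.right_lt p hb hp)
  rcases hwt.first_hit {z | z ∈ P.verts ∧ P.rk p < P.rk z} with h1 | ⟨y, ⟨hyP, hpy⟩, hyX, -, h1⟩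
  -- The walk never meets the rest of `P`: it ends one path, and `P` from `p` on ends the other.
  · left
    obtain ⟨s, hs, hst⟩ := root t h1
    obtain ⟨s', hs', hsp⟩ := h.right_conn
    refine ⟨A ∪ G, insert p B ∪ {z | z ∈ P.verts ∧ P.rk p ≤ P.rk z}, ?_, ⟨s, hs, t, ht, hst⟩,
      s', hs', t₀, ht₀, (hsp.mono Set.subset_union_left).trans
        ((P.conn_from hp).mono Set.subset_union_right)⟩
    rw [Set.disjoint_left]
    rintro x (hx | hx) ((rfl | hxB) | ⟨hxP, hx2⟩)
    · exact lt_irrefl _ (h.left_lt x hx hp)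
    · exact Set.disjoint_left.1 h.disj hx hxB
    · exact absurd (h.left_lt x hx hxP) (not_lt.2 hx2)
    · exact (hGF x hx).1.1 rfl
    · exact (hGF x hx).1.2 (.inr hxB)
    · exact absurd (hFP x (hGF x hx) hxP) (not_lt.2 hx2)
  · right
    -- The walk meets `P` first in `y`. One route to `y` is `A` with the walk, the other one is `B`
    -- with the stretch of `P` from `p` to `y`.
    set J := {z | z ∈ P.verts ∧ P.rk p ≤ P.rk z ∧ P.rk z < P.rk y} with hJ
    have hpJ : p ∈ J := ⟨hp, le_rfl, hpy⟩
    have hins : insert p B ⊆ B ∪ J := by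
      rintro x (rfl | hx)
      · exact .inr hpJ
      · exact .inl hx
    obtain ⟨s', hs', hsp⟩ := h.right_conn
    refine ⟨y, hyP, hpy, A ∪ G, B ∪ J, ?_, ?_, ?_, ?_, ?_, ?_, ?_⟩
    · rw [Set.disjoint_left]
      rintro x (hx | hx) (hxB | ⟨hxP, hx2, -⟩)
      · exact Set.disjoint_left.1 h.disj hx hxB
      · exact absurd (h.left_lt x hx hxP) (not_lt.2 hx2)
      · exact (hGF x hx).1.2 (.inr hxB)
      · exact absurd (hFP x (hGF x hx) hxP) (not_lt.2 hx2)
    · rintro x (hx | hx) hxP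
      · exact (h.left_lt x hx hxP).trans hpy
      · exact (hFP x (hGF x hx) hxP).trans hpy
    · rintro x (hx | hx) hxP
      · exact (h.right_lt x hx hxP).trans hpy
      · exact hx.2.2
    · rintro x (hx | hx)
      · obtain ⟨s, hs, hsx⟩ := h.left_rooted x hx
        exact ⟨s, hs, hsx.mono Set.subset_union_left⟩
      · exact root x hx
    · rintro x (hx | hx)
      · obtain ⟨s, hs, hsx⟩ := h.right_rooted x hx
        exact ⟨s, hs, hsx.mono Set.subset_union_left⟩
      · refine ⟨s', hs', (hsp.mono hins).trans ((P.seg p hp x hx.1 hx.2.1).mono ?_)⟩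
        exact fun z hz => .inr ⟨hz.1, hz.2.1, hz.2.2.trans_lt hx.2.2⟩
    · rcases h1 with rfl | ⟨q, hq, e⟩
      · exact hw _ (Set.subset_union_left.trans (Set.subset_insert _ _)) (Set.mem_insert _ _)
      · obtain ⟨s, hs, hsq⟩ := root q hq
        exact ⟨s, hs, (hsq.mono (Set.subset_insert _ _)).snoc e (Set.mem_insert _ _)⟩
    · refine ⟨s', hs', (hsp.mono (hins.trans (Set.subset_insert _ _))).trans
        ((P.seg p hp y hyP hpy.le).mono ?_)⟩
      intro z hz
      by_cases hzy : z = y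
      · exact .inl hzy
      · exact .inr (.inr ⟨hz.1, hz.2.1, P.rk_lt hz.1 hyP hz.2.2 hzy⟩)

theorem TwoWalksTo.twoDisjoint_of_end {s₀ t₀ p : V} {P : OPath E s₀ t₀} {A B : Set V}
    (h : TwoWalksTo S P p A B) (hp : p ∈ P.verts) (ht₀ : t₀ ∈ T) {t : V} (ht : t ∈ T)
    (htA : t ∈ A) : TwoDisjoint E S T := by
  obtain ⟨s, hs, hst⟩ := h.left_rooted t htA
  obtain ⟨s', hs', hsp⟩ := h.right_conn
  refine ⟨A, insert p B ∪ {z | z ∈ P.verts ∧ P.rk p ≤ P.rk z}, ?_, ⟨s, hs, t, ht, hst⟩,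
    s', hs', t₀, ht₀, (hsp.mono Set.subset_union_left).trans
      ((P.conn_from hp).mono Set.subset_union_right)⟩
  rw [Set.disjoint_left]
  rintro x hx ((rfl | hxB) | ⟨hxP, hx2⟩)
  · exact lt_irrefl _ (h.left_lt x hx hp)
  · exact Set.disjoint_left.1 h.disj hx hxB
  · exact absurd (h.left_lt x hx hxP) (not_lt.2 hx2)

/-- Menger's theorem for two paths: if no vertex separates `S` from `T`, then there are two disjoint
walks from `S` to `T`. -/
theorem twoDisjoint_of_forall_conn [Nonempty V]
    (h : ∀ y, ∃ s ∈ S, ∃ t ∈ T, Conn E {y}ᶜ s t) : TwoDisjoint E S T := by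
  obtain ⟨s₀, hs₀, t₀, ht₀, h₀⟩ := h (Classical.arbitrary V)
  obtain ⟨P, -⟩ := h₀.exists_opath
  -- Two walks to `p` that are disjoint except at `p` are pushed to later and later vertices of `P`.
  -- The rank of `p` increases, so the process ends with two disjoint walks.
  have key : ∀ k, ∀ p ∈ P.verts, P.rk t₀ - P.rk p = k → ∀ A B, TwoWalksTo S P p A B →
      TwoDisjoint E S T := by
    intro k
    induction k using Nat.strong_induction_on with
    | _ k ih =>
      intro p hp hk A B hAB
      suffices H : TwoDisjoint E S T ∨
          ∃ q ∈ P.verts, P.rk p < P.rk q ∧ ∃ A' B', TwoWalksTo S P q A' B' by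
        rcases H with H | ⟨q, hq, hpq, A', B', hAB'⟩
        · exact H
        · have := P.le_right q hq
          exact ih _ (by omega) q hq rfl A' B' hAB'
      -- As `p` does not separate, some walk avoids it. Only its part after the last vertex in `A ∪
      -- B` is used, since that vertex can already be reached from `S`.
      obtain ⟨s, hs, t, ht, hst⟩ := h p
      rcases hst.last_hit (A ∪ B) with h1 | ⟨z, hz, -, -, h1⟩
      · exact hAB.extend hp ht₀ ht (fun X _ hX => ⟨s, hs, .refl hX⟩) h1
      · wlog hzA : z ∈ A generalizing A B
        · exact this B A hAB.symm hz.symm (by rwa [Set.union_comm]) (hz.resolve_left hzA)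
        rcases h1 with rfl | ⟨w, e, hwt⟩
        · exact .inl (hAB.twoDisjoint_of_end hp ht₀ ht hzA)
        · refine hAB.extend hp ht₀ ht (fun X hAX hX => ?_) hwt
          obtain ⟨s', hs', hsz⟩ := hAB.left_rooted z hzA
          exact ⟨s', hs', (hsz.mono hAX).snoc e hX⟩
  refine key _ s₀ P.left_mem rfl ∅ ∅ ⟨by simp, by simp, by simp, ?_, ?_, ?_, ?_⟩
  · simp [Rooted]
  · simp [Rooted]
  · exact ⟨s₀, hs₀, .refl (Set.mem_insert _ _)⟩
  · exact ⟨s₀, hs₀, .refl (Set.mem_insert _ _)⟩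

end Menger

/-! ### Shunts and pairs of disjoint paths -/

section Shunts

variable {V : Type*}

/-- A shunt in terms of three disjoint sets of vertices that carry the walks it needs. -/
def SetShunt (E : V → V → Prop) (S T : Set V) : Prop :=
  ∃ (A B C : Set V) (s s' t t' r r' a b : V),
    Disjoint A B ∧ Disjoint A C ∧ Disjoint B C ∧ ({s, s'} : Set V) = S ∧ ({t, t'} : Set V) = T ∧
    Conn E A s t ∧ Conn E A s r ∧ Conn E B s' t' ∧ Conn E B r' t' ∧ E r a ∧ Conn E C a b ∧ E b r'

/-- Two disjoint paths that start in the two vertices of `S` and end in the two vertices of `T`. -/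
structure PathPair (E : V → V → Prop) (S T : Set V) where
  /-- The start of the first path. -/
  s₁ : V
  /-- The start of the second path. -/
  s₂ : V
  /-- The end of the first path. -/
  t₁ : V
  /-- The end of the second path. -/
  t₂ : V
  /-- The first path. -/
  P : OPath E s₁ t₁
  /-- The second path. -/
  Q : OPath E s₂ t₂
  disj : Disjoint P.verts Q.verts
  starts : ({s₁, s₂} : Set V) = S
  ends : ({t₁, t₂} : Set V) = T

namespace PathPair

variable {E : V → V → Prop} {S T : Set V} (π : PathPair E S T)

/-- The same paths in the other order. -/
def swap : PathPair E S T where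
  s₁ := π.s₂
  s₂ := π.s₁
  t₁ := π.t₂
  t₂ := π.t₁
  P := π.Q
  Q := π.P
  disj := π.disj.symm
  starts := by rw [Set.pair_comm]; exact π.starts
  ends := by rw [Set.pair_comm]; exact π.ends

/-- The vertices of the two paths. -/
def verts : Set V := π.P.verts ∪ π.Q.verts

theorem swap_verts : π.swap.verts = π.verts := Set.union_comm _ _

variable {π}

theorem not_mem_right {x : V} (h : x ∈ π.P.verts) : x ∉ π.Q.verts :=
  fun h' => Set.disjoint_left.1 π.disj h h'

theorem not_mem_left {x : V} (h : x ∈ π.Q.verts) : x ∉ π.P.verts :=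
  fun h' => Set.disjoint_left.1 π.disj h' h

/-- Such a walk, together with its two end vertices on the paths, would be the third path of a shunt
whose other two paths are those of `π`. -/
theorem no_ear (ns : ¬ SetShunt E S T) {r a b r' : V} (hr : r ∈ π.P.verts) (e : E r a)
    (hab : Conn E π.vertsᶜ a b) (e' : E b r') : r' ∉ π.Q.verts := fun hr' =>
  ns ⟨π.P.verts, π.Q.verts, π.vertsᶜ, π.s₁, π.s₂, π.t₁, π.t₂, r, r', a, b, π.disj,
    Set.disjoint_left.2 fun _ hx h => h (.inl hx), Set.disjoint_left.2 fun _ hx h => h (.inr hx),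
    π.starts, π.ends, π.P.conn, (π.P.conn_to hr).mono fun _ h => h.1, π.Q.conn,
    (π.Q.conn_from hr').mono fun _ h => h.1, e, hab, e'⟩

/-- An end of an arc between the two paths cannot be avoided by the path that contains it. -/
theorem not_conn_of_cross (ns : ¬ SetShunt E S T) {x y : V} (hx : x ∈ π.P.verts)
    (hy : y ∈ π.Q.verts) (e : E x y ∨ E y x) :
    ¬ Conn E (insert x π.Q.verts)ᶜ π.s₁ π.t₁ := by
  intro h
  have hd : Disjoint (insert x π.Q.verts)ᶜ π.Q.verts :=
    Set.disjoint_left.2 fun z hz h => hz (.inr h)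
  have hd1 : Disjoint (insert x π.Q.verts)ᶜ {x} :=
    Set.disjoint_left.2 fun z hz h => hz (.inl h)
  have hd2 : Disjoint π.Q.verts {x} :=
    Set.disjoint_left.2 fun z hz h => not_mem_right hx (by rwa [Set.mem_singleton_iff.1 h] at hz)
  have hs : π.s₁ ≠ x := fun hh => h.left_mem (.inl hh)
  have ht : x ≠ π.t₁ := fun hh => h.right_mem (.inl hh.symm)
  -- The arc and a neighbour of `x` on the first path give a third path with `x` as its only
  -- internal vertex; the walk that avoids `x` takes the place of the first path.
  rcases e with e | e
  · obtain ⟨p, ep, hp⟩ := π.P.exists_pred hx hs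
    refine ns ⟨_, _, {x}, π.s₁, π.s₂, π.t₁, π.t₂, p, y, x, x, hd, hd1, hd2, π.starts, π.ends, h,
      hp.mono ?_, π.Q.conn, (π.Q.conn_from hy).mono fun _ h => h.1, ep, .refl rfl, e⟩
    rintro z ⟨hz, hzx⟩ (rfl | hzQ)
    · exact lt_irrefl _ hzx
    · exact not_mem_right hz hzQ
  · obtain ⟨p, ep, hp⟩ := π.P.exists_succ hx ht
    refine ns ⟨_, _, {x}, π.s₂, π.s₁, π.t₂, π.t₁, y, p, x, x, hd.symm, hd2, hd1, π.swap.starts,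
      π.swap.ends, π.Q.conn, (π.Q.conn_to hy).mono fun _ h => h.1, h, hp.mono ?_, e, .refl rfl, ep⟩
    rintro z ⟨hz, hzx⟩ (rfl | hzQ)
    · exact lt_irrefl _ hzx
    · exact not_mem_right hz hzQ

theorem mem_left_of_conn (ns : ¬ SetShunt E S T) {z a b : V} (hz : z ∈ π.P.verts)
    (h : Conn E π.Q.vertsᶜ z a) (e : E a b) (hb : b ∈ π.Q.verts) : a ∈ π.P.verts := by
  by_contra ha
  obtain ⟨r, hr, -, -, rfl | ⟨p, ep, hp⟩⟩ := h.last_hit_of_mem (Y := π.P.verts) hz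
  · exact ha hr
  · refine no_ear ns hr ep (hp.mono ?_) e hb
    rintro x ⟨h1, h2⟩ (h | h)
    · exact h2 h
    · exact h1 h

/-- Between the ends of two crossing arcs there is no further vertex. -/
theorem not_between_of_crossing (ns : ¬ SetShunt E S T) {a b c d : V} (ha : a ∈ π.P.verts)
    (hd : d ∈ π.P.verts) (hc : c ∈ π.Q.verts) (hb : b ∈ π.Q.verts)
    (hcb : π.Q.rk c < π.Q.rk b) (eab : E a b) (ecd : E c d) {z : V} (hz : z ∈ π.P.verts)
    (haz : π.P.rk a < π.P.rk z) : π.P.rk d ≤ π.P.rk z := by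
  by_contra! hzd
  obtain ⟨x, y, ex, hxy, ey⟩ := π.P.exists_between ha hz hd haz hzd
  have hA := π.P.conn_to ha
  have hB := π.Q.conn_from hb
  have hC := π.Q.conn_to hc
  have hD := π.P.conn_from hd
  -- The two paths exchange their final parts along `a b` and `c d`. The stretch of the first path
  -- strictly between `a` and `d` becomes free and serves as the interior of the third path.
  refine ns ⟨{z | z ∈ π.P.verts ∧ π.P.rk z ≤ π.P.rk a} ∪ {z | z ∈ π.Q.verts ∧ π.Q.rk b ≤ π.Q.rk z},
    {z | z ∈ π.Q.verts ∧ π.Q.rk z ≤ π.Q.rk c} ∪ {z | z ∈ π.P.verts ∧ π.P.rk d ≤ π.P.rk z},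
    {z | z ∈ π.P.verts ∧ π.P.rk a < π.P.rk z ∧ π.P.rk z < π.P.rk d},
    π.s₁, π.s₂, π.t₂, π.t₁, a, d, x, y, ?_, ?_, ?_, π.starts, π.swap.ends, ?_, ?_, ?_, ?_,
    ex, hxy, ey⟩
  · rw [Set.disjoint_left]
    rintro w (⟨h1, h2⟩ | ⟨h1, h2⟩) (⟨h3, h4⟩ | ⟨h3, h4⟩)
    · exact not_mem_right h1 h3
    · omega
    · omega
    · exact not_mem_right h3 h1
  · rw [Set.disjoint_left]
    rintro w (⟨h1, h2⟩ | ⟨h1, h2⟩) ⟨h3, h4, h5⟩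
    · omega
    · exact not_mem_right h3 h1
  · rw [Set.disjoint_left]
    rintro w (⟨h1, h2⟩ | ⟨h1, h2⟩) ⟨h3, h4, h5⟩
    · exact not_mem_right h3 h1
    · omega
  · exact (hA.mono Set.subset_union_left).trans
      ((hB.mono Set.subset_union_right).cons (.inl hA.right_mem) eab)
  · exact hA.mono Set.subset_union_left
  · exact (hC.mono Set.subset_union_left).trans
      ((hD.mono Set.subset_union_right).cons (.inl hC.right_mem) ecd)
  · exact hD.mono Set.subset_union_right

theorem start_mem {s : V} (hs : s ∈ S) : s = π.s₁ ∨ s = π.s₂ := by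
  rw [← π.starts] at hs; exact hs

theorem end_mem {t : V} (ht : t ∈ T) : t = π.t₁ ∨ t = π.t₂ := by
  rw [← π.ends] at ht; exact ht

/-- The tails of two crossing arcs separate `S` from `T`. -/
theorem not_conn_of_crossing (ns : ¬ SetShunt E S T) {a b c d : V} (ha : a ∈ π.P.verts)
    (hd : d ∈ π.P.verts) (hc : c ∈ π.Q.verts) (hb : b ∈ π.Q.verts) (had : π.P.rk a < π.P.rk d)
    (hcb : π.Q.rk c < π.Q.rk b) (eab : E a b) (ecd : E c d) {s t : V} (hs : s ∈ S) (ht : t ∈ T) :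
    ¬ Conn E {a, c}ᶜ s t := by
  intro h
  -- The part of the two paths strictly before `a` and `c`. The walk starts in it and must leave it
  -- for good at some vertex `z`.
  set L : Set V := {z | z ∈ π.P.verts ∧ π.P.rk z < π.P.rk a} ∪
    {z | z ∈ π.Q.verts ∧ π.Q.rk z < π.Q.rk c} with hL
  have hsL : s ∈ L := by
    rcases start_mem (π := π) hs with rfl | rfl
    · refine .inl ⟨π.P.left_mem, π.P.rk_lt π.P.left_mem ha (π.P.left_le a ha) ?_⟩
      rintro hh; exact h.left_mem (.inl hh)
    · refine .inr ⟨π.Q.left_mem, π.Q.rk_lt π.Q.left_mem hc (π.Q.left_le c hc) ?_⟩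
      rintro hh; exact h.left_mem (.inr hh)
  obtain ⟨z, hz, -, -, hzt⟩ := h.last_hit_of_mem hsL
  have htv : t ∈ π.verts := by
    rcases end_mem (π := π) ht with rfl | rfl
    · exact .inl π.P.right_mem
    · exact .inr π.Q.right_mem
  have htL : t ∉ L := by
    have h1 := π.P.le_right a ha
    have h2 := π.Q.le_right c hc
    rcases end_mem (π := π) ht with rfl | rfl
    · rintro (⟨-, h⟩ | ⟨h, -⟩)
      · omega
      · exact not_mem_right π.P.right_mem h
    · rintro (⟨h, -⟩ | ⟨-, h⟩)
      · exact not_mem_right h π.Q.right_mem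
      · omega
  have hzt' : ∃ p, E z p ∧ Conn E ({a, c}ᶜ \ L) p t := hzt.resolve_left (by rintro rfl; exact htL hz)
  clear hzt hs hsL h
  wlog hzP : z ∈ π.P.verts ∧ π.P.rk z < π.P.rk a generalizing π a b c d
  · have hzQ := hz.resolve_left hzP
    have hcom : ({a, c}ᶜ : Set V) = {c, a}ᶜ := by rw [Set.pair_comm]
    refine this (π := π.swap) hc hb ha hd hcb had ecd eab rfl hz.symm ?_ (fun h => htL (Or.symm h)) ?_ hzQ
    · exact htv.symm
    · simpa only [swap, hL, Set.union_comm, Set.pair_comm] using hzt'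
  obtain ⟨p, ezp, hpt⟩ := hzt'
  obtain ⟨z', hz', hz'X, -, hz'p⟩ := hpt.first_hit_of_mem htv
  have hQP := π.disj
  have hzQ : z ∉ π.Q.verts := not_mem_right hzP.1
  have hsz : Conn E {z | z ∈ π.P.verts ∧ π.P.rk z < π.P.rk a} π.s₁ z :=
    (π.P.conn_to hzP.1).mono fun w hw => ⟨hw.1, hw.2.trans_lt hzP.2⟩
  by_cases hz'P : z' ∈ π.P.verts
  · have haz' : π.P.rk a < π.P.rk z' := by
      refine π.P.rk_lt ha hz'P (not_lt.1 fun hh => hz'X.2 (.inl ⟨hz'P, hh⟩)) ?_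
      rintro rfl; exact hz'X.1 (.inl rfl)
    -- Jumping from `z` to `z'` bypasses `a` without touching the second path, although `a` is an
    -- end of a crossing arc.
    refine not_conn_of_cross ns ha hb (.inl eab) ?_
    have h1 : Conn E (insert a π.Q.verts)ᶜ π.s₁ z := hsz.mono (by
      rintro w ⟨hw, hw2⟩ (rfl | h)
      · omega
      · exact not_mem_right hw h)
    have h2 : Conn E (insert a π.Q.verts)ᶜ z' π.t₁ := (π.P.conn_from hz'P).mono (by
      rintro w ⟨hw, hw2⟩ (rfl | h)
      · omega
      · exact not_mem_right hw h)
    rcases hz'p with rfl | ⟨q, hpq, eq⟩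
    · exact h1.trans (h2.cons h1.right_mem ezp)
    · refine h1.trans (((hpq.mono ?_).trans (h2.cons ?_ eq)).cons h1.right_mem ezp)
      · rintro w ⟨⟨h3, -⟩, h4⟩ (rfl | h)
        · exact h3 (.inl rfl)
        · exact h4 (.inr h)
      · rintro (h | h)
        · exact hpq.right_mem.1.1 (.inl h)
        · exact hpq.right_mem.2 (.inr h)
  · have hz'Q : z' ∈ π.Q.verts := hz'.resolve_left hz'P
    have hcz' : π.Q.rk c < π.Q.rk z' := by
      refine π.Q.rk_lt hc hz'Q (not_lt.1 fun hh => hz'X.2 (.inr ⟨hz'Q, hh⟩)) ?_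
      rintro rfl; exact hz'X.1 (.inr rfl)
    rcases hz'p with rfl | ⟨q, hpq, eq⟩
    -- The arc from `z` to `z'` crosses `c d` as well, and now `a` lies between `z` and `d`.
    · have := not_between_of_crossing ns hzP.1 hd hc hz'Q hcz' ezp ecd ha hzP.2
      omega
    · exact no_ear ns hzP.1 ezp (hpq.mono fun w hw => hw.2) eq hz'Q

end PathPair

end Shunts

/-! ### Vertices that all pairs of disjoint paths have in common -/

theorem Set.Nonempty.exists_forall_le {V : Type*} {Y : Set V} (hY : Y.Nonempty) (f : V → ℕ) :
    ∃ b ∈ Y, ∀ z ∈ Y, f b ≤ f z := by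
  obtain ⟨b, hb, h⟩ := (measure f).wf.has_min Y hY
  exact ⟨b, hb, fun z hz => not_lt.1 (h z hz)⟩

namespace PathPair

variable {V : Type*} {E : V → V → Prop} {S T : Set V} {π : PathPair E S T}

theorem s₁_mem : π.s₁ ∈ S := π.starts.subset (.inl rfl)
theorem s₂_mem : π.s₂ ∈ S := π.starts.subset (.inr rfl)
theorem t₁_mem : π.t₁ ∈ T := π.ends.subset (.inl rfl)
theorem t₂_mem : π.t₂ ∈ T := π.ends.subset (.inr rfl)

/-- For the induction in `mem_of_not_conn`: a shunt beyond `a` and `c` is prolonged backwards by the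
initial parts of the two paths, which lie outside `X`. As `{d, b}` is unordered, the roles of the
two paths may have to be exchanged. -/
theorem setShunt_extend {a b c d : V} (ha : a ∈ π.P.verts) (hc : c ∈ π.Q.verts)
    (ead : E a d) (ecb : E c b) {X : Set V}
    (hX : X = ({z | z ∈ π.P.verts ∧ π.P.rk z ≤ π.P.rk a} ∪
      {z | z ∈ π.Q.verts ∧ π.Q.rk z ≤ π.Q.rk c})ᶜ)
    (hd : d ∈ X) (hb : b ∈ X) (h : SetShunt (fun u v => E u v ∧ v ∈ X) {d, b} T) :
    SetShunt E S T := by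
  obtain ⟨A, B, C, s, s', t, t', r, r', x, y, hAB, hAC, hBC, hS, hT, hst, hsr, hst', hrt',
    ⟨erx, hx⟩, hxy, eyr, hr'⟩ := h
  wlog hs : s = d ∧ s' = b generalizing π a b c d
  · have hs' : s = b ∧ s' = d := by
      rcases Set.pair_eq_pair_iff.1 hS with h | h
      · exact absurd h hs
      · exact h
    exact this (π := π.swap) hc ha ecb ead (by rw [hX, Set.union_comm]; rfl) hb hd
      (by rw [hS, Set.pair_comm]) hs'
  obtain ⟨rfl, rfl⟩ := hs
  have hA := π.P.conn_to ha
  have hB := π.Q.conn_to hc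
  set L := {z | z ∈ π.P.verts ∧ π.P.rk z ≤ π.P.rk a} with hL
  set M := {z | z ∈ π.Q.verts ∧ π.Q.rk z ≤ π.Q.rk c} with hM
  have hXL : ∀ z ∈ L, z ∉ X := fun z hz h => by rw [hX] at h; exact h (.inl hz)
  have hXM : ∀ z ∈ M, z ∉ X := fun z hz h => by rw [hX] at h; exact h (.inr hz)
  have key : ∀ v, Conn (fun u v => E u v ∧ v ∈ X) A s v → Conn E (L ∪ A ∩ X) π.s₁ v := fun v hv =>
    (hA.mono Set.subset_union_left).trans
      (((hv.of_restrict hd).mono Set.subset_union_right).cons (.inl hA.right_mem) ead)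
  refine ⟨L ∪ A ∩ X, M ∪ B ∩ X, C ∩ X, π.s₁, π.s₂, t, t', r, r', x, y, ?_, ?_, ?_, π.starts, hT,
    key t hst, key r hsr, ?_, ?_, erx, hxy.of_restrict hx, eyr⟩
  · rw [Set.disjoint_left]
    rintro z (hz | hz) (hz' | hz')
    · exact not_mem_right hz.1 hz'.1
    · exact hXL z hz hz'.2
    · exact hXM z hz' hz.2
    · exact Set.disjoint_left.1 hAB hz.1 hz'.1
  · rw [Set.disjoint_left]
    rintro z (hz | hz) hz'
    · exact hXL z hz hz'.2
    · exact Set.disjoint_left.1 hAC hz.1 hz'.1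
  · rw [Set.disjoint_left]
    rintro z (hz | hz) hz'
    · exact hXM z hz hz'.2
    · exact Set.disjoint_left.1 hBC hz.1 hz'.1
  · exact (hB.mono Set.subset_union_left).trans
      (((hst'.of_restrict hb).mono Set.subset_union_right).cons (.inl hB.right_mem) ecb)
  · exact (hrt'.of_restrict hr').mono Set.subset_union_right

/-- Without a shunt, a second pair of paths with the same ends covers every vertex of the first path
that this path cannot avoid. -/
theorem mem_of_not_conn (k : ℕ) : ∀ {E : V → V → Prop} {S T : Set V} {π : PathPair E S T},
    ¬ SetShunt E S T → π.P.rk π.t₁ - π.P.rk π.s₁ = k → ∀ {t t' : V} (P' : OPath E π.s₁ t)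
    (Q' : OPath E π.s₂ t'), ({t, t'} : Set V) = T → Disjoint P'.verts Q'.verts →
    ∀ x ∈ π.P.verts, ¬ Conn E (insert x π.Q.verts)ᶜ π.s₁ π.t₁ → x ∈ P'.verts ∨ x ∈ Q'.verts := by
  induction k using Nat.strong_induction_on with
  | _ k ih =>
  intro E S T π ns hk t t' P' Q' hT hPQ' x hx hess
  have hPQ : ∀ z ∈ P'.verts, z ∉ Q'.verts := fun z h h' => Set.disjoint_left.1 hPQ' h h'
  have htT : t ∈ T := by rw [← hT]; exact .inl rfl
  have ht'T : t' ∈ T := by rw [← hT]; exact .inr rfl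
  -- If `P'` never meets the second path of `π`, it leads to `π.t₁` and must use `x`. Otherwise `b`
  -- is its first vertex there, and its predecessor `a` is on the first path because there are no
  -- ears.
  by_cases h1 : (P'.verts ∩ π.Q.verts).Nonempty
  swap
  · left
    by_contra hxP
    refine hess ?_
    have ht : t = π.t₁ := (end_mem (π := π) htT).resolve_right
      (by rintro rfl; exact h1 ⟨_, P'.right_mem, π.Q.right_mem⟩)
    subst ht
    refine P'.conn.mono ?_
    rintro z hz (rfl | hzQ)
    · exact hxP hz
    · exact h1 ⟨z, hz, hzQ⟩
  obtain ⟨b, ⟨hbP', hbQ⟩, hbmin⟩ := h1.exists_forall_le P'.rk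
  have hs₁b : π.s₁ ≠ b := by rintro rfl; exact not_mem_right π.P.left_mem hbQ
  obtain ⟨a, eab, hs₁a⟩ := P'.exists_pred hbP' hs₁b
  have hpre : ∀ z, z ∈ P'.verts ∧ P'.rk z < P'.rk b → z ∉ π.Q.verts := fun z hz hzQ => by
    have := hbmin z ⟨hz.1, hzQ⟩
    omega
  have haP : a ∈ π.P.verts := mem_left_of_conn ns π.P.left_mem (hs₁a.mono hpre) eab hbQ
  have haP' := hs₁a.right_mem
  -- `Q'` has to meet the first path of `π`: otherwise it would lead from `π.s₂` to `π.t₂` and avoid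
  -- `b`, an end of the crossing arc `a b`.
  by_cases h2 : (Q'.verts ∩ π.P.verts).Nonempty
  swap
  · exfalso
    refine not_conn_of_cross (π := π.swap) ns hbQ haP (.inr eab) ?_
    have ht : t' = π.t₂ := (end_mem (π := π) ht'T).resolve_left
      (by rintro rfl; exact h2 ⟨_, Q'.right_mem, π.P.right_mem⟩)
    subst ht
    refine Q'.conn.mono ?_
    rintro z hz (rfl | hzQ)
    · exact hPQ _ hbP' hz
    · exact h2 ⟨z, hz, hzQ⟩
  obtain ⟨d, ⟨hdQ', hdP⟩, hdmin⟩ := h2.exists_forall_le Q'.rk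
  have hs₂d : π.s₂ ≠ d := by rintro rfl; exact not_mem_left π.Q.left_mem hdP
  obtain ⟨c, ecd, hs₂c⟩ := Q'.exists_pred hdQ' hs₂d
  have hpre' : ∀ z, z ∈ Q'.verts ∧ Q'.rk z < Q'.rk d → z ∉ π.P.verts := fun z hz hzQ => by
    have := hdmin z ⟨hz.1, hzQ⟩
    omega
  have hcQ : c ∈ π.Q.verts :=
    mem_left_of_conn (π := π.swap) ns π.Q.left_mem (hs₂c.mono hpre') ecd hdP
  have hcQ' := hs₂c.right_mem
  -- With `d` at or before `a`, the initial part of `P'` followed by the first path from `a` on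
  -- would avoid `d`, an end of the arc `c d`. The inequality on the second path is symmetric.
  have had : π.P.rk a < π.P.rk d := by
    by_contra! hda
    have hda' := π.P.rk_lt hdP haP hda (by rintro rfl; exact hPQ _ haP'.1 hdQ')
    refine not_conn_of_cross ns hdP hcQ (.inr ecd) ((hs₁a.mono ?_).trans
      ((π.P.conn_from haP).mono ?_))
    · rintro z hz (rfl | h)
      · exact hPQ _ hz.1 hdQ'
      · exact hpre z hz h
    · rintro z hz (rfl | h)
      · have := hz.2; omega
      · exact not_mem_right hz.1 h
  have hcb : π.Q.rk c < π.Q.rk b := by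
    by_contra! hda
    have hda' := π.Q.rk_lt hbQ hcQ hda (by rintro rfl; exact hPQ _ hbP' hcQ'.1)
    refine not_conn_of_cross (π := π.swap) ns hbQ haP (.inr eab) ((hs₂c.mono ?_).trans
      ((π.Q.conn_from hcQ).mono ?_))
    · rintro z hz (rfl | h)
      · exact hPQ _ hbP' hz.1
      · exact hpre' z hz h
    · rintro z hz (rfl | h)
      · have := hz.2; omega
      · exact not_mem_left hz.1 h
  -- Up to `a`, the vertex `x` is forced onto `P'`, since otherwise one could follow `P'` to `a` and
  -- then the first path. After `a`, it is at or after `d`, as nothing lies between.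
  by_cases hxa : π.P.rk x ≤ π.P.rk a
  · left
    by_contra hxP'
    have hxa' := π.P.rk_lt hx haP hxa (by rintro rfl; exact hxP' haP'.1)
    refine hess ((hs₁a.mono ?_).trans ((π.P.conn_from haP).mono ?_))
    · rintro z hz (rfl | h)
      · exact hxP' hz.1
      · exact hpre z hz h
    · rintro z hz (rfl | h)
      · have := hz.2; omega
      · exact not_mem_right hz.1 h
  have hdx := not_between_of_crossing ns haP hdP hcQ hbQ hcb eab ecd hx (not_le.1 hxa)
  obtain ⟨X, hX⟩ : ∃ X, X = ({z | z ∈ π.P.verts ∧ π.P.rk z ≤ π.P.rk a} ∪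
      {z | z ∈ π.Q.verts ∧ π.Q.rk z ≤ π.Q.rk c})ᶜ := ⟨_, rfl⟩
  have ead : E a d := by
    obtain ⟨p, e, hp⟩ := (π.P.seg a haP d hdP had.le).exists_out (by rintro rfl; omega)
    have hpm := hp.left_mem
    have h3 := π.P.rk_lt haP hpm.1.1 hpm.1.2.1 (Ne.symm hpm.2)
    have h4 := not_between_of_crossing ns haP hdP hcQ hbQ hcb eab ecd hpm.1.1 h3
    rwa [π.P.inj d hdP p hpm.1.1 (le_antisymm h4 hpm.1.2.2)]
  have ecb : E c b := by
    obtain ⟨p, e, hp⟩ := (π.Q.seg c hcQ b hbQ hcb.le).exists_out (by rintro rfl; omega)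
    have hpm := hp.left_mem
    have h3 := π.Q.rk_lt hcQ hpm.1.1 hpm.1.2.1 (Ne.symm hpm.2)
    have h4 := not_between_of_crossing (π := π.swap) ns hcQ hbQ haP hdP had ecd eab hpm.1.1 h3
    rwa [π.Q.inj b hbQ p hpm.1.1 (le_antisymm h4 hpm.1.2.2)]
  -- Since `a` and `c` separate `S` from `T`, no walk that avoids them leads from the initial parts
  -- of the two paths to `T`.
  have late : ∀ z v, Conn E {a, c}ᶜ z v → v ∈ T → z ∈ X := by
    intro z v hzv hv
    rw [hX]
    rintro (⟨h3, h4⟩ | ⟨h3, h4⟩)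
    · refine not_conn_of_crossing ns haP hdP hcQ hbQ had hcb eab ecd s₁_mem hv
        (((π.P.conn_to h3).mono ?_).trans hzv)
      have := π.P.rk_lt h3 haP h4 (by rintro rfl; exact hzv.left_mem (.inl rfl))
      rintro w hw (rfl | rfl)
      · have := hw.2; omega
      · exact not_mem_left hcQ hw.1
    · refine not_conn_of_crossing ns haP hdP hcQ hbQ had hcb eab ecd s₂_mem hv
        (((π.Q.conn_to h3).mono ?_).trans hzv)
      have := π.Q.rk_lt h3 hcQ h4 (by rintro rfl; exact hzv.left_mem (.inr rfl))
      rintro w hw (rfl | rfl)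
      · exact not_mem_right haP hw.1
      · have := hw.2; omega
  have hP'X : (P'.suffix hbP').verts ⊆ X := by
    rintro z ⟨hz, hbz⟩
    refine late z t ((P'.conn_from hz).mono ?_) htT
    rintro w hw (rfl | rfl)
    · have := hw.2; have := haP'.2; omega
    · exact hPQ _ hw.1 hcQ'.1
  have hQ'X : (Q'.suffix hdQ').verts ⊆ X := by
    rintro z ⟨hz, hbz⟩
    refine late z t' ((Q'.conn_from hz).mono ?_) ht'T
    rintro w hw (rfl | rfl)
    · exact hPQ _ haP'.1 hw.1
    · have := hw.2; have := hcQ'.2; omega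
  have hPX : (π.P.suffix hdP).verts ⊆ X := by
    rw [hX]
    rintro z ⟨hz, hbz⟩ (⟨h3, h4⟩ | ⟨h3, h4⟩)
    · omega
    · exact not_mem_right hz h3
  have hQX : (π.Q.suffix hbQ).verts ⊆ X := by
    rw [hX]
    rintro z ⟨hz, hbz⟩ (⟨h3, h4⟩ | ⟨h3, h4⟩)
    · exact not_mem_left hz h3
    · omega
  let ρ : PathPair (fun u v => E u v ∧ v ∈ X) {d, b} T :=
    { s₁ := d, s₂ := b, t₁ := π.t₁, t₂ := π.t₂
      P := (π.P.suffix hdP).restrict hPX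
      Q := (π.Q.suffix hbQ).restrict hQX
      disj := Set.disjoint_left.2 fun z hz hz' => not_mem_right hz.1 hz'.1
      starts := rfl
      ends := π.ends }
  have hdX : d ∈ X := hPX (π.P.suffix hdP).left_mem
  have hbX : b ∈ X := hQX (π.Q.suffix hbQ).left_mem
  have hsub : ¬ SetShunt (fun u v => E u v ∧ v ∈ X) {d, b} T := fun h =>
    ns (setShunt_extend haP hcQ ead ecb hX hdX hbX h)
  have hr1 := π.P.left_le a haP
  have hr2 := π.P.le_right d hdP
  -- Beyond `a` and `c`, the pairs from `{d, b}` are compared. The second pair has changed sides, so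
  -- the rest of `Q'` plays the part of `P'`.
  have := ih (π.P.rk π.t₁ - π.P.rk d) (by omega) (π := ρ) hsub rfl
    ((Q'.suffix hdQ').restrict hQ'X) ((P'.suffix hbP').restrict hP'X)
    (by rw [Set.pair_comm]; exact hT)
    (Set.disjoint_left.2 fun z hz hz' => hPQ z hz'.1 hz.1) x ⟨hx, hdx⟩ ?_
  · rcases this with h | h
    · exact .inr h.1
    · exact .inl h.1
  · intro h
    refine hess (((π.P.conn_to haP).mono ?_).trans (((h.of_restrict hdX).mono ?_).cons ?_ ead))
    · rintro z hz (rfl | hzQ)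
      · exact hxa hz.2
      · exact not_mem_right hz.1 hzQ
    · rintro z ⟨hz, hzX⟩ (rfl | hzQ)
      · exact hz (.inl rfl)
      · refine hz (.inr ⟨hzQ, ?_⟩)
        rw [hX] at hzX
        have h5 : π.Q.rk c < π.Q.rk z := not_le.1 fun h => hzX (.inr ⟨hzQ, h⟩)
        exact not_between_of_crossing (π := π.swap) ns hcQ hbQ haP hdP had ecd eab hzQ h5
    · rintro (rfl | hzQ)
      · exact hxa le_rfl
      · exact not_mem_right haP hzQ

end PathPair

/-! ### A criterion for shunts in terms of separating pairs of vertices -/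

section Criterion

variable {V : Type*}

theorem Conn.coreachable {E : V → V → Prop} {X : Set V} {u v : V} (h : Conn E X u v) :
    Conn E {x | Conn E X x v} u v := by
  induction h using Conn.head_induction with
  | base h => exact Conn.refl (X := {x | Conn E X x v}) h
  | step a b ha e hb ih => exact ih.cons (hb.cons ha e) e

variable (E : V → V → Prop) (S T : Set V)

/-- The vertices `x` and `y` separate `S` from `T`. -/
def Cut (x y : V) : Prop := ∀ s ∈ S, ∀ t ∈ T, ¬ Conn E {x, y}ᶜ s t

/-- `x` belongs to a pair of vertices that separates `S` from `T`. -/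
def OnCut (x : V) : Prop := ∃ y, Cut E S T x y

/-- `x` lies on a walk from `S` to `T`. -/
def Useful (x : V) : Prop :=
  (∃ s ∈ S, Conn E Set.univ s x) ∧ ∃ t ∈ T, Conn E Set.univ x t

/-- `i` and `j` are useful neighbours, not both in a separating pair. -/
def Link (i j : V) : Prop :=
  Useful E S T i ∧ Useful E S T j ∧ (E i j ∨ E j i) ∧ ¬ (OnCut E S T i ∧ OnCut E S T j)

/-- Some vertex separates `S` from `T` together with `i` as well as together with `j`. -/
def Partner (i j : V) : Prop := ∃ z, Cut E S T i z ∧ Cut E S T j z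

/-- No vertex separates `S` from `T`, and there is a link between two vertices that the separating
pairs do not force onto the same path. -/
def ShuntCriterion : Prop :=
  (∀ x, ¬ Cut E S T x x) ∧ ∃ u u', OnCut E S T u ∧ OnCut E S T u' ∧
    Relation.TransGen (Link E S T) u u' ∧ ¬ Relation.TransGen (Partner E S T) u u'

variable {E S T}

theorem Cut.symm {x y : V} (h : Cut E S T x y) : Cut E S T y x := by
  unfold Cut at *; rwa [Set.pair_comm]

theorem Cut.mem_or_mem {x y s t : V} (h : Cut E S T x y) (hs : s ∈ S) (ht : t ∈ T) {A : Set V}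
    (hA : Conn E A s t) : x ∈ A ∨ y ∈ A := by
  by_contra! hh
  refine h s hs t ht (hA.mono ?_)
  rintro z hz (rfl | rfl)
  · exact hh.1 hz
  · exact hh.2 hz

theorem Cut.mem_and_mem {x y s t s' t' : V} (h : Cut E S T x y) (hs : s ∈ S) (ht : t ∈ T)
    (hs' : s' ∈ S) (ht' : t' ∈ T) {A B : Set V} (hA : Conn E A s t) (hB : Conn E B s' t')
    (hAB : Disjoint A B) : x ∈ A ∧ y ∈ B ∨ x ∈ B ∧ y ∈ A := by
  have h1 := h.mem_or_mem hs ht hA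
  have h2 := h.mem_or_mem hs' ht' hB
  have h3 : x ∈ A → x ∉ B := fun h h' => Set.disjoint_left.1 hAB h h'
  have h4 : y ∈ A → y ∉ B := fun h h' => Set.disjoint_left.1 hAB h h'
  tauto

/-- All internal vertices of the walk are useful and not critical, so each of its arcs has an end
that is not critical and is a link. The ends `y` and `z` may be critical, as the walk has at least
one internal vertex. -/
theorem link_of_conn {X : Set V} (hX : ∀ x ∈ X, ¬ OnCut E S T x) {s y p q z t : V} (hs : s ∈ S)
    (hsy : Conn E Set.univ s y) (ey : E y p) (hpq : Conn E X p q) (ez : E q z) (ht : t ∈ T)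
    (hzt : Conn E Set.univ z t) : Relation.TransGen (Link E S T) y z := by
  have hyp : ∀ w, Conn E X p w → Conn E Set.univ s w := fun w hw =>
    (hsy.snoc ey trivial).trans (hw.mono (Set.subset_univ _))
  have hqt : ∀ w, Conn E X w q → Conn E Set.univ w t := fun w hw =>
    ((hw.mono (Set.subset_univ _)).snoc ez trivial).trans hzt
  have huse : ∀ w, Conn E X p w → Conn E X w q → Useful E S T w := fun w h1 h2 =>
    ⟨⟨s, hs, hyp w h1⟩, t, ht, hqt w h2⟩
  have hz : Useful E S T z :=
    ⟨⟨s, hs, (hyp q hpq).snoc ez trivial⟩, t, ht, hzt⟩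
  have hy : Useful E S T y :=
    ⟨⟨s, hs, hsy⟩, t, ht, (hqt p hpq).cons trivial ey⟩
  have key : ∀ w, Conn E {x | Conn E X x q} p w → Relation.TransGen (Link E S T) y w := by
    intro w hw
    induction hw using Conn.tail_induction with
    | base h =>
      have h' : Conn E X p q := h.1
      exact .single ⟨hy, huse p (.refl h'.1) h', .inl ey, fun hh => hX p h'.1 hh.2⟩
    | step a b ha e hb ih =>
      have h1 : Conn E X p a := ha.mono fun x hx => Conn.left_mem hx
      have hb' : b ∈ X := Conn.left_mem hb
      exact ih.tail ⟨huse a h1 ha.right_mem, huse b (h1.snoc e hb') hb, .inl e,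
        fun hh => hX b hb' hh.2⟩
  exact (key q hpq.coreachable).tail ⟨huse q hpq (.refl hpq.right_mem), hz, .inl ez,
    fun hh => hX q hpq.right_mem hh.1⟩

/-- Every separating pair has one vertex in `A` and one in `B`. So `C` has no critical vertex, and a
chain of partners that starts in `A` stays there. -/
theorem SetShunt.criterion (h : SetShunt E S T) : ShuntCriterion E S T := by
  obtain ⟨A, B, C, s, s', t, t', r, r', a, b, hAB, hAC, hBC, rfl, rfl, hst, hsr, hst', hrt',
    era, hab, ebr⟩ := h
  have hs : s ∈ ({s, s'} : Set V) := .inl rfl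
  have hs' : s' ∈ ({s, s'} : Set V) := .inr rfl
  have ht : t ∈ ({t, t'} : Set V) := .inl rfl
  have ht' : t' ∈ ({t, t'} : Set V) := .inr rfl
  have hcut : ∀ x y, Cut E {s, s'} {t, t'} x y → x ∈ A ∧ y ∈ B ∨ x ∈ B ∧ y ∈ A :=
    fun x y h => h.mem_and_mem hs ht hs' ht' hst hst' hAB
  have hABn : ∀ x, x ∈ A → x ∉ B := fun x h h' => Set.disjoint_left.1 hAB h h'
  have hC : ∀ x ∈ C, ¬ OnCut E {s, s'} {t, t'} x := by
    rintro x hx ⟨y, hy⟩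
    rcases hcut x y hy with h | h
    · exact Set.disjoint_left.1 hAC h.1 hx
    · exact Set.disjoint_left.1 hBC h.1 hx
  have hsc : OnCut E {s, s'} {t, t'} s :=
    ⟨s', fun x hx _ _ h => h.left_mem hx⟩
  have htc : OnCut E {s, s'} {t, t'} t' :=
    ⟨t, fun _ _ x hx h => h.right_mem (by rwa [Set.pair_comm] at hx)⟩
  refine ⟨fun x hx => ?_, ?_⟩
  · rcases hcut x x hx with h | h
    · exact hABn x h.1 h.2
    · exact hABn x h.2 h.1
  -- The start `s` and the end `t'` are critical, because `S` and `T` are separating pairs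
  -- themselves. Hence a last critical vertex before the third path and a first one after it exist.
  obtain ⟨u, hu, huA, hsu, hur⟩ := hsr.last_hit_of_mem (Y := {x | OnCut E {s, s'} {t, t'} x}) hsc
  obtain ⟨u', hu', hu'B, hut', hur'⟩ :=
    hrt'.first_hit_of_mem (Y := {x | OnCut E {s, s'} {t, t'} x}) htc
  refine ⟨u, u', hu, hu', ?_, fun hp => ?_⟩
  · set X : Set V := {x | ¬ OnCut E {s, s'} {t, t'} x} with hX
    have hab' : Conn E X a b := hab.mono hC
    obtain ⟨p, eup, hpb⟩ : ∃ p, E u p ∧ Conn E X p b := by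
      rcases hur with rfl | ⟨p, ep, hp⟩
      · exact ⟨a, era, hab'⟩
      · exact ⟨p, ep, (hp.mono fun x hx => hx.2).trans
          (hab'.cons hp.right_mem.2 era)⟩
    obtain ⟨q, hpq, equ⟩ : ∃ q, Conn E X p q ∧ E q u' := by
      rcases hur' with rfl | ⟨q, hq, eq⟩
      · exact ⟨b, hpb, ebr⟩
      · exact ⟨q, hpb.trans ((hq.mono fun x hx => hx.2).cons hpb.right_mem ebr), eq⟩
    exact link_of_conn (X := X) (fun x hx => hx) hs (hsu.mono (Set.subset_univ _)) eup hpq equ ht'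
      (hut'.mono (Set.subset_univ _))
  · have : ∀ v, Relation.TransGen (Partner E {s, s'} {t, t'}) u v → v ∈ A := by
      intro v hv
      have step : ∀ x y, x ∈ A → Partner E {s, s'} {t, t'} x y → y ∈ A := by
        rintro x y hx ⟨z, hxz, hyz⟩
        have h1 := hcut x z hxz
        have h2 := hcut y z hyz
        have h3 := hABn x
        have h4 := hABn z
        tauto
      induction hv with
      | single h => exact step _ _ huA h
      | tail _ h ih => exact step _ _ ih h
    exact hABn u' (this u' hp) hu'B

/-- Disjointness makes the two starts distinct and the two ends distinct, so they exhaust the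
two-element sets `S` and `T`. -/
theorem exists_pathPair {x y x' y' : V} (hS : S = {x, y}) (hT : T = {x', y'}) {A B : Set V}
    {s s' t t' : V} (hAB : Disjoint A B) (hs : s ∈ S) (hs' : s' ∈ S) (ht : t ∈ T) (ht' : t' ∈ T)
    (hA : Conn E A s t) (hB : Conn E B s' t') :
    ∃ π : PathPair E S T, π.P.verts ⊆ A ∧ π.Q.verts ⊆ B := by
  obtain ⟨P, hP⟩ := hA.exists_opath
  obtain ⟨Q, hQ⟩ := hB.exists_opath
  have hne : ∀ z ∈ A, ∀ w ∈ B, z ≠ w := by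
    rintro z hz _ hw rfl; exact Set.disjoint_left.1 hAB hz hw
  have h1 := hne s hA.left_mem s' hB.left_mem
  have h2 := hne t hA.right_mem t' hB.right_mem
  have pair : ∀ {a b z w : V}, a ∈ ({z, w} : Set V) → b ∈ ({z, w} : Set V) → a ≠ b →
      ({a, b} : Set V) = {z, w} := by
    rintro a b z w (rfl | rfl) (rfl | rfl) h
    · exact absurd rfl h
    · rfl
    · exact Set.pair_comm _ _
    · exact absurd rfl h
  refine ⟨⟨s, s', t, t', P, Q, hAB.mono hP hQ, ?_, ?_⟩, hP, hQ⟩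
  · subst hS; exact pair hs hs' h1
  · subst hT; exact pair ht ht' h2

/-- Menger's theorem after the deletion of `v`: a vertex `y` that separates there would form a
separating pair with `v`. -/
theorem exists_pathPair_not_mem {x y x' y' : V} (hS : S = {x, y}) (hT : T = {x', y'}) {v : V}
    (hv : ¬ OnCut E S T v) : ∃ π : PathPair E S T, v ∉ π.verts := by
  have : Nonempty V := ⟨v⟩
  have h : TwoDisjoint (fun a b => E a b ∧ b ∈ ({v}ᶜ : Set V)) (S \ {v}) T := by
    refine twoDisjoint_of_forall_conn fun y => ?_
    have : ¬ Cut E S T v y := fun h => hv ⟨y, h⟩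
    unfold Cut at this
    push Not at this
    obtain ⟨s, hs, t, ht, hst⟩ := this
    refine ⟨s, ⟨hs, fun h => hst.left_mem (.inl h)⟩, t, ht, (hst.restrict ?_).mono ?_⟩
    · exact fun z hz h => hz (.inl h)
    · exact fun z hz h => hz (.inr h)
  obtain ⟨A, B, hAB, ⟨s, hs, t, ht, hst⟩, s', hs', t', ht', hst'⟩ := h
  obtain ⟨π, hπ, hπ'⟩ := exists_pathPair hS hT
    (hAB.mono Set.inter_subset_left Set.inter_subset_left) hs.1 hs'.1 ht ht'
    (hst.of_restrict hs.2) (hst'.of_restrict hs'.2)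
  refine ⟨π, ?_⟩
  rintro (h | h)
  · exact (hπ h).2 rfl
  · exact (hπ' h).2 rfl

theorem exists_pathPair_of_not_cut {x y x' y' : V} (hS : S = {x, y}) (hT : T = {x', y'})
    (h : ∀ v, ¬ Cut E S T v v) : Nonempty (PathPair E S T) := by
  have : Nonempty V := ⟨x⟩
  obtain ⟨A, B, hAB, ⟨s, hs, t, ht, hst⟩, s', hs', t', ht', hst'⟩ :=
    twoDisjoint_of_forall_conn (E := E) (S := S) (T := T) fun y => by
      have := h y
      unfold Cut at this
      push Not at this
      simpa using this
  obtain ⟨π, -⟩ := exists_pathPair hS hT hAB hs hs' ht ht' hst hst'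
  exact ⟨π⟩

/-! ### The two sides of a pair of paths, and uncrossing of separating pairs -/

namespace PathPair

variable {π : PathPair E S T}

theorem mem_of_cut {x y : V} (h : Cut E S T x y) :
    x ∈ π.P.verts ∧ y ∈ π.Q.verts ∨ x ∈ π.Q.verts ∧ y ∈ π.P.verts :=
  h.mem_and_mem s₁_mem t₁_mem s₂_mem t₂_mem π.P.conn π.Q.conn π.disj

theorem mem_of_onCut {x : V} (h : OnCut E S T x) : x ∈ π.verts := by
  obtain ⟨y, hy⟩ := h
  rcases mem_of_cut (π := π) hy with h | h
  · exact .inl h.1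
  · exact .inr h.1

/-- Without a shunt, the ends of the arcs between the two paths lie on all pairs of paths. -/
theorem onCut_of_cross (ns : ¬ SetShunt E S T) {x y : V} (hx : x ∈ π.P.verts)
    (hy : y ∈ π.Q.verts) (e : E x y ∨ E y x) : OnCut E S T x := by
  by_contra hc
  obtain ⟨ρ, hρ⟩ := exists_pathPair_not_mem π.starts.symm π.ends.symm hc
  have hess := not_conn_of_cross ns hx hy e
  -- The starts of `ρ` are those of `π`, perhaps in the other order; `mem_of_not_conn` needs the
  -- same order, while the ends may be permuted.
  wlog h1 : ρ.s₁ = π.s₁ generalizing ρ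
  · refine this ρ.swap (by rwa [ρ.swap_verts]) ?_
    have h2 := (start_mem (π := π) ρ.s₁_mem).resolve_left h1
    refine (start_mem (π := π) ρ.s₂_mem).resolve_right fun h3 => ?_
    exact not_mem_right ρ.P.left_mem (by rw [h2, ← h3]; exact ρ.Q.left_mem)
  have h2 : ρ.s₂ = π.s₂ := (start_mem (π := π) ρ.s₂_mem).resolve_left fun h3 =>
    not_mem_right ρ.P.left_mem (by rw [h1, ← h3]; exact ρ.Q.left_mem)
  obtain ⟨a, b, c, d, P', Q', hd, _, hT'⟩ := ρ
  dsimp only at h1 h2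
  subst h1 h2
  exact hρ (mem_of_not_conn _ ns rfl P' Q' hT' hd x hx hess)

variable (π) in
/-- `x` belongs to the first path, or can be reached from it outside of both paths. -/
def OnSide (x : V) : Prop :=
  x ∈ π.P.verts ∨ ∃ r ∈ π.P.verts, ∃ a, E r a ∧ Conn E π.vertsᶜ a x

theorem mem_verts_of_start {s : V} (hs : s ∈ S) : s ∈ π.verts := by
  rcases start_mem (π := π) hs with rfl | rfl
  · exact .inl π.P.left_mem
  · exact .inr π.Q.left_mem

theorem mem_verts_of_end {t : V} (ht : t ∈ T) : t ∈ π.verts := by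
  rcases end_mem (π := π) ht with rfl | rfl
  · exact .inl π.P.right_mem
  · exact .inr π.Q.right_mem

theorem onSide_or_onSide {x : V} (h : Useful E S T x) : π.OnSide x ∨ π.swap.OnSide x := by
  obtain ⟨⟨s, hs, hsx⟩, -⟩ := h
  obtain ⟨r, hr, -, -, rfl | ⟨p, ep, hp⟩⟩ :=
    hsx.last_hit_of_mem (mem_verts_of_start (π := π) hs)
  · rcases hr with hr | hr
    · exact .inl (.inl hr)
    · exact .inr (.inl hr)
  · have hp' : Conn E π.vertsᶜ p x := hp.mono fun _ h => h.2
    rcases hr with hr | hr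
    · exact .inl (.inr ⟨r, hr, p, ep, hp'⟩)
    · exact .inr (.inr ⟨r, hr, p, ep, by rwa [π.swap_verts]⟩)

theorem OnSide.not_mem {x : V} (h : π.OnSide x) : x ∉ π.Q.verts := by
  rcases h with h | ⟨r, hr, a, e, h⟩
  · exact not_mem_right h
  · exact fun hx => h.right_mem (.inr hx)

/-- A vertex reached from both paths can be continued to its first vertex on one of them, which
gives an ear from the other one. -/
theorem OnSide.not_swap (ns : ¬ SetShunt E S T) {x : V} (hu : Useful E S T x) (h : π.OnSide x) :
    ¬ π.swap.OnSide x := by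
  intro h'
  have h1 := h.not_mem
  have h2 := h'.not_mem
  obtain ⟨r, hr, a, e, hax⟩ := h.resolve_left h2
  obtain ⟨r', hr', a', e', hax'⟩ := h'.resolve_left h1
  obtain ⟨-, t, ht, hxt⟩ := hu
  obtain ⟨y, hy, -, -, rfl | ⟨p, hp, ep⟩⟩ :=
    hxt.first_hit_of_mem (mem_verts_of_end (π := π) ht)
  · exact hax.right_mem hy
  · have hp' : Conn E π.vertsᶜ x p := hp.mono fun _ h => h.2
    rcases hy with hy | hy
    · exact no_ear (π := π.swap) ns hr' e' (hax'.trans (by rwa [π.swap_verts])) ep hy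
    · exact no_ear ns hr e (hax.trans hp') ep hy

/-- If `y` were off the paths, it would be on the side of `x` too; if `x` were off the paths, the
arc would complete an ear. -/
theorem cross_of_onSide (ns : ¬ SetShunt E S T) {x y : V} (huy : Useful E S T y) (e : E x y) (hx : π.OnSide x) (hy : π.swap.OnSide y) :
    x ∈ π.P.verts ∧ y ∈ π.Q.verts := by
  have hyn : ¬ π.OnSide y := fun h => h.not_swap ns huy hy
  have hyP : y ∉ π.P.verts := fun h => hyn (.inl h)
  have hyQ : y ∈ π.Q.verts := by
    by_contra hyQ
    have hyv : y ∈ π.vertsᶜ := by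
      rintro (h | h)
      · exact hyP h
      · exact hyQ h
    rcases hx with hx | ⟨r, hr, a, ea, ha⟩
    · exact hyn (.inr ⟨x, hx, y, e, .refl hyv⟩)
    · exact hyn (.inr ⟨r, hr, a, ea, ha.snoc e hyv⟩)
  refine ⟨?_, hyQ⟩
  rcases hx with hx | ⟨r, hr, a, ea, ha⟩
  · exact hx
  · exact absurd hyQ (no_ear ns hr ea ha e)

theorem onSide_of_link (ns : ¬ SetShunt E S T) {i j : V} (h : Link E S T i j) (hi : π.OnSide i) :
    π.OnSide j := by
  obtain ⟨hui, huj, e, hc⟩ := h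
  by_contra hj
  have hj' := (onSide_or_onSide (π := π) huj).resolve_left hj
  have key : i ∈ π.P.verts ∧ j ∈ π.Q.verts := by
    rcases e with e | e
    · exact cross_of_onSide ns huj e hi hj'
    · exact (cross_of_onSide (π := π.swap) ns hui e hj' hi).symm
  exact hc ⟨onCut_of_cross ns key.1 key.2 e, onCut_of_cross (π := π.swap) ns key.2 key.1 e.symm⟩

theorem onSide_of_transGen (ns : ¬ SetShunt E S T) {i j : V}
    (h : Relation.TransGen (Link E S T) i j) (hi : π.OnSide i) : π.OnSide j := by
  induction h with
  | single h => exact onSide_of_link ns h hi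
  | tail _ h ih => exact onSide_of_link ns h ih

theorem mem_of_transGen (ns : ¬ SetShunt E S T) {i j : V} (hj : OnCut E S T j)
    (h : Relation.TransGen (Link E S T) i j) (hi : i ∈ π.P.verts) : j ∈ π.P.verts :=
  (mem_of_onCut (π := π) hj).resolve_right (onSide_of_transGen ns h (.inl hi)).not_mem

/-- Crossing separating pairs can be uncrossed. -/
theorem cut_uncross {a b a' b' : V} (ha : a ∈ π.P.verts) (hb : b ∈ π.Q.verts)
    (ha' : a' ∈ π.P.verts) (hb' : b' ∈ π.Q.verts) (h : Cut E S T a b) (h' : Cut E S T a' b')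
    (haa : π.P.rk a < π.P.rk a') (hbb : π.Q.rk b' < π.Q.rk b) :
    Cut E S T a b' ∧ Cut E S T a' b := by
  constructor
  · intro s hs t ht hst
    rcases hst.first_hit {a', b} with h1 | ⟨y, hy, hyX, -, h1⟩
    · exact h s hs t ht (h1.mono fun z hz hz' => by
        rcases hz' with rfl | rfl
        · exact hz.1 (.inl rfl)
        · exact hz.2 (.inr rfl))
    have hpre : ∀ q, Conn E ({a, b'}ᶜ \ {a', b}) s q → Conn E {a, b}ᶜ s q ∧ Conn E {a', b'}ᶜ s q :=
      fun q hq => ⟨hq.mono fun z hz hz' => by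
        rcases hz' with rfl | rfl
        · exact hz.1 (.inl rfl)
        · exact hz.2 (.inr rfl), hq.mono fun z hz hz' => by
        rcases hz' with rfl | rfl
        · exact hz.2 (.inl rfl)
        · exact hz.1 (.inr rfl)⟩
    -- From `a'` the first path leads to `T` and avoids `a` and `b`; from `b` the second path leads
    -- to `T` and avoids `a'` and `b'`. Either way one of the given pairs does not separate.
    rcases hy with rfl | rfl
    · have h2 : Conn E {a, b}ᶜ y π.t₁ := (π.P.conn_from ha').mono (by
        rintro w hw (rfl | rfl)
        · have := hw.2; omega
        · exact not_mem_left hb hw.1)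
      rcases h1 with rfl | ⟨q, hq, e⟩
      · exact h _ hs _ t₁_mem h2
      · exact h _ hs _ t₁_mem ((hpre q hq).1.trans (h2.cons (hpre q hq).1.right_mem e))
    · have h2 : Conn E {a', b'}ᶜ y π.t₂ := (π.Q.conn_from hb).mono (by
        rintro w hw (rfl | rfl)
        · exact not_mem_right ha' hw.1
        · have := hw.2; omega)
      rcases h1 with rfl | ⟨q, hq, e⟩
      · exact h' _ hs _ t₂_mem h2
      · exact h' _ hs _ t₂_mem ((hpre q hq).2.trans (h2.cons (hpre q hq).2.right_mem e))
  · intro s hs t ht hst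
    rcases hst.last_hit {a, b'} with h1 | ⟨y, hy, hyX, -, h1⟩
    · exact h s hs t ht (h1.mono fun z hz hz' => by
        rcases hz' with rfl | rfl
        · exact hz.2 (.inl rfl)
        · exact hz.1 (.inr rfl))
    have hpost : ∀ q, Conn E ({a', b}ᶜ \ {a, b'}) q t → Conn E {a, b}ᶜ q t ∧ Conn E {a', b'}ᶜ q t :=
      fun q hq => ⟨hq.mono fun z hz hz' => by
        rcases hz' with rfl | rfl
        · exact hz.2 (.inl rfl)
        · exact hz.1 (.inr rfl), hq.mono fun z hz hz' => by
        rcases hz' with rfl | rfl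
        · exact hz.1 (.inl rfl)
        · exact hz.2 (.inr rfl)⟩
    rcases hy with rfl | rfl
    · have h2 : Conn E {a', b'}ᶜ π.s₁ y := (π.P.conn_to ha).mono (by
        rintro w hw (rfl | rfl)
        · have := hw.2; omega
        · exact not_mem_left hb' hw.1)
      rcases h1 with rfl | ⟨q, e, hq⟩
      · exact h' _ s₁_mem _ ht h2
      · exact h' _ s₁_mem _ ht (h2.trans ((hpost q hq).2.cons h2.right_mem e))
    · have h2 : Conn E {a, b}ᶜ π.s₂ y := (π.Q.conn_to hb').mono (by
        rintro w hw (rfl | rfl)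
        · exact not_mem_right ha hw.1
        · have := hw.2; omega)
      rcases h1 with rfl | ⟨q, e, hq⟩
      · exact h _ s₂_mem _ ht h2
      · exact h _ s₂_mem _ ht (h2.trans ((hpost q hq).1.cons h2.right_mem e))

end PathPair

end Criterion

/-! ### Chains of partners in the absence of shunts -/

namespace PathPair

variable {V : Type*} {E : V → V → Prop} {S T : Set V} {π : PathPair E S T}

/-- Between two separating pairs that do not cross there is an arc from one path to the other, if the
outer vertices of the four do not form a separating pair. -/
theorem arc_of_not_cut (ns : ¬ SetShunt E S T) {a b a' b' : V} (ha : a ∈ π.P.verts)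
    (hb : b ∈ π.Q.verts) (ha' : a' ∈ π.P.verts) (hb' : b' ∈ π.Q.verts) (h : Cut E S T a b)
    (h' : Cut E S T a' b') (hn : ¬ Cut E S T a b') (haa : π.P.rk a < π.P.rk a')
    (hbb : π.Q.rk b < π.Q.rk b')
    (gapP : ∀ z ∈ π.P.verts, OnCut E S T z → π.P.rk z ≤ π.P.rk a ∨ π.P.rk a' ≤ π.P.rk z)
    (gapQ : ∀ z ∈ π.Q.verts, OnCut E S T z → π.Q.rk z ≤ π.Q.rk b ∨ π.Q.rk b' ≤ π.Q.rk z) :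
    E b a' := by
  unfold Cut at hn
  push Not at hn
  obtain ⟨s, hs, t, ht, hst⟩ := hn
  set L : Set V := {z | z ∈ π.P.verts ∧ π.P.rk z ≤ π.P.rk a} ∪
    {z | z ∈ π.Q.verts ∧ π.Q.rk z ≤ π.Q.rk b} with hL
  set R : Set V := {z | z ∈ π.P.verts ∧ π.P.rk a' ≤ π.P.rk z} ∪
    {z | z ∈ π.Q.verts ∧ π.Q.rk b' ≤ π.Q.rk z} with hR
  have hsL : s ∈ L := by
    rcases start_mem (π := π) hs with rfl | rfl
    · exact .inl ⟨π.P.left_mem, π.P.left_le a ha⟩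
    · exact .inr ⟨π.Q.left_mem, π.Q.left_le b hb⟩
  have htR : t ∈ R := by
    rcases end_mem (π := π) ht with rfl | rfl
    · exact .inl ⟨π.P.right_mem, π.P.le_right a' ha'⟩
    · exact .inr ⟨π.Q.right_mem, π.Q.le_right b' hb'⟩
  have hLR : ∀ z ∈ L, z ∉ R := by
    rintro z (⟨h1, h2⟩ | ⟨h1, h2⟩) (⟨h3, h4⟩ | ⟨h3, h4⟩)
    · omega
    · exact not_mem_right h1 h3
    · exact not_mem_right h3 h1
    · omega
  have haL : a ∈ L := .inl ⟨ha, le_rfl⟩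
  have hbL : b ∈ L := .inr ⟨hb, le_rfl⟩
  have haR : a' ∈ R := .inl ⟨ha', le_rfl⟩
  have hbR : b' ∈ R := .inr ⟨hb', le_rfl⟩
  have sub1 : Lᶜ ⊆ ({a, b}ᶜ : Set V) := by
    rintro z hz (rfl | rfl)
    · exact hz haL
    · exact hz hbL
  have sub2 : Rᶜ ⊆ ({a', b'}ᶜ : Set V) := by
    rintro z hz (rfl | rfl)
    · exact hz haR
    · exact hz hbR
  obtain ⟨z, hzL, hzX, -, rfl | ⟨p, ezp, hpt⟩⟩ := hst.last_hit_of_mem hsL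
  · exact absurd htR (hLR _ hzL)
  have hpt' : Conn E {a, b}ᶜ p t := hpt.mono fun x hx => sub1 hx.2
  -- From any vertex of `L` other than `b` that the walk may use, going on to `t` would avoid both
  -- `a` and `b`.
  have hzb : z = b := by
    by_contra hzb
    rcases hzL with ⟨h1, h2⟩ | ⟨h1, h2⟩
    · have h3 := π.P.rk_lt h1 ha h2 (by rintro rfl; exact hzX (.inl rfl))
      have h4 : Conn E {a, b}ᶜ π.s₁ z := (π.P.conn_to h1).mono (by
        rintro w hw (rfl | rfl)
        · have := hw.2; omega
        · exact not_mem_left hb hw.1)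
      exact h _ s₁_mem _ ht (h4.trans (hpt'.cons h4.right_mem ezp))
    · have h3 := π.Q.rk_lt h1 hb h2 hzb
      have h4 : Conn E {a, b}ᶜ π.s₂ z := (π.Q.conn_to h1).mono (by
        rintro w hw (rfl | rfl)
        · exact not_mem_right ha hw.1
        · have := hw.2; omega)
      exact h _ s₂_mem _ ht (h4.trans (hpt'.cons h4.right_mem ezp))
  subst hzb
  obtain ⟨y, hyR, hyX, -, hy⟩ := hpt.first_hit_of_mem htR
  have hsb : Conn E {a', b'}ᶜ π.s₂ z := (π.Q.conn_to hb).mono (by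
    rintro w hw (rfl | rfl)
    · exact not_mem_right ha' hw.1
    · have := hw.2; omega)
  have hsy : ∀ X, {a', b'}ᶜ ⊆ X → y ∈ X → Conn E X π.s₂ y := by
    intro X hX hyX
    rcases hy with rfl | ⟨q, hq, e⟩
    · exact (hsb.mono hX).snoc ezp hyX
    · exact (((hsb.mono hX)).trans ((hq.mono fun x hx => hX (sub2 hx.2)).cons
        (hsb.mono hX).right_mem ezp)).snoc e hyX
  -- By the same argument at the other end: entering `R` elsewhere would give a walk that avoids
  -- `a'` and `b'`.
  have hya : y = a' := by
    by_contra hya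
    have hyc : y ∈ ({a', b'}ᶜ : Set V) := by
      rintro (rfl | rfl)
      · exact hya rfl
      · exact hyX.1 (.inr rfl)
    rcases hyR with ⟨h1, h2⟩ | ⟨h1, h2⟩
    · have h3 := π.P.rk_lt ha' h1 h2 (Ne.symm hya)
      refine h' _ s₂_mem _ t₁_mem ((hsy _ le_rfl hyc).trans ((π.P.conn_from h1).mono ?_))
      rintro w hw (rfl | rfl)
      · have := hw.2; omega
      · exact not_mem_left hb' hw.1
    · have h3 := π.Q.rk_lt hb' h1 h2 (by rintro rfl; exact hyc (.inr rfl))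
      refine h' _ s₂_mem _ t₂_mem ((hsy _ le_rfl hyc).trans ((π.Q.conn_from h1).mono ?_))
      rintro w hw (rfl | rfl)
      · exact not_mem_right ha' hw.1
      · have := hw.2; omega
  subst hya
  rcases hy with rfl | ⟨q, hpq, eq⟩
  · exact ezp
  exfalso
  have hnc : ∀ x ∈ ({a, b'}ᶜ \ L : Set V) \ R, ¬ OnCut E S T x := by
    rintro x ⟨⟨-, hxL⟩, hxR⟩ hx
    rcases mem_of_onCut (π := π) hx with h1 | h1
    · rcases gapP x h1 hx with h2 | h2
      · exact hxL (.inl ⟨h1, h2⟩)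
      · exact hxR (.inl ⟨h1, h2⟩)
    · rcases gapQ x h1 hx with h2 | h2
      · exact hxL (.inr ⟨h1, h2⟩)
      · exact hxR (.inr ⟨h1, h2⟩)
  -- If the walk from `b` to `a'` is not a single arc, it has no critical internal vertex and is a
  -- chain of links between critical vertices on different paths.
  have hlink := link_of_conn hnc (s₂_mem (π := π)) (hsb.mono (Set.subset_univ _)) ezp hpq eq
    (t₁_mem (π := π)) ((π.P.conn_from ha').mono (Set.subset_univ _))
  exact not_mem_right ha' (mem_of_transGen (π := π.swap) ns ⟨b', h'⟩ hlink hb)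

theorem exists_forall_ge {Y : Set V} (f : V → ℕ) (hY : Y.Nonempty) (m : ℕ)
    (hm : ∀ z ∈ Y, f z ≤ m) : ∃ b ∈ Y, ∀ z ∈ Y, f z ≤ f b := by
  obtain ⟨b, hb, h⟩ := hY.exists_forall_le fun z => m - f z
  refine ⟨b, hb, fun z hz => ?_⟩
  have := h z hz; have := hm z hz; have := hm b hb
  omega

/-- Two vertices of separating pairs that are on the same path for all pairs of paths. -/
theorem transGen_partner (ns : ¬ SetShunt E S T) {u u' : V} (hu : u ∈ π.P.verts)
    (hu' : u' ∈ π.P.verts) (hcu : OnCut E S T u) (hcu' : OnCut E S T u')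
    (huu : π.P.rk u ≤ π.P.rk u')
    (same : ∀ ρ : PathPair E S T, u ∈ ρ.P.verts → u' ∈ ρ.P.verts) :
    Relation.TransGen (Partner E S T) u u' := by
  by_contra hnp
  have prt : ∀ {x}, x ∈ π.P.verts → OnCut E S T x → ∃ q ∈ π.Q.verts, Cut E S T x q := by
    rintro x hx ⟨q, hq⟩
    rcases mem_of_cut (π := π) hq with h | h
    · exact ⟨q, h.2, hq⟩
    · exact absurd h.1 (not_mem_right hx)
  have prt' : ∀ {x}, x ∈ π.Q.verts → OnCut E S T x → ∃ q ∈ π.P.verts, Cut E S T q x := by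
    rintro x hx ⟨q, hq⟩
    rcases mem_of_cut (π := π) hq with h | h
    · exact absurd h.1 (not_mem_left hx)
    · exact ⟨q, h.2, hq.symm⟩
  have self : ∀ {x}, OnCut E S T x → Partner E S T x x := fun ⟨q, hq⟩ => ⟨q, hq, hq⟩
  -- Here the chain of partners breaks off: `a` is the last critical vertex up to `u'` that it
  -- reaches, and `a'` the next critical vertex on the path.
  obtain ⟨a, ⟨haP, hac, hua, hau'⟩, hamax⟩ := exists_forall_ge
    (Y := {z | z ∈ π.P.verts ∧ OnCut E S T z ∧ Relation.TransGen (Partner E S T) u z ∧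
      π.P.rk z ≤ π.P.rk u'}) π.P.rk ⟨u, hu, hcu, .single (self hcu), huu⟩ (π.P.rk u')
    fun z hz => hz.2.2.2
  have hau : π.P.rk a < π.P.rk u' := π.P.rk_lt haP hu' hau' (by rintro rfl; exact hnp hua)
  have hua' : π.P.rk u ≤ π.P.rk a := hamax u ⟨hu, hcu, .single (self hcu), huu⟩
  obtain ⟨a', ⟨haP', hac', haa⟩, hamin⟩ := Set.Nonempty.exists_forall_le
    (Y := {z | z ∈ π.P.verts ∧ OnCut E S T z ∧ π.P.rk a < π.P.rk z}) ⟨u', hu', hcu', hau⟩ π.P.rk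
  have hau'' : π.P.rk a' ≤ π.P.rk u' := hamin u' ⟨hu', hcu', hau⟩
  have hnpa : ¬ Partner E S T a a' := fun h => by
    have := hamax a' ⟨haP', hac', hua.tail h, hau''⟩
    omega
  have gapP : ∀ z ∈ π.P.verts, OnCut E S T z → π.P.rk z ≤ π.P.rk a ∨ π.P.rk a' ≤ π.P.rk z := by
    intro z hz hcz
    by_contra! hh
    have := hamin z ⟨hz, hcz, hh.1⟩
    omega
  -- On the second path, `b` is the last vertex paired with a critical vertex up to `a`, and `b'`
  -- the first one paired with a critical vertex from `a'` on. Uncrossing shows that they are paired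
  -- with `a` and `a'` themselves.
  obtain ⟨b, ⟨hbQ, p, hp, hpa, hpb⟩, hbmax⟩ := exists_forall_ge
    (Y := {q | q ∈ π.Q.verts ∧ ∃ p ∈ π.P.verts, π.P.rk p ≤ π.P.rk a ∧ Cut E S T p q}) π.Q.rk
    (by
      obtain ⟨q, hq, hq'⟩ := prt haP hac
      exact ⟨q, hq, a, haP, le_rfl, hq'⟩) (π.Q.rk π.t₂) fun z hz => π.Q.le_right z hz.1
  obtain ⟨b', ⟨hbQ', p', hp', hpa', hpb'⟩, hbmin⟩ := Set.Nonempty.exists_forall_le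
    (Y := {q | q ∈ π.Q.verts ∧ ∃ p ∈ π.P.verts, π.P.rk a' ≤ π.P.rk p ∧ Cut E S T p q})
    (by
      obtain ⟨q, hq, hq'⟩ := prt haP' hac'
      exact ⟨q, hq, a', haP', le_rfl, hq'⟩) π.Q.rk
  have hab : Cut E S T a b := by
    obtain ⟨q, hq, hqc⟩ := prt haP hac
    have h1 := hbmax q ⟨hq, a, haP, le_rfl, hqc⟩
    by_cases h2 : p = a
    · rwa [← h2]
    by_cases h3 : q = b
    · rwa [← h3]
    exact (cut_uncross hp hbQ haP hq hpb hqc (π.P.rk_lt hp haP hpa h2) (π.Q.rk_lt hq hbQ h1 h3)).2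
  have hab' : Cut E S T a' b' := by
    obtain ⟨q, hq, hqc⟩ := prt haP' hac'
    have h1 := hbmin q ⟨hq, a', haP', le_rfl, hqc⟩
    by_cases h2 : a' = p'
    · rwa [h2]
    by_cases h3 : b' = q
    · rwa [h3]
    exact (cut_uncross haP' hq hp' hbQ' hqc hpb' (π.P.rk_lt haP' hp' hpa' h2)
      (π.Q.rk_lt hbQ' hq h1 h3)).1
  have hn1 : ¬ Cut E S T a b' := fun h => hnpa ⟨b', h, hab'⟩
  have hn2 : ¬ Cut E S T a' b := fun h => hnpa ⟨b, hab, h⟩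
  have hbb : π.Q.rk b < π.Q.rk b' := by
    by_contra! hh
    by_cases h3 : b' = b
    · exact hn1 (by rwa [h3])
    · exact hn1 (cut_uncross haP hbQ haP' hbQ' hab hab' haa (π.Q.rk_lt hbQ' hbQ hh h3)).1
  have gapQ : ∀ z ∈ π.Q.verts, OnCut E S T z → π.Q.rk z ≤ π.Q.rk b ∨ π.Q.rk b' ≤ π.Q.rk z := by
    intro z hz hcz
    obtain ⟨x, hx, hxz⟩ := prt' hz hcz
    rcases gapP x hx ⟨z, hxz⟩ with h | h
    · exact .inl (hbmax z ⟨hz, x, hx, h, hxz⟩)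
    · exact .inr (hbmin z ⟨hz, x, hx, h, hxz⟩)
  have eba : E b a' := arc_of_not_cut ns haP hbQ haP' hbQ' hab hab' hn1 haa hbb gapP gapQ
  have eab : E a b' := arc_of_not_cut (π := π.swap) ns hbQ haP hbQ' haP' hab.symm hab'.symm
    (fun h => hn2 h.symm) hbb haa gapQ gapP
  have hA := π.P.conn_to haP
  have hB := π.Q.conn_from hbQ'
  have hC := π.Q.conn_to hbQ
  have hD := π.P.conn_from haP'
  -- Exchanging the final parts along `a b'` and `b a'` separates `u`, which is at or before `a`,
  -- from `u'`, which is at or after `a'`.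
  obtain ⟨ρ, hρ, hρ'⟩ := exists_pathPair π.starts.symm π.ends.symm
    (A := {z | z ∈ π.P.verts ∧ π.P.rk z ≤ π.P.rk a} ∪ {z | z ∈ π.Q.verts ∧ π.Q.rk b' ≤ π.Q.rk z})
    (B := {z | z ∈ π.Q.verts ∧ π.Q.rk z ≤ π.Q.rk b} ∪ {z | z ∈ π.P.verts ∧ π.P.rk a' ≤ π.P.rk z})
    (by
      rw [Set.disjoint_left]
      rintro w (⟨h1, h2⟩ | ⟨h1, h2⟩) (⟨h3, h4⟩ | ⟨h3, h4⟩)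
      · exact not_mem_right h1 h3
      · omega
      · omega
      · exact not_mem_right h3 h1) (s₁_mem (π := π)) (s₂_mem (π := π)) (t₂_mem (π := π))
    (t₁_mem (π := π))
    ((hA.mono Set.subset_union_left).trans
      ((hB.mono Set.subset_union_right).cons (.inl hA.right_mem) eab))
    ((hC.mono Set.subset_union_left).trans
      ((hD.mono Set.subset_union_right).cons (.inl hC.right_mem) eba))
  have huρ : u ∈ ρ.P.verts := by
    refine (mem_of_onCut (π := ρ) hcu).resolve_right fun h => ?_
    rcases hρ' h with h | h
    · exact not_mem_right hu h.1
    · have := h.2; omega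
  rcases hρ (same ρ huρ) with h | h
  · have := h.2; omega
  · exact not_mem_right hu' h.1

end PathPair

theorem setShunt_iff {V : Type*} {E : V → V → Prop} {S T : Set V} {x y x' y' : V}
    (hS : S = {x, y}) (hT : T = {x', y'}) : SetShunt E S T ↔ ShuntCriterion E S T := by
  refine ⟨SetShunt.criterion, fun ⟨h, u, u', hu, hu', hl, hp⟩ => ?_⟩
  by_contra ns
  obtain ⟨π⟩ := exists_pathPair_of_not_cut hS hT h
  have : Std.Symm (Link E S T) := ⟨fun a b ⟨h1, h2, h3, h4⟩ => ⟨h2, h1, h3.symm, fun h => h4 h.symm⟩⟩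
  have : Std.Symm (Partner E S T) := ⟨fun a b ⟨z, h1, h2⟩ => ⟨z, h2, h1⟩⟩
  have symmL : ∀ {i j}, Relation.TransGen (Link E S T) i j → Relation.TransGen (Link E S T) j i :=
    fun h => Relation.TransGen.stdSymm.symm _ _ h
  have symmP : ∀ {i j}, Relation.TransGen (Partner E S T) i j →
      Relation.TransGen (Partner E S T) j i :=
    fun h => Relation.TransGen.stdSymm.symm _ _ h
  wlog huP : u ∈ π.P.verts generalizing π
  · exact this π.swap ((PathPair.mem_of_onCut hu).resolve_left huP)
  have huP' := PathPair.mem_of_transGen ns hu' hl huP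
  rcases le_total (π.P.rk u) (π.P.rk u') with hle | hle
  · exact hp (PathPair.transGen_partner ns huP huP' hu hu' hle
      fun ρ h => PathPair.mem_of_transGen ns hu' hl h)
  · exact hp (symmP (PathPair.transGen_partner ns huP' huP hu' hu hle
      fun ρ h => PathPair.mem_of_transGen ns hu (symmL hl) h))

/-! ### Shunts and subdivisions of `E₉` -/

section Shunt

variable {V : Type*}

/-- There is a walk of positive length from `u` to `w` with all its internal vertices in `X`. -/
def Thru (E : V → V → Prop) (X : Set V) (u w : V) : Prop :=
  E u w ∨ ∃ x y, E u x ∧ Conn E X x y ∧ E y w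

theorem isDipath_iff_of_ne {D : Digraph V} {u w : V} {p : List V} (huw : u ≠ w) :
    IsDipath D u w p ↔ ∃ l, p = u :: (l ++ [w]) ∧ p.IsChain D.Adj ∧ p.Nodup := by
  constructor
  · rintro ⟨hc, hn, hh, hl⟩
    obtain ⟨q, rfl⟩ := List.head?_eq_some_iff.1 hh
    have hq : q ≠ [] := by rintro rfl; simp at hl; exact huw hl
    obtain ⟨l, b, rfl⟩ : ∃ l b, q = l ++ [b] := ⟨_, _, (List.dropLast_append_getLast hq).symm⟩
    rw [← List.cons_append, List.getLast?_concat] at hl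
    cases hl
    exact ⟨l, rfl, hc, hn⟩
  · rintro ⟨l, rfl, hc, hn⟩
    exact ⟨hc, hn, rfl, by rw [← List.cons_append, List.getLast?_concat]⟩

theorem internalVertices_cons_concat (u w : V) (l : List V) :
    internalVertices (u :: (l ++ [w])) = l := by
  simp [internalVertices]

theorem List.IsChain.conn_of_ne_nil {E : V → V → Prop} {l : List V} (h : l.IsChain E)
    (hl : l ≠ []) : Conn E {x | x ∈ l} (l.head hl) (l.getLast hl) := by
  have hpos := List.length_pos_iff.2 hl
  have := h.conn 0 (l.length - 1) (by omega) (by omega)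
  rw [List.head_eq_getElem, List.getLast_eq_getElem]
  refine this.mono ?_
  rintro z ⟨k, hk, rfl, -⟩
  exact List.getElem_mem _

theorem exists_conn_of_chain {E : V → V → Prop} {u w : V} {l : List V}
    (h : (u :: (l ++ [w])).IsChain E) (hl : l ≠ []) :
    ∃ x y, E u x ∧ Conn E {x | x ∈ l} x y ∧ E y w := by
  rw [List.isChain_cons] at h
  obtain ⟨h1, h2⟩ := h
  rw [List.isChain_append] at h2
  refine ⟨l.head hl, l.getLast hl, h1 _ ?_, h2.1.conn_of_ne_nil hl, h2.2.2 _ ?_ _ ?_⟩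
  · simp [List.head?_append, List.head?_eq_some_head hl]
  · simp [List.getLast?_eq_some_getLast hl]
  · simp

theorem isChain_of_conn {E : V → V → Prop} {u w x y : V} {l : List V} (hl : l.IsChain E)
    (hx : l.head? = some x) (hy : l.getLast? = some y) (ex : E u x) (ey : E y w) :
    (u :: (l ++ [w])).IsChain E := by
  rw [List.isChain_cons, List.isChain_append]
  refine ⟨?_, hl, List.isChain_singleton _, ?_⟩
  · intro z hz
    rw [List.head?_append, hx] at hz
    cases hz; exact ex
  · intro z hz z' hz'
    rw [hy] at hz
    cases hz; cases hz'; exact ey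

theorem IsDipath.thru {D : Digraph V} {u w : V} {p : List V} (h : IsDipath D u w p)
    (huw : u ≠ w) : Thru D.Adj {x | x ∈ internalVertices p} u w := by
  obtain ⟨l, rfl, hc, hn⟩ := (isDipath_iff_of_ne huw).1 h
  rw [internalVertices_cons_concat]
  by_cases hl : l = []
  · subst hl
    exact .inl (by simpa using hc)
  · exact .inr (exists_conn_of_chain hc hl)

theorem Thru.exists_isDipath {D : Digraph V} {X : Set V} {u w : V} (h : Thru D.Adj X u w)
    (huw : u ≠ w) (hu : u ∉ X) (hw : w ∉ X) :
    ∃ p, IsDipath D u w p ∧ ∀ x ∈ internalVertices p, x ∈ X := by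
  rcases h with h | ⟨x, y, ex, hxy, ey⟩
  · refine ⟨u :: ([] ++ [w]), (isDipath_iff_of_ne huw).2 ⟨[], rfl, ?_, ?_⟩, ?_⟩
    · simpa using h
    · simpa using huw
    · rw [internalVertices_cons_concat]; simp
  · obtain ⟨l, ⟨hc, hn, hh, hl⟩, hX⟩ := hxy.exists_isDipath
    refine ⟨u :: (l ++ [w]), (isDipath_iff_of_ne huw).2
      ⟨l, rfl, isChain_of_conn hc hh hl ex ey, ?_⟩, ?_⟩
    · rw [List.nodup_cons, List.nodup_append]
      refine ⟨?_, hn, List.nodup_singleton _, ?_⟩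
      · rw [List.mem_append, List.mem_singleton]
        rintro (h | h)
        · exact hu (hX u h)
        · exact huw h
      · intro a ha b hb
        rw [List.mem_singleton] at hb
        rintro rfl
        exact hw (hb ▸ hX a ha)
    · rw [internalVertices_cons_concat]; exact hX

/-- A subdivision may be given by walks inside disjoint sets. -/
theorem exists_subdivision {W : Type*} {F : Digraph W} {D : Digraph V} (hF : ∀ a, ¬ F.Adj a a)
    (f : W → V) (hf : Function.Injective f) (X : W → W → Set V)
    (hX : ∀ a b, F.Adj a b → Thru D.Adj (X a b) (f a) (f b))
    (hnew : ∀ a b, F.Adj a b → ∀ c, f c ∉ X a b)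
    (hdisj : ∀ a b c d, F.Adj a b → F.Adj c d → (a, b) ≠ (c, d) → Disjoint (X a b) (X c d)) :
    ∃ σ : Subdivision F D, σ.vertex = f := by
  have h : ∀ a b, ∃ p, F.Adj a b →
      IsDipath D (f a) (f b) p ∧ ∀ x ∈ internalVertices p, x ∈ X a b := by
    intro a b
    by_cases hab : F.Adj a b
    · obtain ⟨p, hp⟩ := (hX a b hab).exists_isDipath
        (fun e => hF a (by rwa [← hf e] at hab)) (hnew a b hab a) (hnew a b hab b)
      exact ⟨p, fun _ => hp⟩
    · exact ⟨[], fun h => absurd h hab⟩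
  choose p hp using h
  exact ⟨⟨f, p, hf, fun a b hab => (hp a b hab).1,
    fun a b hab c hc => hnew a b hab c ((hp a b hab).2 _ hc),
    fun a b c d hab hcd hne x hx hx' => Set.disjoint_left.1 (hdisj a b c d hab hcd hne)
      ((hp a b hab).2 x hx) ((hp c d hcd).2 x hx')⟩, rfl⟩

theorem HasShunt.setShunt {D : Digraph V} {S T : Set V} (h : HasShunt D S T) :
    SetShunt D.Adj S T := by
  obtain ⟨p, p', q, q', r, r', P, Q, R, hP, hQ, hR, hlen, hr, hr', hPQ, hPR, hQR, hS, hT⟩ := h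
  obtain ⟨P', hP'⟩ := hP.exists_opath
  obtain ⟨Q', hQ'⟩ := hQ.exists_opath
  have hrr : r ≠ r' := by rintro rfl; exact hPQ hr hr'
  obtain ⟨l, rfl, hc, hn⟩ := (isDipath_iff_of_ne hrr).1 hR
  rw [internalVertices_cons_concat] at hPR hQR
  obtain ⟨x, y, ex, hxy, ey⟩ := exists_conn_of_chain hc (by rintro rfl; simp at hlen)
  refine ⟨P'.verts, Q'.verts, {x | x ∈ l}, p, q, p', q', r, r', x, y, ?_, ?_, ?_, hS, hT,
    P'.conn, (P'.conn_to ?_).mono fun _ h => h.1, Q'.conn, (Q'.conn_from ?_).mono fun _ h => h.1,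
    ex, hxy, ey⟩
  · rw [hP', hQ']; exact Set.disjoint_left.2 fun z h h' => hPQ h h'
  · rw [hP']; exact Set.disjoint_left.2 fun z h h' => hPR h h'
  · rw [hQ']; exact Set.disjoint_left.2 fun z h h' => hQR h h'
  · rw [hP']; exact hr
  · rw [hQ']; exact hr'

/-- In a `SetShunt` the vertex `r` need not lie on the chosen path from `s` to `t`. The walk to `r`
is cut at its last vertex on that path, and the rest can be added to the interior of the third path.
-/
theorem Conn.exists_branch_out {D : Digraph V} {A : Set V} {s t r : V} (h : Conn D.Adj A s t)
    (hr : Conn D.Adj A s r) : ∃ P, IsDipath D s t P ∧ (∀ x ∈ P, x ∈ A) ∧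
      ∃ z ∈ P, z = r ∨ ∃ p, D.Adj z p ∧ Conn D.Adj (A \ {x | x ∈ P}) p r := by
  obtain ⟨P, hP, hPA⟩ := h.exists_isDipath
  obtain ⟨z, hz, -, -, h⟩ := hr.last_hit_of_mem (Y := {x | x ∈ P}) (List.mem_of_head? hP.2.2.1)
  exact ⟨P, hP, hPA, z, hz, h⟩

theorem Conn.exists_branch_in {D : Digraph V} {A : Set V} {s t r : V} (h : Conn D.Adj A s t)
    (hr : Conn D.Adj A r t) : ∃ P, IsDipath D s t P ∧ (∀ x ∈ P, x ∈ A) ∧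
      ∃ z ∈ P, r = z ∨ ∃ p, Conn D.Adj (A \ {x | x ∈ P}) r p ∧ D.Adj p z := by
  obtain ⟨P, hP, hPA⟩ := h.exists_isDipath
  obtain ⟨z, hz, -, -, h⟩ := hr.first_hit_of_mem (Y := {x | x ∈ P})
    (List.mem_of_getLast? hP.2.2.2)
  exact ⟨P, hP, hPA, z, hz, h⟩

/-- The sets of a shunt may be taken to be paths. -/
theorem exists_paths_of_conn {D : Digraph V} {A B C : Set V} {s s' t t' r r' a b : V}
    (hAB : Disjoint A B) (hAC : Disjoint A C) (hBC : Disjoint B C) (hst : Conn D.Adj A s t)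
    (hsr : Conn D.Adj A s r) (hst' : Conn D.Adj B s' t') (hrt' : Conn D.Adj B r' t')
    (era : D.Adj r a) (hab : Conn D.Adj C a b) (ebr : D.Adj b r') :
    ∃ P Q, ∃ z ∈ P, ∃ z' ∈ Q, ∃ (X : Set V) (x y : V), IsDipath D s t P ∧ IsDipath D s' t' Q ∧
      (∀ x ∈ P, x ∈ A) ∧ (∀ x ∈ Q, x ∈ B) ∧ X ⊆ A ∪ B ∪ C ∧ (∀ x ∈ X, x ∉ P ∧ x ∉ Q) ∧
      D.Adj z x ∧ Conn D.Adj X x y ∧ D.Adj y z' := by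
  obtain ⟨P, hP, hPA, z, hz, h1⟩ := hst.exists_branch_out hsr
  obtain ⟨Q, hQ, hQB, z', hz', h2⟩ := hst'.exists_branch_in hrt'
  set X := (A ∪ B ∪ C) \ {x | x ∈ P ∨ x ∈ Q} with hX
  have hAX : A \ {x | x ∈ P} ⊆ X := fun x hx => ⟨.inl (.inl hx.1), fun h =>
    h.elim hx.2 fun h => Set.disjoint_left.1 hAB hx.1 (hQB x h)⟩
  have hBX : B \ {x | x ∈ Q} ⊆ X := fun x hx => ⟨.inl (.inr hx.1), fun h =>
    h.elim (fun h => Set.disjoint_left.1 hAB (hPA x h) hx.1) hx.2⟩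
  have hCX : C ⊆ X := fun x hx => ⟨.inr hx, fun h =>
    h.elim (fun h => Set.disjoint_left.1 hAC (hPA x h) hx)
      fun h => Set.disjoint_left.1 hBC (hQB x h) hx⟩
  obtain ⟨x, ex, hxb⟩ : ∃ x, D.Adj z x ∧ Conn D.Adj X x b := by
    rcases h1 with rfl | ⟨p, ep, hp⟩
    · exact ⟨a, era, hab.mono hCX⟩
    · exact ⟨p, ep, (hp.mono hAX).trans ((hab.mono hCX).cons (hp.mono hAX).right_mem era)⟩
  obtain ⟨y, hxy, ey⟩ : ∃ y, Conn D.Adj X x y ∧ D.Adj y z' := by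
    rcases h2 with rfl | ⟨p, hp, ep⟩
    · exact ⟨b, hxb, ebr⟩
    · exact ⟨p, hxb.trans ((hp.mono hBX).cons hxb.right_mem ebr), ep⟩
  exact ⟨P, Q, z, hz, z', hz', X, x, y, hP, hQ, hPA, hQB, fun x hx => hx.1,
    fun x hx => not_or.1 hx.2, ex, hxy, ey⟩

theorem hasShunt_iff {D : Digraph V} {S T : Set V} : HasShunt D S T ↔ SetShunt D.Adj S T := by
  refine ⟨HasShunt.setShunt, ?_⟩
  rintro ⟨A, B, C, s, s', t, t', r, r', a, b, hAB, hAC, hBC, hS, hT, hst, hsr, hst', hrt',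
    era, hab, ebr⟩
  obtain ⟨P, Q, z, hz, z', hz', X, x, y, hP, hQ, hPA, hQB, -, hX, ex, hxy, ey⟩ :=
    exists_paths_of_conn hAB hAC hBC hst hsr hst' hrt' era hab ebr
  have hPQ : ∀ w ∈ P, w ∉ Q := fun w h h' => Set.disjoint_left.1 hAB (hPA w h) (hQB w h')
  obtain ⟨l, ⟨hc, hn, hh, hl⟩, hlX⟩ := hxy.exists_isDipath
  have hzz : z ≠ z' := by rintro rfl; exact hPQ _ hz hz'
  refine ⟨s, t, s', t', z, z', P, Q, z :: (l ++ [z']), hP, hQ, (isDipath_iff_of_ne hzz).2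
    ⟨l, rfl, isChain_of_conn hc hh hl ex ey, ?_⟩, ?_, hz, hz', fun w h h' => hPQ w h h',
    ?_, ?_, hS, hT⟩
  · rw [List.nodup_cons, List.nodup_append]
    refine ⟨?_, hn, List.nodup_singleton _, ?_⟩
    · rw [List.mem_append, List.mem_singleton]
      rintro (h | h)
      · exact (hX z (hlX z h)).1 hz
      · exact hzz h
    · intro a ha b hb
      rw [List.mem_singleton] at hb
      rintro rfl
      exact (hX a (hlX a ha)).2 (hb ▸ hz')
  · cases l with
    | nil => simp at hh
    | cons c l => simp
  · rw [internalVertices_cons_concat]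
    exact fun w h h' => (hX w (hlX w h')).1 h
  · rw [internalVertices_cons_concat]
    exact fun w h h' => (hX w (hlX w h')).2 h

/-- Dropping the arcs into `v` has the same effect as deleting `v`, since no walk of the shunt
starts in `v`. This keeps the vertex type fixed. -/
theorem setShunt_deleteVertex {D : Digraph V} {v : V} {s₁ s₂ t₁ t₂ : {x : V // x ≠ v}} :
    SetShunt (deleteVertex D v).Adj {s₁, s₂} {t₁, t₂} ↔
      SetShunt (fun a b => D.Adj a b ∧ b ∈ ({v}ᶜ : Set V)) {(s₁ : V), (s₂ : V)}
        {(t₁ : V), (t₂ : V)} := by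
  constructor
  · rintro ⟨A, B, C, s, s', t, t', r, r', a, b, hAB, hAC, hBC, hS, hT, hst, hsr, hst', hrt',
      era, hab, ebr⟩
    have up : ∀ {X : Set {x : V // x ≠ v}} {u w}, Conn (deleteVertex D v).Adj X u w →
        Conn (fun a b => D.Adj a b ∧ b ∈ ({v}ᶜ : Set V)) (Subtype.val '' X) u w := by
      intro X u w h
      exact ⟨⟨u, h.1, rfl⟩, h.2.lift _ fun x y hxy => ⟨⟨hxy.1, y.2⟩, y, hxy.2, rfl⟩⟩
    have hd : ∀ {X Y : Set {x : V // x ≠ v}}, Disjoint X Y →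
        Disjoint (Subtype.val '' X) (Subtype.val '' Y) := fun h =>
      (Set.disjoint_image_iff Subtype.val_injective).2 h
    refine ⟨_, _, _, s, s', t, t', r, r', a, b, hd hAB, hd hAC, hd hBC, ?_, ?_, up hst, up hsr,
      up hst', up hrt', ⟨era, a.2⟩, up hab, ⟨ebr, r'.2⟩⟩
    · rw [← Set.image_pair, ← Set.image_pair, hS]
    · rw [← Set.image_pair, ← Set.image_pair, hT]
  · rintro ⟨A, B, C, s, s', t, t', r, r', a, b, hAB, hAC, hBC, hS, hT, hst, hsr, hst', hrt',
      era, hab, ebr⟩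
    have down : ∀ {X : Set V} {u w} (hu : u ≠ v),
        Conn (fun a b => D.Adj a b ∧ b ∈ ({v}ᶜ : Set V)) X u w → ∃ hw : w ≠ v,
          Conn (deleteVertex D v).Adj (Subtype.val ⁻¹' X) ⟨u, hu⟩ ⟨w, hw⟩ := by
      intro X u w hu h
      induction h using Conn.tail_induction with
      | base h => exact ⟨hu, .refl h.1⟩
      | step a b ha e hb ih =>
        obtain ⟨hw, h⟩ := ih
        exact ⟨e.2, h.snoc e.1 hb⟩
    have hs : s ≠ v := by
      rcases hS.subset (Set.mem_insert s {s'}) with h | h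
      · rw [h]; exact s₁.2
      · rw [h]; exact s₂.2
    have hs' : s' ≠ v := by
      rcases hS.subset (Set.mem_insert_of_mem s rfl) with h | h
      · rw [h]; exact s₁.2
      · rw [h]; exact s₂.2
    obtain ⟨ht, hst⟩ := down hs hst
    obtain ⟨hr, hsr⟩ := down hs hsr
    obtain ⟨ht', hst'⟩ := down hs' hst'
    obtain ⟨ht'', hrt'⟩ := down ebr.2 hrt'
    obtain ⟨hb, hab⟩ := down era.2 hab
    refine ⟨_, _, _, ⟨s, hs⟩, ⟨s', hs'⟩, ⟨t, ht⟩, ⟨t', ht'⟩, ⟨r, hr⟩, ⟨r', ebr.2⟩,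
      ⟨a, era.2⟩, ⟨b, hb⟩, hAB.preimage _, hAC.preimage _, hBC.preimage _, ?_, ?_,
      hst, hsr, hst', hrt', era.1, hab, ebr.1⟩
    · apply Subtype.val_injective.image_injective
      rw [Set.image_pair, Set.image_pair, hS]
    · apply Subtype.val_injective.image_injective
      rw [Set.image_pair, Set.image_pair, hT]

end Shunt

/-! ### Shunts of D − v and subdivisions of E₉ at v -/

section E9

variable {V : Type*}

theorem E9_adj {a b : Fin 4} : E9.Adj a b ↔ (a = 0 ∧ b = 1) ∨ (a = 1 ∧ b = 0) ∨ (a = 0 ∧ b = 2) ∨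
    (a = 2 ∧ b = 0) ∨ (a = 1 ∧ b = 3) ∨ (a = 3 ∧ b = 2) := by
  simp [E9, Prod.ext_iff]

theorem E9_irrefl (a : Fin 4) : ¬ E9.Adj a a := by
  rw [E9_adj]; revert a; decide

theorem Thru.out {E : V → V → Prop} {X : Set V} {u w : V} (h : Thru E X u w) :
    ∃ x, E u x ∧ Conn E (insert w X) x w := by
  rcases h with h | ⟨x, y, ex, hxy, ey⟩
  · exact ⟨w, h, .refl (.inl rfl)⟩
  · exact ⟨x, ex, (hxy.mono (Set.subset_insert _ _)).snoc ey (.inl rfl)⟩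

theorem Thru.in {E : V → V → Prop} {X : Set V} {u w : V} (h : Thru E X u w) :
    ∃ y, Conn E (insert u X) u y ∧ E y w := by
  rcases h with h | ⟨x, y, ex, hxy, ey⟩
  · exact ⟨u, .refl (.inl rfl), h⟩
  · exact ⟨y, (hxy.mono (Set.subset_insert _ _)).cons (.inl rfl) ex, ey⟩

/-- The part of a path before a vertex `r`, continued backwards to a vertex outside of the path. -/
theorem OPath.thru_to {E : V → V → Prop} {s t : V} (P : OPath E s t) {u r : V} (hr : r ∈ P.verts)
    (e : E u s) : Thru E {z | z ∈ P.verts ∧ P.rk z < P.rk r} u r := by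
  by_cases h : s = r
  · exact .inl (h ▸ e)
  · obtain ⟨p, ep, hp⟩ := P.exists_pred hr h
    exact .inr ⟨s, p, e, hp, ep⟩

theorem OPath.thru_from {E : V → V → Prop} {s t : V} (P : OPath E s t) {w r : V}
    (hr : r ∈ P.verts) (e : E t w) : Thru E {z | z ∈ P.verts ∧ P.rk r < P.rk z} r w := by
  by_cases h : r = t
  · exact .inl (h ▸ e)
  · obtain ⟨p, ep, hp⟩ := P.exists_succ hr h
    exact .inr ⟨p, t, ep, hp, e⟩

variable {D : Digraph V} {v : V}

theorem Subdivision.exists_shunt (σ : Subdivision E9 D) (hv : σ.vertex 0 = v) :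
    ∃ s₁ s₂ t₁ t₂ : V, s₁ ≠ v ∧ s₂ ≠ v ∧ t₁ ≠ v ∧ t₂ ≠ v ∧ s₁ ≠ s₂ ∧ t₁ ≠ t₂ ∧
      D.Adj v s₁ ∧ D.Adj v s₂ ∧ D.Adj t₁ v ∧ D.Adj t₂ v ∧
      SetShunt (fun a b => D.Adj a b ∧ b ∈ ({v}ᶜ : Set V)) {s₁, s₂} {t₁, t₂} := by
  subst hv
  have a01 : E9.Adj 0 1 := by simp [E9_adj]
  have a10 : E9.Adj 1 0 := by simp [E9_adj]
  have a02 : E9.Adj 0 2 := by simp [E9_adj]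
  have a20 : E9.Adj 2 0 := by simp [E9_adj]
  have a13 : E9.Adj 1 3 := by simp [E9_adj]
  have a32 : E9.Adj 3 2 := by simp [E9_adj]
  have hne : ∀ {i j : Fin 4}, i ≠ j → σ.vertex i ≠ σ.vertex j := fun h => σ.vertex_injective.ne h
  have thru : ∀ {i j}, E9.Adj i j →
      Thru D.Adj {x | x ∈ internalVertices (σ.path i j)} (σ.vertex i) (σ.vertex j) :=
    fun {i j} h => (σ.isDipath i j h).thru (hne (by rintro rfl; exact E9_irrefl _ h))
  obtain ⟨s₁, es₁, hs₁⟩ := (thru a01).out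
  obtain ⟨s₂, es₂, hs₂⟩ := (thru a02).out
  obtain ⟨t₁, ht₁, et₁⟩ := (thru a10).in
  obtain ⟨t₂, ht₂, et₂⟩ := (thru a20).in
  obtain ⟨a, ea, ha⟩ := (thru a13).out
  obtain ⟨b, hb, eb⟩ := (thru a32).in
  set A : Set V := {x | x = σ.vertex 1 ∨ x ∈ internalVertices (σ.path 0 1) ∨
    x ∈ internalVertices (σ.path 1 0)} with hA
  set B : Set V := {x | x = σ.vertex 2 ∨ x ∈ internalVertices (σ.path 0 2) ∨
    x ∈ internalVertices (σ.path 2 0)} with hB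
  set C : Set V := {x | x = σ.vertex 3 ∨ x ∈ internalVertices (σ.path 1 3) ∨
    x ∈ internalVertices (σ.path 3 2)} with hC
  have hnew : ∀ {i j}, E9.Adj i j → ∀ c, σ.vertex c ∉ internalVertices (σ.path i j) :=
    fun h => σ.interior_new _ _ h
  have hdis : ∀ {i j k l}, E9.Adj i j → E9.Adj k l → (i, j) ≠ (k, l) → ∀ {x},
      x ∈ internalVertices (σ.path i j) → x ∉ internalVertices (σ.path k l) :=
    fun h h' hn _ hx hx' => σ.interior_disjoint _ _ _ _ h h' hn hx hx'
  have disj : ∀ {p q i j k l i' j' k' l' : Fin 4}, p ≠ q → E9.Adj i j → E9.Adj k l →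
      E9.Adj i' j' → E9.Adj k' l' → (i, j) ≠ (i', j') → (i, j) ≠ (k', l') → (k, l) ≠ (i', j') →
      (k, l) ≠ (k', l') →
      Disjoint {x | x = σ.vertex p ∨ x ∈ internalVertices (σ.path i j) ∨
        x ∈ internalVertices (σ.path k l)} {x | x = σ.vertex q ∨
        x ∈ internalVertices (σ.path i' j') ∨ x ∈ internalVertices (σ.path k' l')} := by
    intro p q i j k l i' j' k' l' hpq h1 h2 h3 h4 n1 n2 n3 n4
    rw [Set.disjoint_left]
    rintro x (rfl | hx | hx) (hx' | hx' | hx')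
    · exact hne hpq hx'
    · exact hnew h3 _ hx'
    · exact hnew h4 _ hx'
    · exact hnew h1 _ (hx' ▸ hx)
    · exact hdis h1 h3 n1 hx hx'
    · exact hdis h1 h4 n2 hx hx'
    · exact hnew h2 _ (hx' ▸ hx)
    · exact hdis h2 h3 n3 hx hx'
    · exact hdis h2 h4 n4 hx hx'
  have avoid : ∀ {p i j k l : Fin 4}, p ≠ 0 → E9.Adj i j → E9.Adj k l →
      {x | x = σ.vertex p ∨ x ∈ internalVertices (σ.path i j) ∨
        x ∈ internalVertices (σ.path k l)} ⊆ ({σ.vertex 0}ᶜ : Set V) := by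
    intro p i j k l hp h1 h2
    rintro x (rfl | hx | hx) h
    · exact hne hp h
    · exact hnew h1 0 (h ▸ hx)
    · exact hnew h2 0 (h ▸ hx)
  have hAB : Disjoint A B := disj (by decide) a01 a10 a02 a20 (by decide) (by decide) (by decide)
    (by decide)
  have hAC : Disjoint A C := disj (by decide) a01 a10 a13 a32 (by decide) (by decide) (by decide)
    (by decide)
  have hBC : Disjoint B C := disj (by decide) a02 a20 a13 a32 (by decide) (by decide) (by decide)
    (by decide)
  have hAv : A ⊆ ({σ.vertex 0}ᶜ : Set V) := avoid (by decide) a01 a10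
  have hBv : B ⊆ ({σ.vertex 0}ᶜ : Set V) := avoid (by decide) a02 a20
  have hCv : C ⊆ ({σ.vertex 0}ᶜ : Set V) := avoid (by decide) a13 a32
  have i1 : ∀ {p i j k l : Fin 4}, insert (σ.vertex p) {x | x ∈ internalVertices (σ.path i j)} ⊆
      {x | x = σ.vertex p ∨ x ∈ internalVertices (σ.path i j) ∨
        x ∈ internalVertices (σ.path k l)} := by
    rintro p i j k l x (rfl | h)
    · exact .inl rfl
    · exact .inr (.inl h)
  have i2 : ∀ {p i j k l : Fin 4}, insert (σ.vertex p) {x | x ∈ internalVertices (σ.path k l)} ⊆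
      {x | x = σ.vertex p ∨ x ∈ internalVertices (σ.path i j) ∨
        x ∈ internalVertices (σ.path k l)} := by
    rintro p i j k l x (rfl | h)
    · exact .inl rfl
    · exact .inr (.inr h)
  have hs₁ : Conn D.Adj A s₁ (σ.vertex 1) := hs₁.mono i1
  have hs₂ : Conn D.Adj B s₂ (σ.vertex 2) := hs₂.mono i1
  have ht₁ : Conn D.Adj A (σ.vertex 1) t₁ := ht₁.mono i2
  have ht₂ : Conn D.Adj B (σ.vertex 2) t₂ := ht₂.mono i2
  have ha : Conn D.Adj C a (σ.vertex 3) := ha.mono i1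
  have hb : Conn D.Adj C (σ.vertex 3) b := hb.mono i2
  have hne' : ∀ {x y}, x ∈ A → y ∈ B → x ≠ y := by
    rintro x _ hx hy rfl; exact Set.disjoint_left.1 hAB hx hy
  exact ⟨s₁, s₂, t₁, t₂, hAv hs₁.left_mem, hBv hs₂.left_mem, hAv ht₁.right_mem,
    hBv ht₂.right_mem, hne' hs₁.left_mem hs₂.left_mem, hne' ht₁.right_mem ht₂.right_mem, es₁, es₂,
    et₁, et₂, A, B, C, s₁, s₂, t₁, t₂, σ.vertex 1, σ.vertex 2, a, b, hAB, hAC, hBC, rfl, rfl,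
    (hs₁.trans ht₁).restrict hAv, hs₁.restrict hAv, (hs₂.trans ht₂).restrict hBv,
    ht₂.restrict hBv, ⟨ea, hCv ha.left_mem⟩, (ha.trans hb).restrict hCv, eb, hBv ht₂.left_mem⟩

theorem exists_subdivision_of_shunt {s₁ s₂ t₁ t₂ : V} (hs₁ : s₁ ≠ v) (hs₂ : s₂ ≠ v)
    (es₁ : D.Adj v s₁) (es₂ : D.Adj v s₂) (et₁ : D.Adj t₁ v) (et₂ : D.Adj t₂ v)
    (h : SetShunt (fun a b => D.Adj a b ∧ b ∈ ({v}ᶜ : Set V)) {s₁, s₂} {t₁, t₂}) :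
    ∃ σ : Subdivision E9 D, σ.vertex 0 = v := by
  obtain ⟨A, B, C, s, s', t, t', r, r', a, b, hAB, hAC, hBC, hS, hT, hst, hsr, hst', hrt',
    era, hab, ebr⟩ := h
  have hs : s ≠ v ∧ D.Adj v s := by
    rcases hS.subset (Set.mem_insert s {s'}) with h | h
    · rw [h]; exact ⟨hs₁, es₁⟩
    · rw [h]; exact ⟨hs₂, es₂⟩
  have hs' : s' ≠ v ∧ D.Adj v s' := by
    rcases hS.subset (Set.mem_insert_of_mem s rfl) with h | h
    · rw [h]; exact ⟨hs₁, es₁⟩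
    · rw [h]; exact ⟨hs₂, es₂⟩
  have ht : D.Adj t v := by
    rcases hT.subset (Set.mem_insert t {t'}) with h | h
    · rw [h]; exact et₁
    · rw [h]; exact et₂
  have ht' : D.Adj t' v := by
    rcases hT.subset (Set.mem_insert_of_mem t rfl) with h | h
    · rw [h]; exact et₁
    · rw [h]; exact et₂
  obtain ⟨P, Q, z, hz, z', hz', X, x, y, hP, hQ, hPA, hQB, hX, hXn, ex, hxy, ey⟩ :=
    exists_paths_of_conn (hAB.mono Set.inter_subset_left Set.inter_subset_left)
      (hAC.mono Set.inter_subset_left Set.inter_subset_left)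
      (hBC.mono Set.inter_subset_left Set.inter_subset_left)
      (hst.of_restrict hs.1) (hsr.of_restrict hs.1) (hst'.of_restrict hs'.1)
      (hrt'.of_restrict ebr.2) era.1 (hab.of_restrict era.2) ebr.1
  obtain ⟨P', hP'⟩ := hP.exists_opath
  obtain ⟨Q', hQ'⟩ := hQ.exists_opath
  have hzP : z ∈ P'.verts := by rw [hP']; exact hz
  have hzQ : z' ∈ Q'.verts := by rw [hQ']; exact hz'
  have hPv : ∀ w ∈ P'.verts, w ≠ v := by rw [hP']; exact fun w hw => (hPA w hw).2
  have hQv : ∀ w ∈ Q'.verts, w ≠ v := by rw [hQ']; exact fun w hw => (hQB w hw).2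
  have hXv : ∀ w ∈ X, w ≠ v := by
    intro w hw
    rcases hX hw with (h | h) | h <;> exact h.2
  have hPQ : ∀ w ∈ P'.verts, w ∉ Q'.verts := by
    rw [hP', hQ']
    exact fun w h h' => Set.disjoint_left.1 hAB (hPA w h).1 (hQB w h').1
  have hXP : ∀ w ∈ X, w ∉ P'.verts := by rw [hP']; exact fun w h => (hXn w h).1
  have hXQ : ∀ w ∈ X, w ∉ Q'.verts := by rw [hQ']; exact fun w h => (hXn w h).2
  have hx : x ∈ X := hxy.left_mem
  -- The d-vertex is the first internal vertex `x` of the third path, so that bd becomes a single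
  -- arc and dc takes the rest.
  have thruC : Thru D.Adj (X \ {x}) x z' := by
    by_cases hxy' : x = y
    · exact .inl (hxy' ▸ ey)
    · obtain ⟨p, ep, hp⟩ := hxy.exists_out hxy'
      exact .inr ⟨p, y, ep, hp, ey⟩
  set Y : Fin 4 → Fin 4 → Set V := fun i j =>
    if i = 0 ∧ j = 1 then {w | w ∈ P'.verts ∧ P'.rk w < P'.rk z}
    else if i = 1 ∧ j = 0 then {w | w ∈ P'.verts ∧ P'.rk z < P'.rk w}
    else if i = 0 ∧ j = 2 then {w | w ∈ Q'.verts ∧ Q'.rk w < Q'.rk z'}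
    else if i = 2 ∧ j = 0 then {w | w ∈ Q'.verts ∧ Q'.rk z' < Q'.rk w}
    else if i = 1 ∧ j = 3 then ∅ else X \ {x} with hY
  have y01 : Y 0 1 = {w | w ∈ P'.verts ∧ P'.rk w < P'.rk z} := by simp [hY]
  have y10 : Y 1 0 = {w | w ∈ P'.verts ∧ P'.rk z < P'.rk w} := by simp [hY]
  have y02 : Y 0 2 = {w | w ∈ Q'.verts ∧ Q'.rk w < Q'.rk z'} := by simp [hY]
  have y20 : Y 2 0 = {w | w ∈ Q'.verts ∧ Q'.rk z' < Q'.rk w} := by simp [hY]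
  have y13 : Y 1 3 = ∅ := by simp [hY]
  have y32 : Y 3 2 = X \ {x} := by simp [hY]
  have hzQ' := hPQ z hzP
  have hzP' : z' ∉ P'.verts := fun h => hPQ z' h hzQ
  have hzv := hPv z hzP
  have hzv' := hQv z' hzQ
  have hzX : z ∉ X := fun h => hXP z h hzP
  have hzX' : z' ∉ X := fun h => hXQ z' h hzQ
  have hxP := hXP x hx
  have hxQ := hXQ x hx
  have hxv := hXv x hx
  have hvP : v ∉ P'.verts := fun h => hPv v h rfl
  have hvQ : v ∉ Q'.verts := fun h => hQv v h rfl
  have hvX : v ∉ X := fun h => hXv v h rfl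
  have hzz : z ≠ z' := fun h => hzP' (h ▸ hzP)
  have hzx : z ≠ x := fun h => hzX (h ▸ hx)
  have hzx' : z' ≠ x := fun h => hzX' (h ▸ hx)
  refine (exists_subdivision (F := E9) (D := D) E9_irrefl ![v, z, z', x] ?_ Y ?_ ?_ ?_).imp
    fun σ hσ => by rw [hσ]; rfl
  · have hin : ∀ i j : Fin 4, i < j → ![v, z, z', x] i ≠ ![v, z, z', x] j := by
      intro i j hij
      fin_cases i <;> fin_cases j <;> first | exact absurd hij (by decide) | skip
      · exact hzv.symm
      · exact hzv'.symm
      · exact hxv.symm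
      · exact hzz
      · exact hzx
      · exact hzx'
    intro i j hij
    rcases lt_trichotomy i j with h | h | h
    · exact absurd hij (hin i j h)
    · exact h
    · exact absurd hij.symm (hin j i h)
  · intro i j h
    rcases E9_adj.1 h with ⟨rfl, rfl⟩ | ⟨rfl, rfl⟩ | ⟨rfl, rfl⟩ | ⟨rfl, rfl⟩ | ⟨rfl, rfl⟩ |
      ⟨rfl, rfl⟩
    · rw [y01]; exact P'.thru_to hzP hs.2
    · rw [y10]; exact P'.thru_from hzP ht
    · rw [y02]; exact Q'.thru_to hzQ hs'.2
    · rw [y20]; exact Q'.thru_from hzQ ht'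
    · rw [y13]; exact .inl ex
    · rw [y32]; exact thruC
  · have hv4 : ∀ (Z : Set V), v ∉ Z → z ∉ Z → z' ∉ Z → x ∉ Z → ∀ c, ![v, z, z', x] c ∉ Z := by
      intro Z h1 h2 h3 h4 c
      fin_cases c
      · exact h1
      · exact h2
      · exact h3
      · exact h4
    intro i j h
    apply hv4 <;>
    · rcases E9_adj.1 h with ⟨rfl, rfl⟩ | ⟨rfl, rfl⟩ | ⟨rfl, rfl⟩ | ⟨rfl, rfl⟩ | ⟨rfl, rfl⟩ |
        ⟨rfl, rfl⟩ <;>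
      simp only [y01, y10, y02, y20, y13, y32, Set.mem_ofPred_eq, Set.mem_sdiff, Set.mem_empty_iff_false,
        Set.mem_singleton_iff, lt_irrefl, and_false, not_false_eq_true, not_true_eq_false, false_and,
        hvP, hvQ, hvX, hzQ', hzP', hzX, hzX', hxP, hxQ]
  · have hd : ∀ w i j, E9.Adj i j → w ∈ Y i j →
        (w ∈ P'.verts ∧ P'.rk w < P'.rk z ∧ (i, j) = (0, 1)) ∨
        (w ∈ P'.verts ∧ P'.rk z < P'.rk w ∧ (i, j) = (1, 0)) ∨
        (w ∈ Q'.verts ∧ Q'.rk w < Q'.rk z' ∧ (i, j) = (0, 2)) ∨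
        (w ∈ Q'.verts ∧ Q'.rk z' < Q'.rk w ∧ (i, j) = (2, 0)) ∨
        (w ∈ X ∧ (i, j) = (3, 2)) := by
      intro w i j h hw
      rcases E9_adj.1 h with ⟨rfl, rfl⟩ | ⟨rfl, rfl⟩ | ⟨rfl, rfl⟩ | ⟨rfl, rfl⟩ | ⟨rfl, rfl⟩ |
        ⟨rfl, rfl⟩
      · rw [y01] at hw; exact .inl ⟨hw.1, hw.2, rfl⟩
      · rw [y10] at hw; exact .inr (.inl ⟨hw.1, hw.2, rfl⟩)
      · rw [y02] at hw; exact .inr (.inr (.inl ⟨hw.1, hw.2, rfl⟩))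
      · rw [y20] at hw; exact .inr (.inr (.inr (.inl ⟨hw.1, hw.2, rfl⟩)))
      · rw [y13] at hw; exact hw.elim
      · rw [y32] at hw; exact .inr (.inr (.inr (.inr ⟨hw.1, rfl⟩)))
    intro i j k l h h' hne
    rw [Set.disjoint_left]
    intro w hw hw'
    have h1 := hPQ w
    have h2 := hXP w
    have h3 := hXQ w
    rcases hd w i j h hw with ⟨a1, a2, a3⟩ | ⟨a1, a2, a3⟩ | ⟨a1, a2, a3⟩ | ⟨a1, a2, a3⟩ | ⟨a1, a3⟩ <;>
    rcases hd w k l h' hw' with ⟨b1, b2, b3⟩ | ⟨b1, b2, b3⟩ | ⟨b1, b2, b3⟩ | ⟨b1, b2, b3⟩ |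
      ⟨b1, b3⟩ <;>
    first
    | exact hne (a3.trans b3.symm)
    | exact h1 a1 b1
    | exact h1 b1 a1
    | exact h2 a1 b1
    | exact h2 b1 a1
    | exact h3 a1 b1
    | exact h3 b1 a1
    | omega

theorem exists_subdivision_iff_hasShunt (D : Digraph V) (v : V) :
    (∃ σ : Subdivision E9 D, σ.vertex 0 = v) ↔
      ∃ s₁ s₂ t₁ t₂ : {x : V // x ≠ v}, s₁ ≠ s₂ ∧ t₁ ≠ t₂ ∧
        D.Adj v s₁ ∧ D.Adj v s₂ ∧ D.Adj t₁ v ∧ D.Adj t₂ v ∧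
        HasShunt (deleteVertex D v) {s₁, s₂} {t₁, t₂} := by
  constructor
  · rintro ⟨σ, hσ⟩
    obtain ⟨s₁, s₂, t₁, t₂, h1, h2, h3, h4, hs, ht, e1, e2, e3, e4, h⟩ := σ.exists_shunt hσ
    refine ⟨⟨s₁, h1⟩, ⟨s₂, h2⟩, ⟨t₁, h3⟩, ⟨t₂, h4⟩, fun h => hs (congrArg Subtype.val h),
      fun h => ht (congrArg Subtype.val h), e1, e2, e3, e4, ?_⟩
    rw [hasShunt_iff, setShunt_deleteVertex]
    exact h
  · rintro ⟨s₁, s₂, t₁, t₂, -, -, e1, e2, e3, e4, h⟩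
    rw [hasShunt_iff, setShunt_deleteVertex] at h
    exact exists_subdivision_of_shunt s₁.2 s₂.2 e1 e2 e3 e4 h

end E9

/-! ### A small language of loop programs on tables, and its compilation -/

namespace RAM

/-- The index of a cell of a table. -/
abbrev Key := ℕ × ℕ × ℕ × ℕ × ℕ

/-- The position of a cell of a table in memory. -/
def Key.code (n : ℕ) (x : Key) : ℕ :=
  x.2.2.2.2 + x.2.2.2.1 * n + x.2.2.1 * n ^ 2 + x.2.1 * n ^ 3 + x.1 * n ^ 4

/-- All entries are less than `n`. -/
def Key.Lt (n : ℕ) (x : Key) : Prop :=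
  x.1 < n ∧ x.2.1 < n ∧ x.2.2.1 < n ∧ x.2.2.2.1 < n ∧ x.2.2.2.2 < n

/-- The contents of all tables. -/
abbrev Tables := ℕ → Key → Prop

/-- Formulas on tables. The variables are numbered; below `d` variables, a quantifier binds
variable `d`. -/
inductive Fml where
  /-- The cell of table `a` given by five variables holds. -/
  | tab (a : ℕ) (x : Key)
  /-- Two variables are equal. -/
  | eq (x y : ℕ)
  /-- Negation. -/
  | not (φ : Fml)
  /-- Conjunction. -/
  | and (φ ψ : Fml)
  /-- Existential quantification over the numbers below `n`. -/
  | ex (φ : Fml)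

/-- The values of five variables. -/
def Key.subst (env : ℕ → ℕ) (x : Key) : Key :=
  (env x.1, env x.2.1, env x.2.2.1, env x.2.2.2.1, env x.2.2.2.2)

/-- The truth of a formula below `d` variables. -/
def Fml.Holds (n : ℕ) (T : Tables) : ℕ → (ℕ → ℕ) → Fml → Prop
  | _, env, tab a x => T a (x.subst env)
  | _, env, eq x y => env x = env y
  | d, env, not φ => ¬ φ.Holds n T d env
  | d, env, and φ ψ => φ.Holds n T d env ∧ ψ.Holds n T d env
  | d, env, ex φ => ∃ i < n, φ.Holds n T (d + 1) (Function.update env d i)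

/-- All variables are less than `d`, or bound. -/
def Fml.WF : ℕ → Fml → Prop
  | d, tab _ x => x.Lt d
  | d, eq x y => x < d ∧ y < d
  | d, not φ => φ.WF d
  | d, and φ ψ => φ.WF d ∧ ψ.WF d
  | d, ex φ => φ.WF (d + 1)

/-- The nesting depth of quantifiers. -/
def Fml.depth : Fml → ℕ
  | tab _ _ => 0
  | eq _ _ => 0
  | not φ => φ.depth
  | and φ ψ => max φ.depth ψ.depth
  | ex φ => φ.depth + 1

/-- The factor in the time bound for the evaluation of a formula. -/
def Fml.cost : Fml → ℕ
  | tab _ _ => 10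
  | eq _ _ => 5
  | not φ => φ.cost + 2
  | and φ ψ => φ.cost + ψ.cost + 2
  | ex φ => φ.cost + 9

/-- Loop programs on tables. -/
inductive Cmd where
  /-- Set a cell of the table `a` to the truth value of a formula. -/
  | put (a : ℕ) (x : Key) (φ : Fml)
  /-- One program, then another one. -/
  | seq (c c' : Cmd)
  /-- For all values below `n` of the next variable. -/
  | all (c : Cmd)

/-- Change a cell of a table. -/
def Tables.set (T : Tables) (a : ℕ) (x : Key) (p : Prop) : Tables :=
  Function.update T a (Function.update (T a) x p)

/-- The effect of a loop program. -/
def Cmd.run (n : ℕ) : ℕ → (ℕ → ℕ) → Cmd → Tables → Tables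
  | d, env, put a x φ, T => T.set a (x.subst env) (φ.Holds n T d env)
  | d, env, seq c c', T => c'.run n d env (c.run n d env T)
  | d, env, all c, T =>
    (List.range n).foldl (fun T i => c.run n (d + 1) (Function.update env d i) T) T

/-- All variables are less than `d`, or bound. -/
def Cmd.WF : ℕ → Cmd → Prop
  | d, put _ x φ => x.Lt d ∧ φ.WF d
  | d, seq c c' => c.WF d ∧ c'.WF d
  | d, all c => c.WF (d + 1)

/-- The nesting depth of loops. -/
def Cmd.depth : Cmd → ℕ
  | put _ _ φ => φ.depth
  | seq c c' => max c.depth c'.depth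
  | all c => c.depth + 1

/-- The factor in the time bound for a loop program. -/
def Cmd.cost : Cmd → ℕ
  | put _ _ φ => φ.cost + 10
  | seq c c' => c.cost + c'.cost
  | all c => c.cost + 6

/-- For all values of register `r` below that of register `b`, do `p`. -/
def forLoop (b r : ℕ) (p : Program) : Program :=
  .seq (.const r 0) (.seq (.sub 3 b r) (.loop 3 (.seq p (.seq (.add r r 2) (.sub 3 b r)))))

/-- Put the position of a cell into register `4`. -/
def codeProgram (x : Key) : Program :=
  .seq (.copy 4 (2 * x.2.2.2.2 + 6)) <|
  .seq (.load 5 2 (2 * x.2.2.2.1 + 6)) <| .seq (.add 4 4 5) <|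
  .seq (.load 5 3 (2 * x.2.2.1 + 6)) <| .seq (.add 4 4 5) <|
  .seq (.load 5 4 (2 * x.2.1 + 6)) <| .seq (.add 4 4 5) <|
  .seq (.load 5 5 (2 * x.1 + 6)) (.add 4 4 5)

/-- Evaluate a formula below `d` variables into the `k`-th auxiliary register. -/
def Fml.compile : ℕ → ℕ → Fml → Program
  | _, k, tab a x => .seq (codeProgram x) (.load (2 * k + 7) (a + 6) 4)
  | _, k, eq x y => .seq (.sub 4 (2 * x + 6) (2 * y + 6)) <|
      .seq (.sub 5 (2 * y + 6) (2 * x + 6)) <| .seq (.add 4 4 5) <|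
      .cond 4 (.const (2 * k + 7) 0) (.const (2 * k + 7) 1)
  | d, k, not φ => .seq (φ.compile d k)
      (.cond (2 * k + 7) (.const (2 * k + 7) 0) (.const (2 * k + 7) 1))
  | d, k, and φ ψ => .seq (φ.compile d k) (.cond (2 * k + 7) (ψ.compile d k) .skip)
  | d, k, ex φ => .seq (.const (2 * k + 7) 0) <| forLoop 0 (2 * d + 6) <|
      .seq (φ.compile (d + 1) (k + 1)) (.cond (2 * (k + 1) + 7) (.const (2 * k + 7) 1) .skip)

/-- Compile a loop program below `d` variables. -/
def Cmd.compile : ℕ → Cmd → Program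
  | d, put a x φ => .seq (φ.compile d 0) (.seq (codeProgram x) (.store (a + 6) 4 7))
  | d, seq c c' => .seq (c.compile d) (c'.compile d)
  | d, all c => forLoop 0 (2 * d + 6) (c.compile (d + 1))

/-! ### Positions of table cells, and the evaluation of formulas -/

theorem Key.code_eq (n : ℕ) (x : Key) : x.code n =
    x.2.2.2.2 + n * (x.2.2.2.1 + n * (x.2.2.1 + n * (x.2.1 + n * x.1))) := by
  unfold Key.code; ring

theorem Key.code_lt {n : ℕ} {x : Key} (h : x.Lt n) : x.code n < n ^ 5 := by
  obtain ⟨h0, h1, h2, h3, h4⟩ := h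
  have step : ∀ {a b N : ℕ}, a < n → b < N → a + n * b < n * N := by
    intro a b N ha hb
    calc a + n * b < n + n * b := by omega
      _ = n * (b + 1) := by ring
      _ ≤ n * N := Nat.mul_le_mul_left _ hb
  rw [Key.code_eq]
  calc _ < n * (n * (n * (n * n))) := step h4 (step h3 (step h2 (step h1 h0)))
    _ = n ^ 5 := by ring

theorem Key.code_inj {n : ℕ} {x y : Key} (hx : x.Lt n) (hy : y.Lt n) (h : x.code n = y.code n) :
    x = y := by
  have step : ∀ {a a' b b' : ℕ}, a < n → a' < n → a + n * b = a' + n * b' → a = a' ∧ b = b' := by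
    intro a a' b b' ha ha' e
    have h1 := congrArg (· % n) e
    have h2 := congrArg (· / n) e
    have hn : 0 < n := by omega
    simp only [Nat.add_mul_mod_self_left, Nat.mod_eq_of_lt ha, Nat.mod_eq_of_lt ha'] at h1
    simp only [Nat.add_mul_div_left _ _ hn, Nat.div_eq_of_lt ha, Nat.div_eq_of_lt ha'] at h2
    exact ⟨h1, by omega⟩
  obtain ⟨x0, x1, x2, x3, x4⟩ := x
  obtain ⟨y0, y1, y2, y3, y4⟩ := y
  obtain ⟨h0, h1, h2, h3, h4⟩ := hx
  obtain ⟨h0', h1', h2', h3', h4'⟩ := hy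
  rw [Key.code_eq, Key.code_eq] at h
  obtain ⟨e4, h⟩ := step h4 h4' h
  obtain ⟨e3, h⟩ := step h3 h3' h
  obtain ⟨e2, h⟩ := step h2 h2' h
  obtain ⟨e1, e0⟩ := step h1 h1' h
  dsimp only at *
  subst e0 e1 e2 e3 e4
  rfl

@[simp] theorem State.setReg_reg (σ : State) (i x j : ℕ) :
    (σ.setReg i x).reg j = if j = i then x else σ.reg j := by
  simp [State.setReg, Function.update_apply]

@[simp] theorem State.setReg_mem (σ : State) (i x : ℕ) : (σ.setReg i x).mem = σ.mem := rfl

@[simp] theorem State.setMem_reg (σ : State) (a j x : ℕ) : (σ.setMem a j x).reg = σ.reg := rfl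

theorem State.setMem_mem (σ : State) (a j x b k : ℕ) :
    (σ.setMem a j x).mem b k = if b = a ∧ k = j then x else σ.mem b k := by
  by_cases hb : b = a
  · subst hb
    simp [State.setMem, Function.update_apply]
  · simp [State.setMem, hb]

/-- The rule for counting loops. -/
theorem exec_forLoop {w N b r : ℕ} {p : Program} {B : ℕ} (Inv : ℕ → State → Prop) (hw : N ≤ w)
    (hbr : b ≠ r)
    (hstep : ∀ i < N, ∀ σ, Inv i σ → ∃ t τ, Exec w p σ t τ ∧ t ≤ B ∧ τ.reg b = N ∧ τ.reg 2 = 1 ∧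
      τ.reg r = i ∧ Inv (i + 1) ((τ.setReg r (i + 1)).setReg 3 (N - (i + 1))))
    (σ : State) (hσ : σ.reg b = N) (h0 : Inv 0 ((σ.setReg r 0).setReg 3 N)) :
    ∃ t τ, Exec w (forLoop b r p) σ t τ ∧ t ≤ N * (B + 3) + 3 ∧ Inv N τ := by
  have key : ∀ k i σ, i + k = N → Inv i σ → σ.reg 3 = N - i →
      ∃ t τ, Exec w (.loop 3 (.seq p (.seq (.add r r 2) (.sub 3 b r)))) σ t τ ∧
        t ≤ k * (B + 3) + 1 ∧ Inv N τ := by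
    intro k
    induction k with
    | zero =>
      intro i σ hi h h3
      exact ⟨1, σ, .loop_false (by omega), by omega, by rwa [show N = i by omega]⟩
    | succ k ih =>
      intro i σ hi h h3
      obtain ⟨t, τ, ht, htB, hb, h2, hri, hI⟩ := hstep i (by omega) σ h
      obtain ⟨t', τ', ht', htB', hI'⟩ := ih (i + 1) _ (by omega) hI (by simp)
      have e1 : Exec w (.add r r 2) τ 1 (τ.setReg r (i + 1)) := by
        have := Exec.add (w := w) τ r r 2 (by rw [hri, h2]; omega)
        rwa [hri, h2] at this
      -- Register `3` is computed afresh after every round, so nested loops may share it.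
      have e2 : Exec w (.sub 3 b r) (τ.setReg r (i + 1)) 1
          ((τ.setReg r (i + 1)).setReg 3 (N - (i + 1))) := by
        have := Exec.sub (w := w) (τ.setReg r (i + 1)) 3 b r
        simpa [hb, hbr] using this
      refine ⟨_, τ', .loop_true (by omega) (.seq ht (.seq e1 e2)) ht', ?_, hI'⟩
      rw [Nat.succ_mul]; omega
  obtain ⟨t, τ, ht, htB, hI⟩ := key N 0 _ (by omega) h0 (by simp)
  have e1 : Exec w (.const r 0) σ 1 (σ.setReg r 0) := .const σ r 0 (by omega)
  have e2 : Exec w (.sub 3 b r) (σ.setReg r 0) 1 ((σ.setReg r 0).setReg 3 N) := by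
    have := Exec.sub (w := w) (σ.setReg r 0) 3 b r
    simpa [hσ, hbr] using this
  exact ⟨_, τ, .seq e1 (.seq e2 ht), by omega, hI⟩

/-- The state `τ` has the memory of `σ`, and its first `d` variables, its first `k` auxiliary
registers and its constants are those of `σ`. -/
structure Keeps (d k : ℕ) (σ τ : State) : Prop where
  mem : τ.mem = σ.mem
  const : ∀ r < 3, τ.reg r = σ.reg r
  var : ∀ x < d, τ.reg (2 * x + 6) = σ.reg (2 * x + 6)
  aux : ∀ j < k, τ.reg (2 * j + 7) = σ.reg (2 * j + 7)

theorem Keeps.refl (d k : ℕ) (σ : State) : Keeps d k σ σ := ⟨rfl, by simp, by simp, by simp⟩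

theorem Keeps.trans {d k d' k' : ℕ} {σ τ ρ : State} (h : Keeps d k σ τ) (h' : Keeps d' k' τ ρ)
    (hd : d ≤ d') (hk : k ≤ k') : Keeps d k σ ρ :=
  ⟨h'.mem.trans h.mem, fun r hr => (h'.const r hr).trans (h.const r hr),
    fun x hx => (h'.var x (hx.trans_le hd)).trans (h.var x hx),
    fun j hj => (h'.aux j (hj.trans_le hk)).trans (h.aux j hj)⟩

/-- Registers `3` to `5` are scratch; the even ones from `6` on hold variables, the odd ones from
`7` on truth values. -/
theorem Keeps.setReg {d k : ℕ} {σ τ : State} (h : Keeps d k σ τ) {r : ℕ} (x : ℕ)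
    (hr : r = 3 ∨ r = 4 ∨ r = 5 ∨ (∃ y, d ≤ y ∧ r = 2 * y + 6) ∨ ∃ j, k ≤ j ∧ r = 2 * j + 7) :
    Keeps d k σ (τ.setReg r x) := by
  refine ⟨h.mem, fun s hs => ?_, fun y hy => ?_, fun j hj => ?_⟩
  · rw [State.setReg_reg, if_neg, h.const s hs]
    rcases hr with h | h | h | ⟨y, -, h⟩ | ⟨y, -, h⟩ <;> omega
  · rw [State.setReg_reg, if_neg, h.var y hy]
    rcases hr with h | h | h | ⟨z, h', h⟩ | ⟨z, h', h⟩ <;> omega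
  · rw [State.setReg_reg, if_neg, h.aux j hj]
    rcases hr with h | h | h | ⟨z, h', h⟩ | ⟨z, h', h⟩ <;> omega

/-- The state represents the values of the first `d` variables and the tables. -/
structure Represents (n d : ℕ) (env : ℕ → ℕ) (T : Tables) (σ : State) : Prop where
  size : σ.reg 0 = n
  one : σ.reg 2 = 1
  var : ∀ x < d, σ.reg (2 * x + 6) = env x
  lt : ∀ x < d, env x < n
  pow1 : ∀ i < n, σ.mem 2 i = i * n
  pow2 : ∀ i < n, σ.mem 3 i = i * n ^ 2
  pow3 : ∀ i < n, σ.mem 4 i = i * n ^ 3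
  pow4 : ∀ i < n, σ.mem 5 i = i * n ^ 4
  tab : ∀ a x, Key.Lt n x → T a x → σ.mem (a + 6) (x.code n) = 1
  tab' : ∀ a x, Key.Lt n x → ¬ T a x → σ.mem (a + 6) (x.code n) = 0

theorem Represents.of_keeps {n d k : ℕ} {env : ℕ → ℕ} {T : Tables} {σ τ : State}
    (h : Represents n d env T σ) (hk : Keeps d k σ τ) : Represents n d env T τ where
  size := (hk.const 0 (by omega)).trans h.size
  one := (hk.const 2 (by omega)).trans h.one
  var x hx := (hk.var x hx).trans (h.var x hx)
  lt := h.lt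
  pow1 := by rw [hk.mem]; exact h.pow1
  pow2 := by rw [hk.mem]; exact h.pow2
  pow3 := by rw [hk.mem]; exact h.pow3
  pow4 := by rw [hk.mem]; exact h.pow4
  tab := by rw [hk.mem]; exact h.tab
  tab' := by rw [hk.mem]; exact h.tab'

theorem Represents.bind {n d i : ℕ} {env : ℕ → ℕ} {T : Tables} {σ : State}
    (h : Represents n d env T σ) (hi : i < n) (hσ : σ.reg (2 * d + 6) = i) :
    Represents n (d + 1) (Function.update env d i) T σ where
  size := h.size
  one := h.one
  var x hx := by
    rcases Nat.lt_succ_iff_lt_or_eq.1 hx with hx | rfl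
    · rw [Function.update_of_ne hx.ne, h.var x hx]
    · rw [Function.update_self, hσ]
  lt x hx := by
    rcases Nat.lt_succ_iff_lt_or_eq.1 hx with hx | rfl
    · rw [Function.update_of_ne hx.ne]; exact h.lt x hx
    · rw [Function.update_self]; exact hi
  pow1 := h.pow1
  pow2 := h.pow2
  pow3 := h.pow3
  pow4 := h.pow4
  tab := h.tab
  tab' := h.tab'

theorem Represents.unbind {n d i : ℕ} {env : ℕ → ℕ} {T : Tables} {σ : State}
    (h : Represents n (d + 1) (Function.update env d i) T σ) : Represents n d env T σ where
  size := h.size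
  one := h.one
  var x hx := by rw [h.var x (by omega), Function.update_of_ne hx.ne]
  lt x hx := by have := h.lt x (by omega); rwa [Function.update_of_ne hx.ne] at this
  pow1 := h.pow1
  pow2 := h.pow2
  pow3 := h.pow3
  pow4 := h.pow4
  tab := h.tab
  tab' := h.tab'

theorem Key.Lt.subst {n d : ℕ} {env : ℕ → ℕ} (h : ∀ x < d, env x < n) {x : Key} (hx : x.Lt d) :
    (x.subst env).Lt n :=
  ⟨h _ hx.1, h _ hx.2.1, h _ hx.2.2.1, h _ hx.2.2.2.1, h _ hx.2.2.2.2⟩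

/-- The machine cannot multiply. Arrays `2` to `5` supply the multiples of the powers of `n`, so one
copy, four loads and four additions suffice; all partial sums are at most the position itself. -/
theorem exec_codeProgram {w n d : ℕ} {env : ℕ → ℕ} {T : Tables} {σ : State}
    (h : Represents n d env T σ) (hw : n ^ 5 ≤ w) {x : Key} (hx : x.Lt d) (k : ℕ) :
    ∃ τ, Exec w (codeProgram x) σ 9 τ ∧ Keeps d k σ τ ∧ τ.reg 4 = (x.subst env).code n := by
  have hlt := hx.subst h.lt
  have hcode := Key.code_lt hlt
  obtain ⟨x0, x1, x2, x3, x4⟩ := x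
  obtain ⟨h0, h1, h2, h3, h4⟩ := hx
  obtain ⟨l0, l1, l2, l3, l4⟩ := hlt
  simp only [Key.subst, Key.code] at *
  have v0 := h.var x0 h0
  have v1 := h.var x1 h1
  have v2 := h.var x2 h2
  have v3 := h.var x3 h3
  have v4 := h.var x4 h4
  have p1 := h.pow1 _ l3
  have p2 := h.pow2 _ l2
  have p3 := h.pow3 _ l1
  have p4 := h.pow4 _ l0
  have n45 : ∀ x, ¬ (2 * x + 6 = 4) ∧ ¬ (2 * x + 6 = 5) := fun x => by omega
  have c4 := Keeps.refl d k σ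
  refine ⟨_, .seq (s := 1) (t := 8) (.copy σ 4 _) <| .seq (s := 1) (t := 7) (.load _ 5 2 _) <|
    .seq (s := 1) (t := 6) (.add _ 4 4 5 ?_) <|
    .seq (s := 1) (t := 5) (.load _ 5 3 _) <| .seq (s := 1) (t := 4) (.add _ 4 4 5 ?_) <|
    .seq (s := 1) (t := 3) (.load _ 5 4 _) <| .seq (s := 1) (t := 2) (.add _ 4 4 5 ?_) <|
    .seq (s := 1) (t := 1) (.load _ 5 5 _) (.add _ 4 4 5 ?_), ?_, ?_⟩
  · simp [n45, v4, v3, p1]; omega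
  · simp [n45, v4, v3, v2, p1, p2]; omega
  · simp [n45, v4, v3, v2, v1, p1, p2, p3]; omega
  · simp [n45, v4, v3, v2, v1, v0, p1, p2, p3, p4]; omega
  · iterate 9 refine Keeps.setReg ?_ _ (by omega)
    exact c4
  · simp [n45, v4, v3, v2, v1, v0, p1, p2, p3, p4]

/-- The auxiliary register `k` holds a truth value. -/
def HoldsReg (p : Prop) (k : ℕ) (σ : State) : Prop :=
  (p → σ.reg (2 * k + 7) = 1) ∧ (¬ p → σ.reg (2 * k + 7) = 0)

/-- A quantifier multiplies the time by `n` and adds a bounded number of steps per round. As `n` is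
positive, these fit into the constant factor. -/
theorem Fml.exec_compile {w n : ℕ} (hn : 0 < n) (hw : n ^ 5 ≤ w) {T : Tables} (φ : Fml) :
    ∀ (d k : ℕ) (env : ℕ → ℕ) (σ : State), φ.WF d → Represents n d env T σ →
    ∃ t τ, Exec w (φ.compile d k) σ t τ ∧ Keeps d k σ τ ∧ HoldsReg (φ.Holds n T d env) k τ ∧
      t ≤ φ.cost * n ^ φ.depth := by
  have hnw : n ≤ w := (Nat.le_self_pow (by omega) n).trans hw
  induction φ with
  | tab a x =>
    intro d k env σ hwf h
    obtain ⟨τ, e, hk, h4⟩ := exec_codeProgram h hw hwf k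
    refine ⟨_, _, .seq e (.load τ _ _ _),
      hk.setReg _ (.inr (.inr (.inr (.inr ⟨k, le_rfl, rfl⟩)))), ?_, by simp [cost, depth]⟩
    have h' := h.of_keeps hk
    have hlt := Key.Lt.subst h.lt hwf
    constructor
    · intro hp
      simp only [State.setReg_reg, if_true, h4]
      exact h'.tab a _ hlt hp
    · intro hp
      simp only [State.setReg_reg, if_true, h4]
      exact h'.tab' a _ hlt hp
  | eq x y =>
    intro d k env σ hwf h
    have vx := h.var x hwf.1
    have vy := h.var y hwf.2
    have lx := h.lt x hwf.1
    have ly := h.lt y hwf.2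
    have e1 := Exec.sub (w := w) σ 4 (2 * x + 6) (2 * y + 6)
    have e2 := Exec.sub (w := w) (σ.setReg 4 (env x - env y)) 5 (2 * y + 6) (2 * x + 6)
    have e3 := Exec.add (w := w) ((σ.setReg 4 (env x - env y)).setReg 5 (env y - env x)) 4 4 5
      (by simp; omega)
    rw [vx, vy] at e1
    simp only [State.setReg_reg, vx, vy, show ¬ (2 * x + 6 = 4) by omega,
      show ¬ (2 * y + 6 = 4) by omega, if_false] at e2
    simp only [State.setReg_reg, if_true, if_false, show ¬ (4 = 5) by omega] at e3
    have hk : Keeps d k σ (((σ.setReg 4 (env x - env y)).setReg 5 (env y - env x)).setReg 4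
          (env x - env y + (env y - env x))) :=
      (((Keeps.refl d k σ).setReg _ (by omega)).setReg _ (by omega)).setReg _ (by omega)
    have hk' : ∀ v, Keeps d k σ (State.setReg _ (2 * k + 7) v) := fun v =>
      hk.setReg v (.inr (.inr (.inr (.inr ⟨k, le_rfl, rfl⟩))))
    by_cases hxy : env x = env y
    · refine ⟨_, _, .seq e1 (.seq e2 (.seq e3 (.cond_false ?_ (.const _ _ 1 (by omega))))),
        hk' _, ?_, by simp [cost, depth]⟩
      · simp [hxy]
      · exact ⟨fun _ => by simp, fun h => absurd hxy h⟩
    · refine ⟨_, _, .seq e1 (.seq e2 (.seq e3 (.cond_true ?_ (.const _ _ 0 (by omega))))),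
        hk' _, ?_, by simp [cost, depth]⟩
      · simp; omega
      · exact ⟨fun h => absurd h hxy, fun _ => by simp⟩
  | not φ ih =>
    intro d k env σ hwf h
    obtain ⟨t, τ, e, hk, hr, ht⟩ := ih d k env σ hwf h
    have hpos : 1 ≤ n ^ φ.depth := Nat.one_le_pow _ _ hn
    have hcost : t + 2 ≤ (Fml.not φ).cost * n ^ (Fml.not φ).depth := by
      simp only [cost, depth]; nlinarith
    by_cases hp : φ.Holds n T d env
    · refine ⟨_, _, .seq e (.cond_true ?_ (.const _ _ 0 (by omega))), hk.setReg _ ?_, ?_, hcost⟩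
      · rw [hr.1 hp]; omega
      · exact .inr (.inr (.inr (.inr ⟨k, le_rfl, rfl⟩)))
      · exact ⟨fun h => absurd hp h, fun _ => by simp⟩
    · refine ⟨_, _, .seq e (.cond_false (hr.2 hp) (.const _ _ 1 (by omega))), hk.setReg _ ?_, ?_,
        hcost⟩
      · exact .inr (.inr (.inr (.inr ⟨k, le_rfl, rfl⟩)))
      · exact ⟨fun _ => by simp, fun h => absurd hp h⟩
  | and φ ψ ih ih' =>
    intro d k env σ hwf h
    obtain ⟨t, τ, e, hk, hr, ht⟩ := ih d k env σ hwf.1 h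
    obtain ⟨t', τ', e', hk', hr', ht'⟩ := ih' d k env τ hwf.2 (h.of_keeps hk)
    have hpos : 1 ≤ n ^ (Fml.and φ ψ).depth := Nat.one_le_pow _ _ hn
    have h1 : n ^ φ.depth ≤ n ^ (Fml.and φ ψ).depth := Nat.pow_le_pow_right hn (le_max_left _ _)
    have h2 : n ^ ψ.depth ≤ n ^ (Fml.and φ ψ).depth := Nat.pow_le_pow_right hn (le_max_right _ _)
    have ht := ht.trans (Nat.mul_le_mul_left φ.cost h1)
    have ht' := ht'.trans (Nat.mul_le_mul_left ψ.cost h2)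
    have hcost : (Fml.and φ ψ).cost * n ^ (Fml.and φ ψ).depth =
        φ.cost * n ^ (Fml.and φ ψ).depth + ψ.cost * n ^ (Fml.and φ ψ).depth +
        2 * n ^ (Fml.and φ ψ).depth := by
      simp only [cost]; ring
    by_cases hp : φ.Holds n T d env
    · refine ⟨_, _, .seq e (.cond_true (by rw [hr.1 hp]; omega) e'), hk.trans hk' le_rfl le_rfl, ?_,
        by omega⟩
      exact ⟨fun h => hr'.1 h.2, fun h => hr'.2 fun h' => h ⟨hp, h'⟩⟩
    · refine ⟨_, _, .seq e (.cond_false (hr.2 hp) (.skip _)), hk, ?_, by omega⟩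
      exact ⟨fun h => absurd h.1 hp, fun _ => hr.2 hp⟩
  | ex φ ih =>
    intro d k env σ hwf h
    have hpos : 1 ≤ n ^ φ.depth := Nat.one_le_pow _ _ hn
    obtain ⟨t, τ, e, ht, ⟨hk, hr⟩, -⟩ := exec_forLoop (w := w) (N := n) (b := 0) (r := 2 * d + 6)
      (p := .seq (φ.compile (d + 1) (k + 1)) (.cond (2 * (k + 1) + 7) (.const (2 * k + 7) 1) .skip))
      (B := φ.cost * n ^ φ.depth + 2)
      (fun i τ => (Keeps d k σ τ ∧
        HoldsReg (∃ j < i, φ.Holds n T (d + 1) (Function.update env d j)) k τ) ∧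
        τ.reg (2 * d + 6) = i) hnw
      (by omega)
      (by
        rintro i hi τ ⟨⟨hk, hr⟩, hd⟩
        have hrep := (h.of_keeps hk).bind hi hd
        obtain ⟨t, ρ, e, hk', hr', ht⟩ := ih (d + 1) (k + 1) _ τ hwf hrep
        have hρ := hrep.of_keeps hk'
        have hρd : ρ.reg (2 * d + 6) = i := by rw [hk'.var d (by omega), hd]
        have hkρ : Keeps d k σ ρ := hk.trans hk' (by omega) (by omega)
        have hρk : ρ.reg (2 * k + 7) = τ.reg (2 * k + 7) := hk'.aux k (by omega)
        by_cases hp : φ.Holds n T (d + 1) (Function.update env d i)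
        · refine ⟨_, _, .seq e (.cond_true (by rw [hr'.1 hp]; omega) (.const _ _ 1 (by omega))),
            by omega, by simp [hρ.size], by simp [hρ.one], ?_, ⟨?_, ?_⟩, ?_⟩
          · rw [State.setReg_reg, if_neg (by omega), hρd]
          · refine ((hkρ.setReg _ ?_).setReg _ ?_).setReg _ (by omega)
            · exact .inr (.inr (.inr (.inr ⟨k, le_rfl, rfl⟩)))
            · exact .inr (.inr (.inr (.inl ⟨d, le_rfl, rfl⟩)))
          · refine ⟨fun _ => ?_, fun hh => absurd ⟨i, by omega, hp⟩ hh⟩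
            rw [State.setReg_reg, if_neg (by omega), State.setReg_reg, if_neg (by omega)]
            simp
          · rw [State.setReg_reg, if_neg (by omega), State.setReg_reg, if_pos rfl]
        · refine ⟨_, _, .seq e (.cond_false (hr'.2 hp) (.skip _)), by omega, hρ.size, hρ.one, hρd,
            ⟨?_, ?_⟩, ?_⟩
          · refine (hkρ.setReg _ ?_).setReg _ (by omega)
            exact .inr (.inr (.inr (.inl ⟨d, le_rfl, rfl⟩)))
          · have hiff : (∃ j < i + 1, φ.Holds n T (d + 1) (Function.update env d j)) ↔
                ∃ j < i, φ.Holds n T (d + 1) (Function.update env d j) := by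
              constructor
              · rintro ⟨j, hj, hφ⟩
                rcases Nat.lt_succ_iff_lt_or_eq.1 hj with hj | rfl
                · exact ⟨j, hj, hφ⟩
                · exact absurd hφ hp
              · rintro ⟨j, hj, hφ⟩
                exact ⟨j, by omega, hφ⟩
            unfold HoldsReg
            rw [hiff, State.setReg_reg, if_neg (by omega), State.setReg_reg, if_neg (by omega), hρk]
            exact hr
          · rw [State.setReg_reg, if_neg (by omega), State.setReg_reg, if_pos rfl])
      (σ.setReg (2 * k + 7) 0) (by simp [h.size]) (by
        refine ⟨⟨?_, ?_⟩, ?_⟩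
        · refine (((Keeps.refl d k σ).setReg _ ?_).setReg _ ?_).setReg _ (by omega)
          · exact .inr (.inr (.inr (.inr ⟨k, le_rfl, rfl⟩)))
          · exact .inr (.inr (.inr (.inl ⟨d, le_rfl, rfl⟩)))
        · refine ⟨fun ⟨j, hj, _⟩ => absurd hj (by omega), fun _ => ?_⟩
          rw [State.setReg_reg, if_neg (by omega), State.setReg_reg, if_neg (by omega)]
          simp
        · rw [State.setReg_reg, if_neg (by omega), State.setReg_reg, if_pos rfl])
    refine ⟨_, _, .seq (.const σ _ 0 (by omega)) e, hk, hr, ?_⟩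
    simp only [cost, depth, pow_succ]
    have h3 : n ≤ n ^ φ.depth * n := Nat.le_mul_of_pos_left n hpos
    have h4 : n * (φ.cost * n ^ φ.depth + 2 + 3) = φ.cost * (n ^ φ.depth * n) + 5 * n := by ring
    have h5 : (φ.cost + 9) * (n ^ φ.depth * n) = φ.cost * (n ^ φ.depth * n) +
      9 * (n ^ φ.depth * n) := by ring
    omega

end RAM

/-! ### Execution of loop programs, and reading the input -/

namespace RAM

theorem Represents.setMem {n d : ℕ} {env : ℕ → ℕ} {T : Tables} {σ : State}
    (h : Represents n d env T σ) (a v : ℕ) {x : Key} (hx : x.Lt n) {p : Prop} (hv : p → v = 1)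
    (hv' : ¬ p → v = 0) : Represents n d env (T.set a x p) (σ.setMem (a + 6) (x.code n) v) where
  size := h.size
  one := h.one
  var := h.var
  lt := h.lt
  pow1 i hi := by rw [State.setMem_mem, if_neg (by omega)]; exact h.pow1 i hi
  pow2 i hi := by rw [State.setMem_mem, if_neg (by omega)]; exact h.pow2 i hi
  pow3 i hi := by rw [State.setMem_mem, if_neg (by omega)]; exact h.pow3 i hi
  pow4 i hi := by rw [State.setMem_mem, if_neg (by omega)]; exact h.pow4 i hi
  tab b y hy hT := by
    rw [State.setMem_mem]
    split_ifs with hc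
    · obtain ⟨h1, h2⟩ := hc
      obtain rfl : b = a := by omega
      obtain rfl := Key.code_inj hy hx h2
      exact hv (by simpa [Tables.set] using hT)
    · refine h.tab b y hy ?_
      by_cases hb : b = a
      · subst hb
        have hyx : y ≠ x := by rintro rfl; exact hc ⟨rfl, rfl⟩
        simpa [Tables.set, hyx] using hT
      · simpa [Tables.set, hb] using hT
  tab' b y hy hT := by
    rw [State.setMem_mem]
    split_ifs with hc
    · obtain ⟨h1, h2⟩ := hc
      obtain rfl : b = a := by omega
      obtain rfl := Key.code_inj hy hx h2
      exact hv' (by simpa [Tables.set] using hT)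
    · refine h.tab' b y hy ?_
      by_cases hb : b = a
      · subst hb
        have hyx : y ≠ x := by rintro rfl; exact hc ⟨rfl, rfl⟩
        simpa [Tables.set, hyx] using hT
      · simpa [Tables.set, hb] using hT

theorem Cmd.exec_compile {w n : ℕ} (hn : 0 < n) (hw : n ^ 5 ≤ w) (c : Cmd) :
    ∀ (d : ℕ) (env : ℕ → ℕ) (T : Tables) (σ : State), c.WF d → Represents n d env T σ →
    ∃ t τ, Exec w (c.compile d) σ t τ ∧ Represents n d env (c.run n d env T) τ ∧
      t ≤ c.cost * n ^ c.depth := by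
  have hnw : n ≤ w := (Nat.le_self_pow (by omega) n).trans hw
  induction c with
  | put a x φ =>
    intro d env T σ hwf h
    obtain ⟨t, τ, e, hk, hr, ht⟩ := φ.exec_compile hn hw d 0 env σ hwf.2 h
    obtain ⟨ρ, e', hk', h4⟩ := exec_codeProgram (h.of_keeps hk) hw hwf.1 1
    have h7 : ρ.reg 7 = τ.reg 7 := hk'.aux 0 (by omega)
    have hpos : 1 ≤ n ^ φ.depth := Nat.one_le_pow _ _ hn
    refine ⟨_, _, .seq e (.seq e' (.store _ _ _ _)), ?_, ?_⟩
    · rw [h4]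
      exact ((h.of_keeps hk).of_keeps hk').setMem a _ (hwf.1.subst h.lt)
        (fun hp => h7.trans (hr.1 hp)) (fun hp => h7.trans (hr.2 hp))
    · simp only [cost, depth]; nlinarith
  | seq c c' ih ih' =>
    intro d env T σ hwf h
    obtain ⟨t, τ, e, h', ht⟩ := ih d env T σ hwf.1 h
    obtain ⟨t', τ', e', h'', ht'⟩ := ih' d env _ τ hwf.2 h'
    have h1 : n ^ c.depth ≤ n ^ (Cmd.seq c c').depth := Nat.pow_le_pow_right hn (le_max_left _ _)
    have h2 : n ^ c'.depth ≤ n ^ (Cmd.seq c c').depth := Nat.pow_le_pow_right hn (le_max_right _ _)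
    refine ⟨_, _, .seq e e', h'', ?_⟩
    calc t + t' ≤ c.cost * n ^ (Cmd.seq c c').depth + c'.cost * n ^ (Cmd.seq c c').depth :=
          add_le_add (ht.trans (Nat.mul_le_mul_left _ h1)) (ht'.trans (Nat.mul_le_mul_left _ h2))
      _ = (Cmd.seq c c').cost * n ^ (Cmd.seq c c').depth := by simp only [cost]; ring
  | all c ih =>
    intro d env T σ hwf h
    have hpos : 1 ≤ n ^ c.depth := Nat.one_le_pow _ _ hn
    have hset : ∀ {T : Tables} {τ : State} (i v : ℕ), Represents n d env T τ →
        Represents n d env T ((τ.setReg (2 * d + 6) i).setReg 3 v) := fun i v hτ =>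
      hτ.of_keeps (((Keeps.refl d 0 _).setReg _ (.inr (.inr (.inr (.inl ⟨d, le_rfl, rfl⟩))))).setReg
        _ (by omega))
    obtain ⟨t, τ, e, ht, hτ, -⟩ := exec_forLoop (w := w) (N := n) (b := 0) (r := 2 * d + 6)
      (p := c.compile (d + 1)) (B := c.cost * n ^ c.depth)
      (fun i τ => Represents n d env ((List.range i).foldl
        (fun T i => c.run n (d + 1) (Function.update env d i) T) T) τ ∧ τ.reg (2 * d + 6) = i) hnw
      (by omega)
      (by
        rintro i hi τ ⟨hτ, hd⟩
        obtain ⟨t, ρ, e, hρ, ht⟩ := ih (d + 1) _ _ τ hwf (hτ.bind hi hd)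
        refine ⟨t, ρ, e, ht, hρ.size, hρ.one, ?_, ?_, ?_⟩
        · rw [hρ.var d (by omega), Function.update_self]
        · rw [List.range_succ, List.foldl_append]
          exact hset _ _ hρ.unbind
        · rw [State.setReg_reg, if_neg (by omega), State.setReg_reg, if_pos rfl])
      σ h.size ⟨hset _ _ h, by rw [State.setReg_reg, if_neg (by omega), State.setReg_reg, if_pos rfl]⟩
    refine ⟨t, τ, e, hτ, ?_⟩
    simp only [cost, depth, pow_succ]
    have h3 : n ≤ n ^ c.depth * n := Nat.le_mul_of_pos_left n hpos
    have h4 : n * (c.cost * n ^ c.depth + 3) = c.cost * (n ^ c.depth * n) + 3 * n := by ring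
    have h5 : (c.cost + 6) * (n ^ c.depth * n) = c.cost * (n ^ c.depth * n) +
      6 * (n ^ c.depth * n) := by ring
    omega

/-- Fill array `j` with the multiples of register `4`, and multiply this register by `n`. -/
def multiplesProgram (j : ℕ) : Program :=
  .seq (.const 5 0) (.seq (forLoop 0 6 (.seq (.store j 6 5) (.add 5 5 4))) (.copy 4 5))

/-- Register `5` runs through the multiples of `q`. Its final value `n * q` is the factor for the
next array. -/
theorem exec_multiplesProgram {w n j q : ℕ} {σ : State} (h0 : σ.reg 0 = n) (h2 : σ.reg 2 = 1)
    (h4 : σ.reg 4 = q) (hw : n * q ≤ w) (hnw : n ≤ w) :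
    ∃ t τ, Exec w (multiplesProgram j) σ t τ ∧ t ≤ 5 * n + 5 ∧ τ.reg 0 = n ∧
      τ.reg 1 = σ.reg 1 ∧ τ.reg 2 = 1 ∧ τ.reg 4 = n * q ∧ (∀ i < n, τ.mem j i = i * q) ∧
      ∀ b, b ≠ j → τ.mem b = σ.mem b := by
  obtain ⟨t, τ, e, ht, g0, g1, g2, g4, g5, g6, gj, gb⟩ := exec_forLoop (w := w) (N := n) (b := 0)
    (r := 6) (p := .seq (.store j 6 5) (.add 5 5 4)) (B := 2)
    (fun i τ => τ.reg 0 = n ∧ τ.reg 1 = σ.reg 1 ∧ τ.reg 2 = 1 ∧ τ.reg 4 = q ∧ τ.reg 5 = i * q ∧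
      τ.reg 6 = i ∧ (∀ k < i, τ.mem j k = k * q) ∧ ∀ b, b ≠ j → τ.mem b = σ.mem b)
    hnw (by omega)
    (by
      rintro i hi τ ⟨g0, g1, g2, g4, g5, g6, gj, gb⟩
      have hle : (i + 1) * q ≤ w := (Nat.mul_le_mul_right q hi).trans hw
      refine ⟨_, _, .seq (.store τ j 6 5) (.add _ 5 5 4 ?_), le_rfl, ?_, ?_, ?_, ?_, ?_, ?_, ?_, ?_,
        ?_, ?_, ?_⟩
      · simp only [State.setMem_reg, g5, g4]; linarith
      · simpa using g0
      · simpa using g2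
      · simpa using g6
      · simpa using g0
      · simpa using g1
      · simpa using g2
      · simpa using g4
      · simp [g5, g4]; ring
      · simp
      · intro k hk
        simp only [State.setReg_mem, State.setMem_mem, g6, g5, true_and]
        split_ifs with hki
        · rw [hki]
        · exact gj k (by omega)
      · intro b hb
        funext k
        simp only [State.setReg_mem, State.setMem_mem, hb, false_and, if_false, gb b hb])
    (σ.setReg 5 0) (by simpa using h0) (by simp [h0, h2, h4])
  refine ⟨_, _, .seq (.const _ _ _ (by omega)) (.seq e (.copy _ _ _)), by omega, ?_⟩
  simp [g0, g1, g2, g5]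
  exact ⟨gj, gb⟩

/-- Enter the arcs into table `0`. -/
def arcsProgram : Program :=
  forLoop 1 6 (.seq (.load 7 0 6) (.seq (.load 8 1 6) (.seq (.load 9 2 7) (.seq (.add 9 9 8)
    (.store 6 9 2)))))

/-- The tables at the start: table `0` holds the arcs. -/
def arcTables {n : ℕ} (D : Digraph (Fin n)) : Tables := fun a x =>
  a = 0 ∧ ∃ u v : Fin n, D.Adj u v ∧ x = (0, 0, 0, (u : ℕ), (v : ℕ))

/-- Run a loop program on the digraph, and read the answer from table `A`. -/
def mainProgram (c : Cmd) (A : ℕ) : Program :=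
  .cond 0 (.seq (.const 2 1) <| .seq (.copy 4 0) <| .seq (multiplesProgram 2) <|
    .seq (multiplesProgram 3) <| .seq (multiplesProgram 4) <| .seq (multiplesProgram 5) <|
    .seq arcsProgram <| .seq (.const 6 0) <| .seq (c.compile 1) <| .seq (.const 4 0)
    (.load 0 (A + 6) 4)) .skip

theorem exec_arcsProgram {w n : ℕ} (hw : n ^ 5 ≤ w) (D : Digraph (Fin n))
    (arcs : List (Fin n × Fin n)) (hm : arcs.length ≤ w)
    (harcs : ∀ u v, (u, v) ∈ arcs ↔ D.Adj u v) {σ : State}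
    (h0 : σ.reg 0 = n) (h1 : σ.reg 1 = arcs.length) (h2 : σ.reg 2 = 1)
    (m0 : ∀ j, σ.mem 0 j = (arcs.map fun e => (e.1 : ℕ)).getD j 0)
    (m1 : ∀ j, σ.mem 1 j = (arcs.map fun e => (e.2 : ℕ)).getD j 0)
    (m2 : ∀ i < n, σ.mem 2 i = i * n) (m3 : ∀ i < n, σ.mem 3 i = i * n ^ 2)
    (m4 : ∀ i < n, σ.mem 4 i = i * n ^ 3) (m5 : ∀ i < n, σ.mem 5 i = i * n ^ 4)
    (m6 : ∀ a j, σ.mem (a + 6) j = 0) :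
    ∃ t τ, Exec w arcsProgram σ t τ ∧ t ≤ 8 * arcs.length + 3 ∧
      Represents n 0 (fun _ => 0) (arcTables D) τ := by
  obtain ⟨t, τ, e, ht, g0, g1, g2, g6, gm, gt, gt'⟩ := exec_forLoop (w := w) (N := arcs.length)
    (b := 1) (r := 6) (p := .seq (.load 7 0 6) (.seq (.load 8 1 6) (.seq (.load 9 2 7)
      (.seq (.add 9 9 8) (.store 6 9 2))))) (B := 5)
    (fun i τ => τ.reg 0 = n ∧ τ.reg 1 = arcs.length ∧ τ.reg 2 = 1 ∧ τ.reg 6 = i ∧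
      (∀ b, b ≠ 6 → τ.mem b = σ.mem b) ∧
      (∀ x : Key, (∃ k, k < i ∧ ∃ h : k < arcs.length,
        x = (0, 0, 0, (arcs[k].1 : ℕ), (arcs[k].2 : ℕ))) → τ.mem 6 (x.code n) = 1) ∧
      -- Only indices below `n` have distinct positions, hence the restriction.
      (∀ x : Key, x.Lt n → (¬ ∃ k, k < i ∧ ∃ h : k < arcs.length,
        x = (0, 0, 0, (arcs[k].1 : ℕ), (arcs[k].2 : ℕ))) → τ.mem 6 (x.code n) = 0)) hm (by omega)
    (by
      rintro i hi τ ⟨g0, g1, g2, g6, gm, gt, gt'⟩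
      have hn : 0 < n := arcs[i].1.pos
      have e0 : τ.mem 0 i = arcs[i].1 := by
        rw [gm 0 (by omega), m0]; simp [List.getD, hi]
      have e1 : τ.mem 1 i = arcs[i].2 := by
        rw [gm 1 (by omega), m1]; simp [List.getD, hi]
      have e2 : τ.mem 2 arcs[i].1 = arcs[i].1 * n := by
        rw [gm 2 (by omega), m2 _ arcs[i].1.2]
      have hlt : Key.Lt n (0, 0, 0, (arcs[i].1 : ℕ), (arcs[i].2 : ℕ)) :=
        ⟨hn, hn, hn, arcs[i].1.2, arcs[i].2.2⟩
      have hcode : Key.code n (0, 0, 0, (arcs[i].1 : ℕ), (arcs[i].2 : ℕ)) =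
          arcs[i].1 * n + arcs[i].2 := by simp [Key.code]; ring
      have hc := Key.code_lt hlt
      refine ⟨_, _, .seq (.load τ 7 0 6) (.seq (.load _ 8 1 6) (.seq (.load _ 9 2 7)
        (.seq (.add _ 9 9 8 ?_) (.store _ 6 9 2)))), le_rfl, ?_, ?_, ?_, ?_, ?_, ?_, ?_, ?_, ?_, ?_⟩
      · simp [g6, e0, e1, e2]; omega
      · simpa using g1
      · simpa using g2
      · simpa using g6
      · simpa using g0
      · simpa using g1
      · simpa using g2
      · simp
      · intro b hb
        funext k
        simp only [State.setReg_mem, State.setMem_mem, hb, false_and, if_false]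
        rw [gm b hb]
      · rintro x ⟨k, hk, hkl, rfl⟩
        simp only [State.setReg_mem, State.setMem_mem, State.setReg_reg, true_and, if_true]
        simp [g6, e0, e1, e2, g2]
        intro hne
        refine gt _ ⟨k, ?_, hkl, rfl⟩
        by_contra hki
        obtain rfl : k = i := by omega
        exact hne hcode
      · intro x hx hnx
        simp only [State.setReg_mem, State.setMem_mem, State.setReg_reg, true_and, if_true]
        rw [if_neg]
        · exact gt' x hx fun ⟨k, hk, hh⟩ => hnx ⟨k, by omega, hh⟩
        · simp [g6, e0, e1, e2]
          intro hh
          exact hnx ⟨i, by omega, hi, Key.code_inj hx hlt (hh.trans hcode.symm)⟩)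
    σ h1 (by simp [h0, h1, h2, m6])
  refine ⟨t, τ, e, by omega, g0, g2, by simp, by simp, ?_, ?_, ?_, ?_, ?_, ?_⟩
  · rw [gm 2 (by omega)]; exact m2
  · rw [gm 3 (by omega)]; exact m3
  · rw [gm 4 (by omega)]; exact m4
  · rw [gm 5 (by omega)]; exact m5
  · rintro a x hx ⟨rfl, u, v, huv, rfl⟩
    obtain ⟨k, hk, hkuv⟩ := List.getElem_of_mem ((harcs u v).2 huv)
    exact gt _ ⟨k, hk, hk, by rw [hkuv]⟩
  · intro a x hx hT
    by_cases ha : a = 0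
    · subst ha
      refine gt' x hx ?_
      rintro ⟨k, hk, hk', rfl⟩
      exact hT ⟨rfl, _, _, (harcs _ _).1 (List.getElem_mem hk'), rfl⟩
    · rw [gm _ (by omega)]; exact m6 a _

/-- A property that a loop program of depth at most `8` decides can be decided in time
`O(n ^ 7 * (n + m))`. -/
theorem solvableInTime_of_cmd {Q : (n : ℕ) → Digraph (Fin n) → Prop} (c : Cmd) (A : ℕ)
    (hwf : c.WF 1) (hdepth : c.depth ≤ 8) (hQ0 : ∀ D, ¬ Q 0 D)
    (hQ : ∀ n (D : Digraph (Fin n)), 0 < n → (∀ v, ¬ D.Adj v v) →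
      (c.run n 1 (fun _ => 0) (arcTables D) A (0, 0, 0, 0, 0) ↔ Q n D)) :
    SolvableInTime Q (fun n m => n ^ 7 * (n + m)) := by
  -- The exponent `5` makes words large enough for positions in tables with five indices.
  refine ⟨mainProgram c A, 5, c.cost + 100, fun n D arcs hloop _ harcs => ?_⟩
  have hw : n ^ 5 ≤ (n + arcs.length + 2) ^ 5 := Nat.pow_le_pow_left (by omega) 5
  have hw1 : n + arcs.length + 2 ≤ (n + arcs.length + 2) ^ 5 := Nat.le_self_pow (by omega) _
  generalize (n + arcs.length + 2) ^ 5 = w at hw hw1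
  rcases Nat.eq_zero_or_pos n with rfl | hn
  -- Without vertices the program stops at once, and register `0`, which holds the size, already
  -- gives the answer no.
  · refine ⟨_, _, .cond_false rfl (.skip _), fun h => absurd h (hQ0 D), fun _ => rfl,
      fun h => absurd h (by omega)⟩
  have hnw : n ≤ w := by omega
  have p2 : n * n ≤ n ^ 5 := by
    rw [← pow_two]; exact Nat.pow_le_pow_right hn (by omega)
  have p3 : n * (n * n) ≤ n ^ 5 :=
    le_of_eq_of_le (by ring) (Nat.pow_le_pow_right hn (by omega : 3 ≤ 5))
  have p4 : n * (n * (n * n)) ≤ n ^ 5 :=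
    le_of_eq_of_le (by ring) (Nat.pow_le_pow_right hn (by omega : 4 ≤ 5))
  have p5 : n * (n * (n * (n * n))) ≤ n ^ 5 := le_of_eq (by ring)
  set σ₀ := ((input n arcs).setReg 2 1).setReg 4 n with hσ₀
  have e1 : Exec w (.const 2 1) (input n arcs) 1 ((input n arcs).setReg 2 1) :=
    .const _ _ _ (by omega)
  have e2 : Exec w (.copy 4 0) ((input n arcs).setReg 2 1) 1 σ₀ := .copy _ 4 0
  obtain ⟨t3, τ3, e3, ht3, a0, a1, a2, a4, aj, ab⟩ := exec_multiplesProgram (w := w) (n := n)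
    (j := 2) (q := n) (σ := σ₀) (by simp [hσ₀, input]) (by simp [hσ₀]) (by simp [hσ₀])
    (by omega) hnw
  obtain ⟨t4, τ4, e4, ht4, b0, b1, b2, b4, bj, bb⟩ := exec_multiplesProgram (w := w) (n := n)
    (j := 3) (q := n * n) (σ := τ3) a0 a2 a4 (by omega) hnw
  obtain ⟨t5, τ5, e5, ht5, c0, c1, c2, c4, cj, cb⟩ := exec_multiplesProgram (w := w) (n := n)
    (j := 4) (q := n * (n * n)) (σ := τ4) b0 b2 b4 (by omega) hnw
  obtain ⟨t6, τ6, e6, ht6, d0, d1, d2, d4, dj, db⟩ := exec_multiplesProgram (w := w) (n := n)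
    (j := 5) (q := n * (n * (n * n))) (σ := τ5) c0 c2 c4 (by omega) hnw
  have hmem : ∀ b, b ≠ 2 → b ≠ 3 → b ≠ 4 → b ≠ 5 → τ6.mem b = (input n arcs).mem b :=
    fun b h2 h3 h4 h5 => by rw [db b h5, cb b h4, bb b h3, ab b h2]; rfl
  obtain ⟨t7, τ7, e7, ht7, h7⟩ := exec_arcsProgram hw D arcs (by omega) harcs (σ := τ6) d0
    (by rw [d1, c1, b1, a1]; simp [hσ₀, input]) d2
    (fun j => by rw [hmem 0 (by omega) (by omega) (by omega) (by omega)]; simp [input])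
    (fun j => by rw [hmem 1 (by omega) (by omega) (by omega) (by omega)]; simp [input])
    (fun i hi => by rw [db 2 (by omega), cb 2 (by omega), bb 2 (by omega), aj i hi])
    (fun i hi => by rw [db 3 (by omega), cb 3 (by omega), bj i hi]; ring)
    (fun i hi => by rw [db 4 (by omega), cj i hi]; ring)
    (fun i hi => by rw [dj i hi]; ring)
    (fun a j => by rw [hmem (a + 6) (by omega) (by omega) (by omega) (by omega)]; simp [input])
  have h8 : Represents n 1 (fun _ => 0) (arcTables D) (τ7.setReg 6 0) := by
    have hk : Keeps 0 0 τ7 (τ7.setReg 6 0) :=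
      (Keeps.refl 0 0 τ7).setReg 0 (.inr (.inr (.inr (.inl ⟨0, le_rfl, rfl⟩))))
    -- Variable `0` is the constant `0`, which pads the indices of tables with fewer than five
    -- arguments.
    have := (h7.of_keeps hk).bind hn (i := 0) (by simp)
    rwa [Function.update_eq_self] at this
  obtain ⟨t9, τ9, e9, h9, ht9⟩ := c.exec_compile hn hw 1 _ _ _ hwf h8
  refine ⟨_, _, .cond_true (by simp [input]; omega) (.seq e1 <| .seq e2 <| .seq e3 <| .seq e4 <|
    .seq e5 <| .seq e6 <| .seq e7 <| .seq (.const τ7 6 0 (by omega)) <| .seq e9 <|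
    .seq (.const _ 4 0 (by omega)) (.load _ 0 _ 4)), ?_, ?_, ?_⟩
  · intro h
    have := h9.tab A (0, 0, 0, 0, 0) ⟨hn, hn, hn, hn, hn⟩ ((hQ n D hn hloop).2 h)
    simpa [Key.code] using this
  · intro h
    have := h9.tab' A (0, 0, 0, 0, 0) ⟨hn, hn, hn, hn, hn⟩ fun h' => h ((hQ n D hn hloop).1 h')
    simpa [Key.code] using this
  · intro _
    have q1 : n ^ c.depth ≤ n ^ 8 := Nat.pow_le_pow_right hn hdepth
    have q2 : n ≤ n ^ 8 := Nat.le_self_pow (by omega) n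
    have q3 : 1 ≤ n ^ 7 := Nat.one_le_pow _ _ hn
    have q4 : arcs.length ≤ n ^ 7 * arcs.length := Nat.le_mul_of_pos_left _ q3
    have q5 : c.cost * n ^ c.depth ≤ c.cost * n ^ 8 := Nat.mul_le_mul_left _ q1
    have q6 : (c.cost + 100) * (n ^ 7 * (n + arcs.length)) = c.cost * n ^ 8 +
        c.cost * (n ^ 7 * arcs.length) + 100 * n ^ 8 + 100 * (n ^ 7 * arcs.length) := by ring
    dsimp only
    rw [q6]
    omega

end RAM

/-! ### A loop program for the criterion -/

namespace RAM

/-- Disjunction. -/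
def Fml.or (φ ψ : Fml) : Fml := .not (.and (.not φ) (.not ψ))

section Holds

variable {n : ℕ} {T : Tables} {d : ℕ} {env : ℕ → ℕ}

@[simp] theorem Fml.holds_tab (a : ℕ) (x : Key) :
    (Fml.tab a x).Holds n T d env ↔ T a (x.subst env) := Iff.rfl

@[simp] theorem Fml.holds_eq (x y : ℕ) : (Fml.eq x y).Holds n T d env ↔ env x = env y := Iff.rfl

@[simp] theorem Fml.holds_not (φ : Fml) :
    φ.not.Holds n T d env ↔ ¬ φ.Holds n T d env := Iff.rfl

@[simp] theorem Fml.holds_and (φ ψ : Fml) :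
    (φ.and ψ).Holds n T d env ↔ φ.Holds n T d env ∧ ψ.Holds n T d env := Iff.rfl

@[simp] theorem Fml.holds_or (φ ψ : Fml) :
    (φ.or ψ).Holds n T d env ↔ φ.Holds n T d env ∨ ψ.Holds n T d env := by
  simp only [Fml.or, holds_not, holds_and]; tauto

@[simp] theorem Fml.holds_ex (φ : Fml) :
    φ.ex.Holds n T d env ↔ ∃ i : Fin n, φ.Holds n T (d + 1) (Function.update env d i) :=
  ⟨fun ⟨i, hi, h⟩ => ⟨⟨i, hi⟩, h⟩, fun ⟨i, h⟩ => ⟨i, i.2, h⟩⟩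

end Holds

/-- Every run of the program `c` on tables with the property `J` keeps this property, and brings
the tables into a state with `p`, if they had not been there before, exactly when `q`. -/
def Accumulates (n d : ℕ) (env : ℕ → ℕ) (c : Cmd) (J p : Tables → Prop) (q : Prop) : Prop :=
  ∀ T, J T → J (c.run n d env T) ∧ (p (c.run n d env T) ↔ p T ∨ q)

theorem Accumulates.all {n d : ℕ} {env : ℕ → ℕ} {c : Cmd} {J p : Tables → Prop} {q : Fin n → Prop}
    (h : ∀ i : Fin n, Accumulates n (d + 1) (Function.update env d i) c J p (q i)) :
    Accumulates n d env (.all c) J p (∃ i, q i) := by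
  intro T hT
  have key : ∀ m ≤ n, ∀ T', T' = (List.range m).foldl
      (fun T i => c.run n (d + 1) (Function.update env d i) T) T →
      J T' ∧ (p T' ↔ p T ∨ ∃ i : Fin n, i.1 < m ∧ q i) := by
    intro m
    induction m with
    | zero => rintro - _ rfl; simpa using hT
    | succ m ih =>
      rintro hm _ rfl
      rw [List.range_succ, List.foldl_append]
      obtain ⟨h1, h2⟩ := ih (by omega) _ rfl
      obtain ⟨h3, h4⟩ := h ⟨m, hm⟩ _ h1
      refine ⟨h3, h4.trans ?_⟩
      rw [h2, or_assoc]
      refine or_congr_right ⟨?_, ?_⟩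
      · rintro (⟨i, hi, hq⟩ | hq)
        · exact ⟨i, by omega, hq⟩
        · exact ⟨⟨m, hm⟩, by simp, hq⟩
      · rintro ⟨i, hi, hq⟩
        rcases Nat.lt_succ_iff_lt_or_eq.1 hi with hi | rfl
        · exact .inl ⟨i, hi, hq⟩
        · exact .inr hq
  simpa [Cmd.run] using key n le_rfl _ rfl

/-- The tables `T'` arise from `T` when some cells are given their values in `G`. -/
def Tables.Toward (G T T' : Tables) : Prop := ∀ a x, T' a x = T a x ∨ T' a x = G a x

theorem Tables.Toward.refl (G T : Tables) : G.Toward T T := fun _ _ => .inl rfl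

theorem Tables.Toward.trans {G T T' T'' : Tables} (h : G.Toward T T') (h' : G.Toward T' T'') :
    G.Toward T T'' := fun a x => by
  rcases h' a x with e | e
  · rw [e]; exact h a x
  · exact .inr e

/-- On its way from `T` to `G`, the program `c` gives the cells of `K` their values in `G`. -/
def Fills (n d : ℕ) (env : ℕ → ℕ) (c : Cmd) (T G : Tables) (K : ℕ → Key → Prop) : Prop :=
  ∀ T', G.Toward T T' → G.Toward T' (c.run n d env T') ∧ ∀ a x, K a x → c.run n d env T' a x = G a x

/-- Programs that overwrite a table in place need no order of evaluation as long as every cell has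
either its old or its final value; `Toward` is this invariant, and a cell once filled cannot change
again. -/
theorem Fills.all {n d : ℕ} {env : ℕ → ℕ} {c : Cmd} {T G : Tables} {K : Fin n → ℕ → Key → Prop}
    (h : ∀ i : Fin n, Fills n (d + 1) (Function.update env d i) c T G (K i)) :
    Fills n d env (.all c) T G (fun a x => ∃ i, K i a x) := by
  intro T₀ hT₀
  have key : ∀ m ≤ n, ∀ T', T' = (List.range m).foldl
      (fun T i => c.run n (d + 1) (Function.update env d i) T) T₀ →
      G.Toward T₀ T' ∧ ∀ i : Fin n, i.1 < m → ∀ a x, K i a x → T' a x = G a x := by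
    intro m
    induction m with
    | zero => rintro - _ rfl; exact ⟨.refl _ _, by simp⟩
    | succ m ih =>
      rintro hm _ rfl
      rw [List.range_succ, List.foldl_append]
      obtain ⟨h1, h2⟩ := ih (by omega) _ rfl
      obtain ⟨h3, h4⟩ := h ⟨m, hm⟩ _ (hT₀.trans h1)
      refine ⟨h1.trans h3, fun i hi a x hk => ?_⟩
      rcases Nat.lt_succ_iff_lt_or_eq.1 hi with hi | rfl
      · rcases h3 a x with e | e
        · exact e.trans (h2 i hi a x hk)
        · exact e
      · exact h4 a x hk
  obtain ⟨h1, h2⟩ := key n le_rfl _ rfl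
  exact ⟨h1, fun a x ⟨i, hk⟩ => h2 i i.2 a x hk⟩

theorem Fills.put {n d : ℕ} {env : ℕ → ℕ} {a : ℕ} {x : Key} {φ : Fml} {T G : Tables}
    (h : ∀ T', G.Toward T T' → (φ.Holds n T' d env ↔ G a (x.subst env))) :
    Fills n d env (.put a x φ) T G (fun b y => b = a ∧ y = x.subst env) := by
  intro T' hT'
  have e := propext (h T' hT')
  refine ⟨fun b y => ?_, ?_⟩
  · by_cases hb : b = a
    · subst hb
      by_cases hy : y = x.subst env
      · subst hy; right; simp [Cmd.run, Tables.set, e]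
      · left; simp [Cmd.run, Tables.set, hy]
    · left; simp [Cmd.run, Tables.set, hb]
  · rintro _ _ ⟨rfl, rfl⟩
    simp [Cmd.run, Tables.set, e]

theorem Fills.run_eq {n d : ℕ} {env : ℕ → ℕ} {c : Cmd} {T G : Tables} {K : ℕ → Key → Prop}
    (h : Fills n d env c T G K) (hK : ∀ a x, ¬ K a x → G a x = T a x) : c.run n d env T = G := by
  obtain ⟨h1, h2⟩ := h T (.refl _ _)
  funext a x
  by_cases hk : K a x
  · exact h2 a x hk
  · rcases h1 a x with e | e
    · rw [e, hK a x hk]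
    · exact e

/-- Replace the part of table `a` with the indices `(x, y, z, i, j)`, for all `i` and `j`. -/
def Tables.setBlock {n : ℕ} (T : Tables) (a x y z : ℕ) (r : Fin n → Fin n → Prop) : Tables :=
  fun b k => (b = a ∧ ∃ i j : Fin n, k = (x, y, z, i.1, j.1) ∧ r i j) ∨
    (¬ (b = a ∧ ∃ i j : Fin n, k = (x, y, z, i.1, j.1)) ∧ T b k)

section setBlock

variable {n : ℕ} (T : Tables) {a x y z : ℕ} {r : Fin n → Fin n → Prop}

theorem Tables.setBlock_self (i j : Fin n) :
    T.setBlock a x y z r a (x, y, z, i.1, j.1) = r i j := by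
  refine propext ?_
  unfold setBlock
  constructor
  · rintro (⟨-, i', j', h, hr⟩ | ⟨h, -⟩)
    · simp only [Prod.mk.injEq, true_and, Fin.val_inj] at h
      rwa [h.1, h.2]
    · exact absurd ⟨rfl, i, j, rfl⟩ h
  · exact fun h => .inl ⟨rfl, i, j, rfl, h⟩

theorem Tables.setBlock_of_ne {b : ℕ} {k : Key}
    (h : ¬ (b = a ∧ ∃ i j : Fin n, k = (x, y, z, i.1, j.1))) :
    T.setBlock a x y z r b k = T b k := by
  refine propext ?_
  unfold setBlock
  constructor
  · rintro (⟨rfl, i, j, e, -⟩ | ⟨-, hk⟩)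
    · exact absurd ⟨rfl, i, j, e⟩ h
    · exact hk
  · exact fun hk => .inr ⟨h, hk⟩

theorem Tables.setBlock_of_table_ne {b : ℕ} (h : b ≠ a) : T.setBlock a x y z r b = T b :=
  funext fun _ => T.setBlock_of_ne fun h' => h h'.1

theorem Tables.setBlock_setBlock {r' : Fin n → Fin n → Prop} :
    (T.setBlock a x y z r).setBlock a x y z r' = T.setBlock a x y z r' := by
  funext b k
  by_cases h : b = a ∧ ∃ i j : Fin n, k = (x, y, z, i.1, j.1)
  · obtain ⟨rfl, i, j, rfl⟩ := h
    rw [setBlock_self, setBlock_self]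
  · rw [setBlock_of_ne _ h, setBlock_of_ne _ h, setBlock_of_ne _ h]

end setBlock

/-- Compute a block of a table cell by cell. The formula may refer to the block itself, if its
value is the same for the old and for the new contents of the cells. -/
theorem run_all_all_put {n d : ℕ} {env : ℕ → ℕ} {a x y z : ℕ} {φ : Fml} {T : Tables}
    {r : Fin n → Fin n → Prop} (hx : x < d) (hy : y < d) (hz : z < d)
    (h : ∀ T' : Tables, (∀ b ≠ a, T' b = T b) →
      (∀ i j : Fin n, T' a (env x, env y, env z, i.1, j.1) = T a (env x, env y, env z, i.1, j.1) ∨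
        T' a (env x, env y, env z, i.1, j.1) = r i j) →
      ∀ i j : Fin n, φ.Holds n T' (d + 2) (Function.update (Function.update env d i) (d + 1) j) ↔
        r i j) :
    (Cmd.all (.all (.put a (x, y, z, d, d + 1) φ))).run n d env T =
      T.setBlock a (env x) (env y) (env z) r := by
  have hk : ∀ i j : Fin n, Key.subst (Function.update (Function.update env d i) (d + 1) j)
      (x, y, z, d, d + 1) = (env x, env y, env z, i.1, j.1) := by
    intro i j
    have h1 : x ≠ d ∧ x ≠ d + 1 := by omega
    have h2 : y ≠ d ∧ y ≠ d + 1 := by omega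
    have h3 : z ≠ d ∧ z ≠ d + 1 := by omega
    simp [Key.subst, Function.update_of_ne, h1, h2, h3]
  refine Fills.run_eq (Fills.all fun i => Fills.all fun j => Fills.put fun T' hT' => ?_) ?_
  · rw [hk, Tables.setBlock_self]
    refine h T' (fun b hb => funext fun k => ?_) (fun i j => ?_) i j
    · simpa [Tables.setBlock_of_table_ne T hb] using hT' b k
    · simpa [Tables.setBlock_self] using hT' a (env x, env y, env z, i.1, j.1)
  · intro b k hbk
    refine Tables.setBlock_of_ne _ ?_
    rintro ⟨rfl, i, j, rfl⟩
    exact hbk ⟨i, j, rfl, (hk i j).symm⟩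

/-- The formula does not mention the table `a`. -/
def Fml.Avoids (a : ℕ) : Fml → Prop
  | tab b _ => b ≠ a
  | eq _ _ => True
  | not φ => φ.Avoids a
  | and φ ψ => φ.Avoids a ∧ ψ.Avoids a
  | ex φ => φ.Avoids a

theorem Fml.Avoids.holds_iff {n a : ℕ} {T T' : Tables} (hT : ∀ b ≠ a, T' b = T b) {φ : Fml}
    (h : φ.Avoids a) : ∀ (d : ℕ) (env : ℕ → ℕ), φ.Holds n T' d env ↔ φ.Holds n T d env := by
  induction φ with
  | tab b x => intro d env; simp [hT b h]
  | eq x y => intro d env; rfl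
  | not φ ih => intro d env; simp [ih h d env]
  | and φ ψ ih ih' => intro d env; simp [ih h.1 d env, ih' h.2 d env]
  | ex φ ih => intro d env; simp [ih h]

theorem run_all_all_put_of_avoids {n d : ℕ} {env : ℕ → ℕ} {a x y z : ℕ} {φ : Fml} (T : Tables)
    (hx : x < d) (hy : y < d) (hz : z < d) (h : φ.Avoids a) :
    (Cmd.all (.all (.put a (x, y, z, d, d + 1) φ))).run n d env T =
      T.setBlock a (env x) (env y) (env z) fun i j : Fin n =>
        φ.Holds n T (d + 2) (Function.update (Function.update env d i) (d + 1) j) :=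
  run_all_all_put hx hy hz fun _ hT _ _ _ => h.holds_iff hT _ _

/-- One round of Warshall's algorithm. -/
def pivot {α : Type*} (r : α → α → Prop) (k : α) (i j : α) : Prop := r i j ∨ r i k ∧ r k j

/-- Warshall's algorithm, for a block of a table. -/
def closureCmd (a x y z d : ℕ) : Cmd :=
  .all <| .all <| .all <| .put a (x, y, z, d + 1, d + 2) <|
    .or (.tab a (x, y, z, d + 1, d + 2))
      (.and (.tab a (x, y, z, d + 1, d)) (.tab a (x, y, z, d, d + 2)))

/-- A round may be done in place because row `k` and column `k` do not change: `pivot r k i k` is `r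
i k`, and `pivot r k k j` is `r k j`. -/
theorem run_pivot {n d : ℕ} {env : ℕ → ℕ} {a x y z : ℕ} {T : Tables} (r : Fin n → Fin n → Prop)
    (hx : x < d) (hy : y < d) (hz : z < d) (k : Fin n) :
    (Cmd.all (.all (.put a (x, y, z, d + 1, d + 2) (.or (.tab a (x, y, z, d + 1, d + 2))
      (.and (.tab a (x, y, z, d + 1, d)) (.tab a (x, y, z, d, d + 2))))))).run n (d + 1)
      (Function.update env d k) (T.setBlock a (env x) (env y) (env z) r) =
    T.setBlock a (env x) (env y) (env z) (pivot r k) := by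
  have h1 : x ≠ d ∧ x ≠ d + 1 ∧ x ≠ d + 2 := by omega
  have h2 : y ≠ d ∧ y ≠ d + 1 ∧ y ≠ d + 2 := by omega
  have h3 : z ≠ d ∧ z ≠ d + 1 ∧ z ≠ d + 2 := by omega
  have e1 : Function.update env d k.1 x = env x := by simp [h1]
  have e2 : Function.update env d k.1 y = env y := by simp [h2]
  have e3 : Function.update env d k.1 z = env z := by simp [h3]
  refine (run_all_all_put (r := pivot r k) (by omega) (by omega) (by omega) ?_).trans ?_
  · intro T' hT hT' i j
    simp only [e1, e2, e3, Tables.setBlock_self] at hT'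
    have key : ∀ i j, T' a (env x, env y, env z, i.1, j.1) = r i j ∨
        T' a (env x, env y, env z, i.1, j.1) = pivot r k i j := hT'
    have hik : T' a (env x, env y, env z, i.1, k.1) = r i k := by
      refine (key i k).elim id fun h => h.trans (propext ?_)
      unfold pivot; tauto
    have hkj : T' a (env x, env y, env z, k.1, j.1) = r k j := by
      refine (key k j).elim id fun h => h.trans (propext ?_)
      unfold pivot; tauto
    simp only [Fml.holds_or, Fml.holds_and, Fml.holds_tab, Key.subst]
    simp only [Function.update_apply, h1, h2, h3]
    have h4 : d ≠ d + 1 + 1 := by omega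
    simp [hik, hkj, h4]
    rcases key i j with e | e <;> rw [e] <;> unfold pivot <;> tauto
  · rw [e1, e2, e3, Tables.setBlock_setBlock]

theorem run_closureCmd {n d : ℕ} {env : ℕ → ℕ} {a x y z : ℕ} (T : Tables)
    (r : Fin n → Fin n → Prop) (hx : x < d) (hy : y < d) (hz : z < d) :
    (closureCmd a x y z d).run n d env (T.setBlock a (env x) (env y) (env z) r) =
      T.setBlock a (env x) (env y) (env z) (Relation.TransGen r) := by
  -- After `m` rounds the relation lies between `r` and its closure, and is transitive through all
  -- middle vertices below `m`.
  have key : ∀ m ≤ n, ∃ r' : Fin n → Fin n → Prop,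
      (List.range m).foldl (fun T k => (Cmd.all (.all (.put a (x, y, z, d + 1, d + 2)
        (.or (.tab a (x, y, z, d + 1, d + 2)) (.and (.tab a (x, y, z, d + 1, d))
          (.tab a (x, y, z, d, d + 2))))))).run n (d + 1) (Function.update env d k) T)
        (T.setBlock a (env x) (env y) (env z) r) = T.setBlock a (env x) (env y) (env z) r' ∧
      (∀ i j, r i j → r' i j) ∧ (∀ i j, r' i j → Relation.TransGen r i j) ∧
      ∀ k : Fin n, k.1 < m → ∀ i j, r' i k → r' k j → r' i j := by
    intro m
    induction m with
    | zero => exact fun _ => ⟨r, rfl, fun _ _ => id, fun _ _ => .single, by simp⟩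
    | succ m ih =>
      intro hm
      obtain ⟨r', e, h1, h2, h3⟩ := ih (by omega)
      refine ⟨pivot r' ⟨m, hm⟩, ?_, fun i j h => .inl (h1 i j h), ?_, ?_⟩
      · rw [List.range_succ, List.foldl_append, e]
        exact run_pivot r' hx hy hz ⟨m, hm⟩
      · rintro i j (h | ⟨h, h'⟩)
        · exact h2 i j h
        · exact (h2 _ _ h).trans (h2 _ _ h')
      · intro k hk i j hik hkj
        rcases Nat.lt_succ_iff_lt_or_eq.1 hk with hk | hk
        · have := h3 k hk
          unfold pivot at *
          grind
        · obtain rfl : k = ⟨m, hm⟩ := Fin.ext hk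
          unfold pivot at *
          tauto
  obtain ⟨r', e, h1, h2, h3⟩ := key n le_rfl
  refine e.trans (congrArg _ (funext fun i => funext fun j => propext ⟨h2 i j, fun h => ?_⟩))
  induction h with
  | single h => exact h1 _ _ h
  | tail _ h ih => exact h3 _ (Fin.is_lt _) _ _ ih (h1 _ _ h)

end RAM

/-! ### Reachability after the deletion of three vertices -/

namespace RAM

/-- Equality is allowed as a step so that the transitive closure contains the walks of length zero,
but only at vertices of `X`. -/
theorem transGen_iff_conn {V : Type*} (A : V → V → Prop) (X : Set V) (s t : V) :
    Relation.TransGen (fun a b => (a ∈ X ∧ b ∈ X) ∧ (a = b ∨ A a b)) s t ↔ Conn A X s t := by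
  constructor
  · intro h
    induction h with
    | single h =>
      obtain ⟨⟨h1, h2⟩, rfl | h⟩ := h
      · exact .refl h1
      · exact (Conn.refl h1).snoc h h2
    | tail _ h ih =>
      obtain ⟨⟨h1, h2⟩, rfl | h⟩ := h
      · exact ih
      · exact ih.snoc h h2
  · rintro ⟨hs, h⟩
    have : Relation.TransGen (fun a b => (a ∈ X ∧ b ∈ X) ∧ (a = b ∨ A a b)) s t ∧ t ∈ X := by
      induction h with
      | refl => exact ⟨.single ⟨⟨hs, hs⟩, .inl rfl⟩, hs⟩
      | tail _ h ih => exact ⟨ih.1.tail ⟨⟨ih.2, h.2⟩, .inr h.1⟩, h.2⟩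
    exact this.1

/-- Variables `4` and `5` are equal or joined by an arc, and avoid variables `1`, `2` and `3`. -/
def stepFml : Fml :=
  .and (.and (.and (.and (.not (.eq 4 1)) (.not (.eq 4 2))) (.not (.eq 4 3)))
      (.and (.and (.not (.eq 5 1)) (.not (.eq 5 2))) (.not (.eq 5 3))))
    (.or (.eq 4 5) (.tab 0 (0, 0, 0, 4, 5)))

/-- Tabulate reachability after the deletion of any three vertices. -/
def reachCmd : Cmd :=
  .all <| .all <| .all <| .seq (.all (.all (.put 1 (1, 2, 3, 4, 5) stepFml))) (closureCmd 1 1 2 3 4)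

/-- Table `0` holds the arcs of `D`, and table `1` reachability after the deletion of three
vertices. -/
structure Ready {n : ℕ} (D : Digraph (Fin n)) (T : Tables) : Prop where
  arc : ∀ u v : Fin n, T 0 (0, 0, 0, u.1, v.1) ↔ D.Adj u v
  reach : ∀ v x y i j : Fin n, T 1 (v.1, x.1, y.1, i.1, j.1) ↔ Conn D.Adj {v, x, y}ᶜ i j

/-- The tables after the computation of reachability. -/
def reachTables {n : ℕ} (D : Digraph (Fin n)) : Tables := fun b k =>
  (b = 1 ∧ ∃ v x y i j : Fin n,
    k = (v.1, x.1, y.1, i.1, j.1) ∧ Conn D.Adj {v, x, y}ᶜ i j) ∨ arcTables D b k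

theorem ready_reachTables {n : ℕ} (D : Digraph (Fin n)) : Ready D (reachTables D) where
  arc u v := by
    simp only [reachTables, arcTables, Prod.mk.injEq, true_and, Fin.val_inj]
    constructor
    · rintro (⟨h, -⟩ | ⟨u', v', h, rfl, rfl⟩)
      · omega
      · exact h
    · exact fun h => .inr ⟨u, v, h, rfl, rfl⟩
  reach v x y i j := by
    simp only [reachTables, arcTables, Prod.mk.injEq, true_and, Fin.val_inj]
    constructor
    · rintro (⟨v', x', y', i', j', ⟨rfl, rfl, rfl, rfl, rfl⟩, h⟩ | ⟨h, -⟩)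
      · exact h
      · omega
    · exact fun h => .inl ⟨v, x, y, i, j, ⟨rfl, rfl, rfl, rfl, rfl⟩, h⟩

theorem run_reach_block {n : ℕ} {D : Digraph (Fin n)} {T : Tables} (hT : T 0 = arcTables D 0)
    {env : ℕ → ℕ} {v x y : Fin n} (h0 : env 0 = 0) (hv : env 1 = v) (hx : env 2 = x)
    (hy : env 3 = y) :
    (Cmd.seq (.all (.all (.put 1 (1, 2, 3, 4, 5) stepFml))) (closureCmd 1 1 2 3 4)).run n 4 env T =
      T.setBlock 1 v x y (Conn D.Adj {v, x, y}ᶜ) := by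
  have h1 := run_all_all_put_of_avoids (n := n) (d := 4) (a := 1) (x := 1) (y := 2) (z := 3)
    (env := env) (φ := stepFml) T (by omega) (by omega) (by omega)
    (by simp [stepFml, Fml.Avoids, Fml.or])
  refine (congrArg _ h1).trans
    ((run_closureCmd T _ (by omega) (by omega) (by omega)).trans ?_)
  rw [hv, hx, hy]
  congr 1
  funext s t
  rw [← transGen_iff_conn]
  congr 1
  funext i j
  simp [stepFml, Key.subst, h0, hv, hx, hy, hT, arcTables, Fin.val_inj, and_assoc]

theorem run_reachCmd {n : ℕ} (D : Digraph (Fin n)) :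
    reachCmd.run n 1 (fun _ => 0) (arcTables D) = reachTables D := by
  refine Fills.run_eq (K := fun b k => ∃ v x y : Fin n, b = 1 ∧
    ∃ i j : Fin n, k = (v.1, x.1, y.1, i.1, j.1)) ?_ ?_
  · refine Fills.all fun v => Fills.all fun x => Fills.all fun y => fun T hT => ?_
    have h0 : T 0 = arcTables D 0 := by
      funext k
      rcases hT 0 k with e | e
      · exact e
      · simpa [reachTables] using e
    have e := run_reach_block h0 (v := v) (x := x) (y := y)
      (env := Function.update (Function.update (Function.update (fun _ => 0) 1 v.1) 2 x) 3 y)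
      (by simp) (by simp) (by simp) (by simp)
    have e' : ∀ i j : Fin n, reachTables D 1 (v.1, x.1, y.1, i.1, j.1) =
        Conn D.Adj {v, x, y}ᶜ i j := fun i j => propext ((ready_reachTables D).reach v x y i j)
    refine ⟨fun b k => ?_, ?_⟩
    · refine (congrFun (congrFun e b) k).symm ▸ ?_
      by_cases h : b = 1 ∧ ∃ i j : Fin n, k = (v.1, x.1, y.1, i.1, j.1)
      · obtain ⟨rfl, i, j, rfl⟩ := h
        right
        rw [Tables.setBlock_self, e']
      · exact .inl (Tables.setBlock_of_ne _ h)
    · rintro b k ⟨rfl, i, j, rfl⟩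
      refine (congrFun (congrFun e _) _).trans ?_
      rw [Tables.setBlock_self, e']
  · intro b k h
    refine propext ⟨?_, .inr⟩
    rintro (⟨rfl, v, x, y, i, j, rfl, -⟩ | h')
    · exact absurd ⟨v, x, y, rfl, i, j, rfl⟩ h
    · exact h'

end RAM

/-! ### The criterion as a loop program -/

namespace RAM

/-- The pair of variables `x` and `y` separates variables `2`, `3` from variables `4`, `5`. -/
def cutFml (x y : ℕ) : Fml :=
  .and (.and (.not (.tab 1 (1, x, y, 2, 4))) (.not (.tab 1 (1, x, y, 2, 5))))
    (.and (.not (.tab 1 (1, x, y, 3, 4))) (.not (.tab 1 (1, x, y, 3, 5))))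

/-- The variable `x` lies on a path between variables `2`, `3` and variables `4`, `5`. -/
def usefulFml (x : ℕ) : Fml :=
  .and (.or (.tab 1 (1, 1, 1, 2, x)) (.tab 1 (1, 1, 1, 3, x)))
    (.or (.tab 1 (1, 1, 1, x, 4)) (.tab 1 (1, 1, 1, x, 5)))

/-- The link relation between variables `6` and `7`. -/
def linkFml : Fml :=
  .and (.and (usefulFml 6) (usefulFml 7)) <|
    .and (.or (.tab 0 (0, 0, 0, 6, 7)) (.tab 0 (0, 0, 0, 7, 6)))
      (.not (.and (.ex (cutFml 6 8)) (.ex (cutFml 7 8))))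

/-- The partner relation between variables `6` and `7`. -/
def partnerFml : Fml := .ex (.and (cutFml 6 8) (cutFml 7 8))

/-- The criterion for a shunt from variables `2`, `3` to variables `4`, `5` in the digraph without
variable `1`, where tables `2` and `3` hold the closures of the link and partner relations. -/
def shuntFml : Fml :=
  .and (.and (.and (.not (.eq 2 3)) (.not (.eq 4 5)))
      (.and (.and (.tab 0 (0, 0, 0, 1, 2)) (.tab 0 (0, 0, 0, 1, 3)))
        (.and (.tab 0 (0, 0, 0, 4, 1)) (.tab 0 (0, 0, 0, 5, 1))))) <|
    .and (.not (.ex (cutFml 6 6))) <| .ex <| .ex <|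
      .and (.and (.ex (cutFml 6 8)) (.ex (cutFml 7 8))) <|
        .and (.tab 2 (0, 0, 0, 6, 7)) (.not (.tab 3 (0, 0, 0, 6, 7)))

/-- Add the result for given values of variables `1` to `5` to the answer in table `4`. -/
def shuntCmd : Cmd :=
  .seq (.all (.all (.put 2 (0, 0, 0, 6, 7) linkFml))) <| .seq (closureCmd 2 0 0 0 6) <|
  .seq (.all (.all (.put 3 (0, 0, 0, 6, 7) partnerFml))) <| .seq (closureCmd 3 0 0 0 6) <|
  .put 4 (0, 0, 0, 0, 0) (.or (.tab 4 (0, 0, 0, 0, 0)) shuntFml)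

/-- The program that looks for a subdivision of `E₉`. -/
def subdivisionCmd : Cmd := .seq reachCmd (.all (.all (.all (.all (.all shuntCmd)))))

theorem wf_subdivisionCmd : subdivisionCmd.WF 1 := by
  simp [subdivisionCmd, reachCmd, shuntCmd, closureCmd, stepFml, linkFml, partnerFml, shuntFml,
    cutFml, usefulFml, Fml.or, Cmd.WF, Fml.WF, Key.Lt]

/-- Five loops choose `v`, `S` and `T`, and three more levels are needed for the closures, or for
two variables and one quantifier. Reachability takes only six levels. -/
theorem depth_subdivisionCmd : subdivisionCmd.depth ≤ 8 := by decide

/-- The values of the variables `1` to `5`. -/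
structure Values {n : ℕ} (env : ℕ → ℕ) (v s₁ s₂ t₁ t₂ : Fin n) : Prop where
  zero : env 0 = 0
  one : env 1 = v
  two : env 2 = s₁
  three : env 3 = s₂
  four : env 4 = t₁
  five : env 5 = t₂

theorem Values.update {n : ℕ} {env : ℕ → ℕ} {v s₁ s₂ t₁ t₂ : Fin n}
    (h : Values env v s₁ s₂ t₁ t₂) {d : ℕ} (hd : 6 ≤ d) (i : ℕ) :
    Values (Function.update env d i) v s₁ s₂ t₁ t₂ := by
  constructor <;> rw [Function.update_of_ne (by omega)]
  exacts [h.zero, h.one, h.two, h.three, h.four, h.five]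

section Semantics

variable {n : ℕ} {D : Digraph (Fin n)} {T : Tables} {env : ℕ → ℕ} {v s₁ s₂ t₁ t₂ : Fin n} {d : ℕ}

/-- The arcs of `D` that do not enter `v`. -/
abbrev avoiding (D : Digraph (Fin n)) (v : Fin n) (a b : Fin n) : Prop :=
  D.Adj a b ∧ b ∈ ({v}ᶜ : Set (Fin n))

theorem conn_avoiding {X : Set (Fin n)} {s t : Fin n} (hs : s ≠ v) :
    Conn (avoiding D v) X s t ↔ Conn D.Adj ({v}ᶜ ∩ X) s t := by
  constructor
  · rintro ⟨h, h'⟩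
    exact ⟨⟨hs, h⟩, Relation.ReflTransGen.mono (fun _ _ hab => ⟨hab.1.1, hab.1.2, hab.2⟩) _ _ h'⟩
  · rintro ⟨h, h'⟩
    exact ⟨h.2, Relation.ReflTransGen.mono (fun _ _ hab => ⟨⟨hab.1, hab.2.1⟩, hab.2.2⟩) _ _ h'⟩

theorem conn_avoiding_pair {x y s t : Fin n} (hs : s ≠ v) :
    Conn (avoiding D v) {x, y}ᶜ s t ↔ Conn D.Adj {v, x, y}ᶜ s t := by
  rw [conn_avoiding hs]
  have : ({v, x, y}ᶜ : Set (Fin n)) = {v}ᶜ ∩ {x, y}ᶜ := by ext; simp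
  rw [this]

/-- Repeating `v` in the index of the table means that `v` alone is deleted. -/
theorem conn_avoiding_univ {s t : Fin n} (hs : s ≠ v) :
    Conn (avoiding D v) Set.univ s t ↔ Conn D.Adj {v, v, v}ᶜ s t := by
  rw [conn_avoiding hs]; simp

theorem holds_cutFml (hT : Ready D T) (hv : Values env v s₁ s₂ t₁ t₂) (h₁ : s₁ ≠ v) (h₂ : s₂ ≠ v)
    {x y : ℕ} {a b : Fin n} (hx : env x = a) (hy : env y = b) :
    (cutFml x y).Holds n T d env ↔ Cut (avoiding D v) {s₁, s₂} {t₁, t₂} a b := by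
  simp [cutFml, Key.subst, hv.one, hv.two, hv.three, hv.four, hv.five, hx, hy, hT.reach, Cut,
    conn_avoiding_pair h₁, conn_avoiding_pair h₂]

theorem holds_onCut (hT : Ready D T) (hv : Values env v s₁ s₂ t₁ t₂) (h₁ : s₁ ≠ v) (h₂ : s₂ ≠ v)
    {x : ℕ} {a : Fin n} (hx : env x = a) (hd : 6 ≤ d) (hxd : x < d) :
    (Fml.ex (cutFml x d)).Holds n T d env ↔ OnCut (avoiding D v) {s₁, s₂} {t₁, t₂} a := by
  rw [Fml.holds_ex]
  refine exists_congr fun i => ?_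
  rw [holds_cutFml hT (hv.update hd i) h₁ h₂ (a := a) (b := i) (by simp [hxd.ne, hx]) (by simp)]

theorem holds_usefulFml (hT : Ready D T) (hv : Values env v s₁ s₂ t₁ t₂) (h₁ : s₁ ≠ v)
    (h₂ : s₂ ≠ v) {x : ℕ} {a : Fin n} (hx : env x = a) :
    (usefulFml x).Holds n T d env ↔ Useful (avoiding D v) {s₁, s₂} {t₁, t₂} a ∧ a ≠ v := by
  have key : (usefulFml x).Holds n T d env ↔
      (Conn D.Adj {v, v, v}ᶜ s₁ a ∨ Conn D.Adj {v, v, v}ᶜ s₂ a) ∧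
      (Conn D.Adj {v, v, v}ᶜ a t₁ ∨ Conn D.Adj {v, v, v}ᶜ a t₂) := by
    simp only [usefulFml, Fml.holds_and, Fml.holds_or, Fml.holds_tab, Key.subst, hv.one, hv.two,
      hv.three, hv.four, hv.five, hx, hT.reach]
  rw [key]
  by_cases ha : a = v
  · simp only [ha, ne_eq, not_true_eq_false, and_false, iff_false, not_and]
    rintro - (h | h) <;> simpa using h.left_mem
  · simp [Useful, conn_avoiding_univ h₁, conn_avoiding_univ h₂, conn_avoiding_univ ha, ha]

/-- No arc of `avoiding D v` enters `v`, so a walk from another vertex never reaches it. This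
reconciles the table, which excludes `v`, with `Useful`. -/
theorem Useful.ne_of_ne (h₁ : s₁ ≠ v) (h₂ : s₂ ≠ v) {T : Set (Fin n)} {a : Fin n}
    (h : Useful (avoiding D v) {s₁, s₂} T a) : a ≠ v := by
  obtain ⟨⟨s, hs, -, h⟩, -⟩ := h
  have hsv : s ≠ v := by rcases hs with rfl | rfl <;> assumption
  rcases Relation.ReflTransGen.cases_tail h with rfl | ⟨c, -, h⟩
  · exact hsv
  · exact h.1.2

theorem holds_linkFml (hT : Ready D T) (hv : Values env v s₁ s₂ t₁ t₂) (h₁ : s₁ ≠ v)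
    (h₂ : s₂ ≠ v) {i j : Fin n} (hi : env 6 = i) (hj : env 7 = j) :
    linkFml.Holds n T 8 env ↔ Link (avoiding D v) {s₁, s₂} {t₁, t₂} i j := by
  simp only [linkFml, Fml.holds_and, Fml.holds_or, Fml.holds_not, holds_usefulFml hT hv h₁ h₂ hi,
    holds_usefulFml hT hv h₁ h₂ hj, holds_onCut hT hv h₁ h₂ hi (by omega : 6 ≤ 8) (by omega),
    holds_onCut hT hv h₁ h₂ hj (by omega : 6 ≤ 8) (by omega), Fml.holds_tab, Key.subst, hv.zero,
    hi, hj, hT.arc, Link]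
  constructor
  · rintro ⟨⟨⟨h, h'⟩, h'', h'''⟩, ha, hc⟩
    exact ⟨h, h'', ha.imp (fun h => ⟨h, h'''⟩) (fun h => ⟨h, h'⟩), hc⟩
  · rintro ⟨h, h', ha, hc⟩
    exact ⟨⟨⟨h, Useful.ne_of_ne h₁ h₂ h⟩, h', Useful.ne_of_ne h₁ h₂ h'⟩, ha.imp And.left And.left, hc⟩

theorem holds_partnerFml (hT : Ready D T) (hv : Values env v s₁ s₂ t₁ t₂) (h₁ : s₁ ≠ v)
    (h₂ : s₂ ≠ v) {i j : Fin n} (hi : env 6 = i) (hj : env 7 = j) :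
    partnerFml.Holds n T 8 env ↔ Partner (avoiding D v) {s₁, s₂} {t₁, t₂} i j := by
  rw [partnerFml, Fml.holds_ex]
  refine exists_congr fun z => ?_
  rw [Fml.holds_and, holds_cutFml hT (hv.update (by omega) z) h₁ h₂ (a := i) (b := z) (by simp [hi])
    (by simp), holds_cutFml hT (hv.update (by omega) z) h₁ h₂ (a := j) (b := z) (by simp [hj])
    (by simp)]

theorem holds_shuntFml (hD : ∀ v, ¬ D.Adj v v) (hT : Ready D T) (hv : Values env v s₁ s₂ t₁ t₂)
    (hlink : s₁ ≠ v → s₂ ≠ v → ∀ i j : Fin n, T 2 (0, 0, 0, i.1, j.1) ↔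
      Relation.TransGen (Link (avoiding D v) {s₁, s₂} {t₁, t₂}) i j)
    (hpart : s₁ ≠ v → s₂ ≠ v → ∀ i j : Fin n, T 3 (0, 0, 0, i.1, j.1) ↔
      Relation.TransGen (Partner (avoiding D v) {s₁, s₂} {t₁, t₂}) i j) :
    shuntFml.Holds n T 6 env ↔ (s₁ ≠ s₂ ∧ t₁ ≠ t₂ ∧ D.Adj v s₁ ∧ D.Adj v s₂ ∧ D.Adj t₁ v ∧
      D.Adj t₂ v) ∧ SetShunt (avoiding D v) {s₁, s₂} {t₁, t₂} := by
  rw [shuntFml, Fml.holds_and]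
  refine Iff.trans (and_congr_left' (b := s₁ ≠ s₂ ∧ t₁ ≠ t₂ ∧ D.Adj v s₁ ∧ D.Adj v s₂ ∧ D.Adj t₁ v ∧
      D.Adj t₂ v) ?_) (and_congr_right fun h => ?_)
  · simp [Key.subst, hv.zero, hv.one, hv.two, hv.three, hv.four, hv.five, hT.arc, Fin.val_inj,
      and_assoc]
  · have h₁ : s₁ ≠ v := by rintro rfl; exact hD _ h.2.2.1
    have h₂ : s₂ ≠ v := by rintro rfl; exact hD _ h.2.2.2.1
    rw [setShunt_iff rfl rfl, Fml.holds_and, Fml.holds_not, Fml.holds_ex, not_exists]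
    refine and_congr (forall_congr' fun x => not_congr ?_) ?_
    · exact holds_cutFml hT (hv.update le_rfl x) h₁ h₂ (by simp) (by simp)
    · rw [Fml.holds_ex]
      refine exists_congr fun u => ?_
      rw [Fml.holds_ex]
      refine exists_congr fun u' => ?_
      have hv' := (hv.update le_rfl u).update (by omega : 6 ≤ 7) u'
      rw [Fml.holds_and, Fml.holds_and, holds_onCut hT hv' h₁ h₂ (a := u) (by simp) (by omega)
        (by omega), holds_onCut hT hv' h₁ h₂ (a := u') (by simp) (by omega) (by omega)]
      simp [Key.subst, hv.zero, hlink h₁ h₂, hpart h₁ h₂, and_assoc]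

end Semantics

theorem Ready.setBlock {n : ℕ} {D : Digraph (Fin n)} {T : Tables} (hT : Ready D T) {a : ℕ}
    (ha : 2 ≤ a) (x y z : ℕ) (r : Fin n → Fin n → Prop) : Ready D (T.setBlock a x y z r) where
  arc u v := by rw [Tables.setBlock_of_table_ne _ (by omega)]; exact hT.arc u v
  reach v x y i j := by rw [Tables.setBlock_of_table_ne _ (by omega)]; exact hT.reach v x y i j

theorem accumulates_shuntCmd {n : ℕ} {D : Digraph (Fin n)} (hD : ∀ v, ¬ D.Adj v v)
    {v s₁ s₂ t₁ t₂ : Fin n} {env : ℕ → ℕ} (hv : Values env v s₁ s₂ t₁ t₂) :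
    Accumulates n 6 env shuntCmd (Ready D) (fun T => T 4 (0, 0, 0, 0, 0))
      ((s₁ ≠ s₂ ∧ t₁ ≠ t₂ ∧ D.Adj v s₁ ∧ D.Adj v s₂ ∧ D.Adj t₁ v ∧
      D.Adj t₂ v) ∧ SetShunt (avoiding D v) {s₁, s₂} {t₁, t₂}) := by
  intro T hT
  have hv' : ∀ i j : Fin n, Values (Function.update (Function.update env 6 i) 7 j) v s₁ s₂ t₁ t₂ :=
    fun i j => (hv.update le_rfl i).update (by omega) j
  obtain ⟨T', e⟩ : ∃ T', T' = T.setBlock 2 0 0 0 (Relation.TransGen fun i j : Fin n =>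
    linkFml.Holds n T 8 (Function.update (Function.update env 6 i) 7 j)) := ⟨_, rfl⟩
  obtain ⟨T'', e'⟩ : ∃ T'', T'' = T'.setBlock 3 0 0 0 (Relation.TransGen fun i j : Fin n =>
    partnerFml.Holds n T' 8 (Function.update (Function.update env 6 i) 7 j)) := ⟨_, rfl⟩
  have hT' : Ready D T' := e ▸ hT.setBlock le_rfl _ _ _ _
  have hT'' : Ready D T'' := e' ▸ hT'.setBlock (by omega) _ _ _ _
  have h4 : T'' 4 = T 4 := by
    rw [e', Tables.setBlock_of_table_ne _ (by omega), e, Tables.setBlock_of_table_ne _ (by omega)]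
  have run : shuntCmd.run n 6 env T = T''.set 4 (0, 0, 0, 0, 0)
      (T 4 (0, 0, 0, 0, 0) ∨ shuntFml.Holds n T'' 6 env) := by
    have r1 := run_all_all_put_of_avoids (n := n) (d := 6) (a := 2) (x := 0) (y := 0) (z := 0)
      (env := env) (φ := linkFml) T (by omega) (by omega) (by omega)
      (by simp [linkFml, usefulFml, cutFml, Fml.Avoids, Fml.or])
    have r2 := fun r => run_closureCmd (n := n) (d := 6) (a := 2) (x := 0) (y := 0) (z := 0)
      (env := env) T r (by omega) (by omega) (by omega)
    have r3 := run_all_all_put_of_avoids (n := n) (d := 6) (a := 3) (x := 0) (y := 0) (z := 0)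
      (env := env) (φ := partnerFml) T' (by omega) (by omega) (by omega)
      (by simp [partnerFml, cutFml, Fml.Avoids])
    have r4 := fun r => run_closureCmd (n := n) (d := 6) (a := 3) (x := 0) (y := 0) (z := 0)
      (env := env) T' r (by omega) (by omega) (by omega)
    simp only [hv.zero] at r1 r2 r3 r4
    simp only [shuntCmd, Cmd.run.eq_2]
    rw [r1, r2, ← e, r3, r4, ← e']
    simp [Cmd.run, Key.subst, hv.zero, h4]
  rw [run]
  refine ⟨⟨hT''.arc, hT''.reach⟩, ?_⟩
  rw [← holds_shuntFml hD hT'' hv ?_ ?_]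
  · simp [Tables.set]
  · intro h₁ h₂ i j
    rw [e', Tables.setBlock_of_table_ne _ (by omega), e, Tables.setBlock_self]
    have : (fun i j : Fin n => linkFml.Holds n T 8 (Function.update (Function.update env 6 i) 7 j))
        = Link (avoiding D v) {s₁, s₂} {t₁, t₂} := funext fun i => funext fun j =>
      propext (holds_linkFml hT (hv' i j) h₁ h₂ (by simp) (by simp))
    rw [this]
  · intro h₁ h₂ i j
    rw [e', Tables.setBlock_self]
    have : (fun i j : Fin n => partnerFml.Holds n T' 8
        (Function.update (Function.update env 6 i) 7 j))
        = Partner (avoiding D v) {s₁, s₂} {t₁, t₂} := funext fun i => funext fun j =>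
      propext (holds_partnerFml hT' (hv' i j) h₁ h₂ (by simp) (by simp))
    rw [this]

theorem run_subdivisionCmd {n : ℕ} (D : Digraph (Fin n)) (hD : ∀ v, ¬ D.Adj v v) :
    subdivisionCmd.run n 1 (fun _ => 0) (arcTables D) 4 (0, 0, 0, 0, 0) ↔
      Nonempty (Subdivision E9 D) := by
  have h := Accumulates.all (n := n) (d := 1) (env := fun _ => 0) fun v =>
    Accumulates.all fun s₁ => Accumulates.all fun s₂ => Accumulates.all fun t₁ =>
    Accumulates.all fun t₂ => accumulates_shuntCmd hD (v := v) (s₁ := s₁) (s₂ := s₂) (t₁ := t₁)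
      (t₂ := t₂) (by constructor <;> simp)
  have h4 : ¬ reachTables D 4 (0, 0, 0, 0, 0) := by
    rintro (⟨h, -⟩ | ⟨h, -⟩) <;> omega
  have run : subdivisionCmd.run n 1 (fun _ => 0) (arcTables D) = _ :=
    congrArg (Cmd.run n 1 (fun _ => 0) (.all (.all (.all (.all (.all shuntCmd))))))
      (run_reachCmd D)
  rw [run]
  -- The answer cell is false at the start and collects the disjunction over all choices of the five
  -- vertices.
  refine (h _ (ready_reachTables D)).2.trans ?_
  constructor
  · rintro (h | ⟨v, s₁, s₂, t₁, t₂, ⟨-, -, e1, e2, e3, e4⟩, hs⟩)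
    · exact absurd h h4
    · obtain ⟨σ, -⟩ := exists_subdivision_of_shunt (v := v) (by rintro rfl; exact hD _ e1)
        (by rintro rfl; exact hD _ e2) e1 e2 e3 e4 hs
      exact ⟨σ⟩
  · rintro ⟨σ⟩
    obtain ⟨s₁, s₂, t₁, t₂, -, -, -, -, h1, h2, e1, e2, e3, e4, hs⟩ := σ.exists_shunt rfl
    exact .inr ⟨σ.vertex 0, s₁, s₂, t₁, t₂, ⟨h1, h2, e1, e2, e3, e4⟩, hs⟩

end RAM

theorem mainTheorem6 :
    RAM.SolvableInTime (fun _ D => Nonempty (Subdivision E9 D)) (fun n m => n ^ 7 * (n + m)) ∧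
    ∀ (V : Type*) (D : Digraph V) (v : V),
      (∃ S : Subdivision E9 D, S.vertex 0 = v) ↔
        ∃ s₁ s₂ t₁ t₂ : {x : V // x ≠ v}, s₁ ≠ s₂ ∧ t₁ ≠ t₂ ∧
          D.Adj v s₁ ∧ D.Adj v s₂ ∧ D.Adj t₁ v ∧ D.Adj t₂ v ∧
          HasShunt (deleteVertex D v) {s₁, s₂} {t₁, t₂} :=
  ⟨RAM.solvableInTime_of_cmd RAM.subdivisionCmd 4 RAM.wf_subdivisionCmd RAM.depth_subdivisionCmd
    (fun _ ⟨σ⟩ => (σ.vertex 0).elim0) fun _ D _ hD => RAM.run_subdivisionCmd D hD,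
    fun _ D v => exists_subdivision_iff_hasShunt D v⟩
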